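/- **Conventions.** Let $\mathbb K$ be a field of characteristic $0$ and let $d\ge 0$ be an integer (only the parity of $d$ matters for the signs). A dg vector space is a $\mathbb Z$-graded $\mathbb K$-vector space with a differential of degree $-1$. A *commutative $\Sigma$-cosimplicial dg vector space* $Y^\bullet$ is a contravariant functor $n_+\mapsto Y^n$ from the category of the finite pointed sets $n_+=\{*,1,\dots,n\}$, $n\ge 0$, to dg vector spaces. For a pointed map $\alpha:m_+\to n_+$ and $y\in Y^n$ write $$\alpha^*y=\Big(\prod_{\alpha(j)=*}x_j\Big)\cdot y\Big(\prod_{\alpha(j)=1}x_j,\dots,\prod_{\alpha(j)=n}x_j\Big)\in Y^m,$$ where the $x_j$ are commuting formal variables. The underlying cosimplicial dg vector space has the cofaces $d_0y=x_1\,y(x_2,\dots,x_{n+1})$, $d_iy=y(\dots,x_ix_{i+1},\dots)$ for $1\le i\le n$, $d_{n+1}y=y(x_1,\dots,x_n)\,x_{n+1}$, and its codegeneracies substitute $1$ for a variable. Its totalization is $$\operatorname{Tot}Y^\bullet=\bigoplus_{n\ge0}\Big(\bigcap_i\ker s_i\subset Y^n\Big)[-n]$$ (an element of degree $k$ in $Y^n$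 has total degree $k-n$), with the differential $\sum_i(-1)^id_i+(-1)^n\partial$ on $Y^n$. An element $y\in Y^n$ is *alternating* if $y(x_{\sigma_1},\dots,x_{\sigma_n})=(-1)^{|\sigma|}y(x_1,\dots,x_n)$ for all $\sigma\in S_n$, and a *multiderivation* if for $i=1,\dots,n$ $$y(x_1,\dots,x_ix_{i+1},\dots,x_{n+1})=x_i\,y(x_1,\dots,\hat x_i,\dots,x_{n+1})+y(x_1,\dots,\hat x_{i+1},\dots,x_{n+1})\,x_{i+1}.$$ The alternating multiderivations form a subcomplex $AM(Y^\bullet)\subset\operatorname{Tot}Y^\bullet$, and $Y^\bullet$ is *smooth* if this inclusion is a quasi-isomorphism. **Graphs.** Consider finite graphs, with loops and multiple edges allowed, with $n$ external vertices and with internal vertices. An *orientation* consists of a direction of every edge and an ordering of the orientation set, which consists of the internal vertices, of degree $-d$, and of the edges, of degree $d-1$. The degree of a graph is the sum of these degrees. Oriented graphs are considered up to isomorphism and modulo the relations: reversing an edge multiplies by $(-1)^d$, and permuting the orientation set multiplies by the Koszul sign. A graph is *admissible* if its internal vertices have valence at least $3$ and each connected component contains an external vertex. $D_d(n)$ is spanned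 by the oriented admissible graphs with $n$ external vertices, labelled $1,\dots,n$ (of any valence), and $P_d(n)\subset D_d(n)$, its primitive part for the cosuperimposing coproduct, is spanned by those which become connected (and non-empty) when the external vertices are removed together with small neighbourhoods. The differential $\partial$ is the sum of the expansions of the vertices: an expansion of a vertex $v$ moves a set of half-edges from $v$ to a new internal vertex connected to $v$ by a new edge, directed from $v$ to the new vertex; the new vertex, and $v$ if it is internal, must have valence at least $3$ afterwards; the new vertex and the new edge are put, in this order, in front of the orientation set. The two descriptions of an expansion of an internal vertex, which differ by the exchange of the two resulting vertices, are counted as one expansion. For a pointed map $\alpha:m_+\to n_+$, $\alpha^*\Gamma$ is the sum of all the graphs obtained from $\Gamma$ by replacing its external vertices by $m$ new ones and attaching each half-edge at the external vertex $i$ to one of the vertices in $\alpha^{-1}(i)$. (These maps come from the operadic compositions with the edgeless graphs, which represent the operad $\mathcal{COMM}$.) This defines commutative $\Sigma$-cosimplicial dg vector spaces $D_d^\bullet$ and $P_d^\bullet$, with $D_d^n=D_d(n)$, $P_d^n=P_d(n)$. The graph complex of *uni-$\ge3$-valent graphs* $\mathcal G(D_d)$ is spanned by the oriented, possibly empty or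 disconnected, graphs with unlabelled univalent external vertices, with internal vertices of valence at least $3$, and with an external vertex in every component. Here the external vertices, of degree $-1$, belong to the orientation set as well, the orientation relations are as above, and the differential is the sum of the expansions of the internal vertices, with the same rule of signs. $\mathcal G(P_d)\subset\mathcal G(D_d)$ is the subcomplex spanned by the connected non-empty graphs. **Theorem.** The commutative $\Sigma$-cosimplicial dg vector spaces $D_d^\bullet$ and $P_d^\bullet$ are smooth: the inclusions $AM(D_d^\bullet)\hookrightarrow\operatorname{Tot}D_d^\bullet$ and $AM(P_d^\bullet)\hookrightarrow\operatorname{Tot}P_d^\bullet$ are quasi-isomorphisms. Moreover, there are isomorphisms of dg vector spaces $$AM(D_d^\bullet)\cong\mathcal G(D_d),\qquad AM(P_d^\bullet)\cong\mathcal G(P_d),$$ both given by forgetting the labels of the external vertices, the external vertices $1,\dots,n$ being put, in this order, in front of the orientation set. -/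

import Mathlib

open scoped DirectSum

universe u

noncomputable section

namespace GC

/-! ## Graded modules and dg vector spaces -/

/-- A family of submodules with a compatible system of projections is a direct sum decomposition. -/
theorem isInternal_of_proj {K M ι : Type*} [DecidableEq ι] [Field K] [AddCommGroup M] [Module K M]
    (A : ι → Submodule K M) (p : ι → M →ₗ[K] M)
    (h1 : ∀ k, ∀ x ∈ A k, p k x = x) (h2 : ∀ k l, l ≠ k → ∀ x ∈ A l, p k x = 0)
    (h3 : iSup A = ⊤) : DirectSum.IsInternal A := by
  refine DirectSum.isInternal_submodule_of_iSupIndep_of_iSup_eq_top ?_ h3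
  rw [iSupIndep_def]
  intro k
  rw [Submodule.disjoint_def]
  intro x hx hx'
  have : (⨆ j, ⨆ (_ : j ≠ k), A j) ≤ LinearMap.ker (p k) :=
    iSup_le fun j => iSup_le fun hj y hy => h2 k j hj y hy
  rw [← h1 k x hx]
  exact this hx'

/-- A dg vector space over `K`: a `ℤ`-graded vector space with a differential of degree `-1`. -/
structure DGVect (K : Type u) [Field K] where
  carrier : Type u
  [grp : AddCommGroup carrier]
  [mod : Module K carrier]
  /-- the homogeneous components -/
  deg : ℤ → Submodule K carrier
  isInternal : DirectSum.IsInternal deg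
  d : carrier →ₗ[K] carrier
  d_mem : ∀ k, ∀ x ∈ deg k, d x ∈ deg (k - 1)
  d_d : ∀ x, d (d x) = 0

attribute [instance] DGVect.grp DGVect.mod

instance {K : Type u} [Field K] : CoeSort (DGVect K) (Type u) := ⟨DGVect.carrier⟩

namespace DGVect

variable {K : Type u} [Field K]

theorem bij (C : DGVect K) : Function.Bijective (DirectSum.coeLinearMap C.deg) := C.isInternal

/-- The projection to the component of degree `k`. -/
def proj (C : DGVect K) (k : ℤ) : C →ₗ[K] C :=
  (C.deg k).subtype ∘ₗ DirectSum.component K ℤ (fun i => C.deg i) k ∘ₗ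
    (LinearEquiv.ofBijective (DirectSum.coeLinearMap C.deg) C.bij).symm.toLinearMap

theorem proj_mem (C : DGVect K) (k : ℤ) (x : C) : C.proj k x ∈ C.deg k :=
  Subtype.coe_prop _

theorem symm_of_mem (C : DGVect K) (k : ℤ) (x : C) (hx : x ∈ C.deg k) :
    (LinearEquiv.ofBijective (DirectSum.coeLinearMap C.deg) C.bij).symm x =
      DirectSum.lof K ℤ (fun i => C.deg i) k ⟨x, hx⟩ := by
  rw [LinearEquiv.symm_apply_eq, LinearEquiv.ofBijective_apply, DirectSum.coeLinearMap_lof]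

theorem proj_self (C : DGVect K) (k : ℤ) (x : C) (hx : x ∈ C.deg k) : C.proj k x = x := by
  simp [proj, symm_of_mem C k x hx, DirectSum.component.lof_self]

theorem proj_ne (C : DGVect K) (k l : ℤ) (h : l ≠ k) (x : C) (hx : x ∈ C.deg l) :
    C.proj k x = 0 := by
  simp [proj, symm_of_mem C l x hx, DirectSum.component.of, h]

theorem iSup_deg (C : DGVect K) : iSup C.deg = ⊤ := C.isInternal.submodule_iSup_eq_top

theorem induction (C : DGVect K) {P : C → Prop} (x : C) (h : ∀ k, ∀ y ∈ C.deg k, P y)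
    (h0 : P 0) (hadd : ∀ y z, P y → P z → P (y + z)) : P x :=
  Submodule.iSup_induction C.deg (motive := P) (C.iSup_deg ▸ Submodule.mem_top : x ∈ iSup C.deg) h h0 hadd

/-- Every element is the sum of its homogeneous components. -/
theorem exists_sum (C : DGVect K) (x : C) : ∃ s : Finset ℤ, ∑ k ∈ s, C.proj k x = x := by
  classical
  refine C.induction (P := fun x => ∃ s : Finset ℤ, ∀ t, s ⊆ t → ∑ k ∈ t, C.proj k x = x)
    x ?_ ?_ ?_ |>.imp fun s hs => hs s subset_rfl
  · intro k y hy
    refine ⟨{k}, fun t ht => ?_⟩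
    rw [Finset.sum_eq_single_of_mem k (ht (Finset.mem_singleton_self k)), C.proj_self k y hy]
    intro l _ hl
    exact C.proj_ne l k hl.symm y hy
  · exact ⟨∅, fun t _ => by simp⟩
  · rintro y z ⟨s, hs⟩ ⟨t, ht⟩
    refine ⟨s ∪ t, fun r hr => ?_⟩
    simp only [map_add, Finset.sum_add_distrib]
    rw [hs r (Finset.union_subset_left hr), ht r (Finset.union_subset_right hr)]

/-- A degree-preserving linear map commutes with the projections. -/
theorem map_proj {C C' : DGVect K} (f : C →ₗ[K] C')
    (hf : ∀ k, ∀ x ∈ C.deg k, f x ∈ C'.deg k) (k : ℤ) (x : C) :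
    f (C.proj k x) = C'.proj k (f x) := by
  refine C.induction (P := fun x => f (C.proj k x) = C'.proj k (f x)) x ?_ (by simp)
    (fun y z hy hz => by simp [hy, hz])
  intro l y hy
  by_cases h : l = k
  · subst h
    rw [C.proj_self l y hy, C'.proj_self l _ (hf l y hy)]
  · rw [C.proj_ne k l h y hy, C'.proj_ne k l h _ (hf l y hy), map_zero]

/-- A submodule is homogeneous if it contains the homogeneous components of its elements. -/
def Homogeneous (C : DGVect K) (S : Submodule K C) : Prop := ∀ x ∈ S, ∀ k, C.proj k x ∈ S

theorem homogeneous_span (C : DGVect K) (s : Set C) (h : ∀ x ∈ s, ∃ k, x ∈ C.deg k) :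
    C.Homogeneous (Submodule.span K s) := by
  intro x hx k
  induction hx using Submodule.span_induction with
  | mem y hy =>
    obtain ⟨l, hl⟩ := h y hy
    by_cases hlk : l = k
    · subst hlk
      rw [C.proj_self l y hl]
      exact Submodule.subset_span hy
    · rw [C.proj_ne k l hlk y hl]
      exact zero_mem _
  | zero => simp
  | add y z _ _ hy hz => simpa using add_mem hy hz
  | smul a y _ hy => simpa using Submodule.smul_mem _ a hy

/-- The dg subspace on a homogeneous submodule stable under the differential. -/
def sub (C : DGVect K) (S : Submodule K C) (hS : C.Homogeneous S)
    (hd : ∀ x ∈ S, C.d x ∈ S) : DGVect K where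
  carrier := S
  deg k := (C.deg k).comap S.subtype
  isInternal := by
    refine isInternal_of_proj _ (fun k => (C.proj k).restrict fun x hx => hS x hx k) ?_ ?_ ?_
    · rintro k ⟨x, hx⟩ hk
      exact Subtype.ext (C.proj_self k x hk)
    · rintro k l hkl ⟨x, hx⟩ hk
      exact Subtype.ext (C.proj_ne k l hkl x hk)
    · rw [eq_top_iff]
      rintro ⟨x, hx⟩ -
      obtain ⟨s, hs⟩ := C.exists_sum x
      have : (⟨x, hx⟩ : S) = ∑ k ∈ s, ⟨C.proj k x, hS x hx k⟩ := by
        apply Subtype.ext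
        simp [hs]
      rw [this]
      exact Submodule.sum_mem _ fun k _ =>
        Submodule.mem_iSup_of_mem k (C.proj_mem k x)
  d := C.d.restrict hd
  d_mem := fun k x hx => C.d_mem k _ hx
  d_d := fun x => Subtype.ext (C.d_d _)

/-- The inclusion of a dg subspace. -/
def subVal (C : DGVect K) (S : Submodule K C) (hS : C.Homogeneous S)
    (hd : ∀ x ∈ S, C.d x ∈ S) : C.sub S hS hd →ₗ[K] C := S.subtype

/-- The homology (cycles modulo boundaries) of a dg vector space. -/
def Homology (C : DGVect K) : Type u :=
  LinearMap.ker C.d ⧸ (LinearMap.range C.d).comap (LinearMap.ker C.d).subtype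

instance (C : DGVect K) : AddCommGroup C.Homology :=
  inferInstanceAs (AddCommGroup (_ ⧸ _))

instance (C : DGVect K) : Module K C.Homology :=
  inferInstanceAs (Module K (_ ⧸ (LinearMap.range C.d).comap (LinearMap.ker C.d).subtype))

/-- Morphisms of dg vector spaces: linear chain maps of degree `0`. -/
structure Hom (C C' : DGVect K) where
  toLin : C →ₗ[K] C'
  map_deg : ∀ k, ∀ x ∈ C.deg k, toLin x ∈ C'.deg k
  comm : ∀ x, toLin (C.d x) = C'.d (toLin x)

/-- The map induced in homology. -/
def Hom.homologyMap {C C' : DGVect K} (f : Hom C C') : C.Homology →ₗ[K] C'.Homology :=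
  Submodule.mapQ _ _
    (f.toLin.restrict (p := LinearMap.ker C.d) (q := LinearMap.ker C'.d) (fun x hx => by
      rw [LinearMap.mem_ker] at hx ⊢
      rw [← f.comm, hx, map_zero]))
    (by
      rintro ⟨x, hx⟩ ⟨y, hy⟩
      exact ⟨f.toLin y, by rw [← f.comm, hy]; rfl⟩)

/-- Quasi-isomorphisms: the induced map on the (total, graded) homology is bijective.  Since the map
has degree `0`, this is the same as bijectivity in every degree. -/
def Hom.IsQuasiIso {C C' : DGVect K} (f : Hom C C') : Prop := Function.Bijective f.homologyMap

/-- Isomorphisms of dg vector spaces. -/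
structure Iso (C C' : DGVect K) where
  toEquiv : C ≃ₗ[K] C'
  map_deg : ∀ k x, toEquiv x ∈ C'.deg k ↔ x ∈ C.deg k
  comm : ∀ x, toEquiv (C.d x) = C'.d (toEquiv x)

/-- The inclusion of nested dg subspaces. -/
def subIncl (C : DGVect K) {S T : Submodule K C} (hS : C.Homogeneous S)
    (hdS : ∀ x ∈ S, C.d x ∈ S) (hT : C.Homogeneous T) (hdT : ∀ x ∈ T, C.d x ∈ T) (h : S ≤ T) :
    Hom (C.sub S hS hdS) (C.sub T hT hdT) where
  toLin := Submodule.inclusion h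
  map_deg := fun _ _ hx => hx
  comm := fun _ => rfl

/-! ### The total complex of a sequence of dg vector spaces -/

/-- The degree `k` part of `⨁ₙ Cₙ[-n]`: the component in `Cₙ` has degree `k + n`. -/
def totalDeg (C : ℕ → DGVect K) (k : ℤ) : Submodule K (⨁ n, C n) where
  carrier := {x | ∀ n : ℕ, x n ∈ (C n).deg (k + n)}
  add_mem' := fun hx hy n => by simpa using add_mem (hx n) (hy n)
  zero_mem' := fun n => by simp
  smul_mem' := fun a x hx n => Submodule.smul_mem _ a (hx n)

/-- The total differential `x ↦ δ x + (-1)ⁿ d x` for `x ∈ Cₙ`. -/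
def totalD (C : ℕ → DGVect K) (δ : ∀ n, C n →ₗ[K] C (n + 1)) :
    (⨁ n, C n) →ₗ[K] (⨁ n, C n) :=
  DirectSum.toModule K ℕ _ fun n =>
    DirectSum.lof K ℕ (fun n => C n) (n + 1) ∘ₗ δ n +
      (-1 : K) ^ n • (DirectSum.lof K ℕ (fun n => C n) n ∘ₗ (C n).d)

theorem totalD_lof (C : ℕ → DGVect K) (δ : ∀ n, C n →ₗ[K] C (n + 1)) (n : ℕ) (x : C n) :
    totalD C δ (DirectSum.lof K ℕ (fun n => C n) n x) =
      DirectSum.lof K ℕ (fun n => C n) (n + 1) (δ n x) +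
        (-1 : K) ^ n • DirectSum.lof K ℕ (fun n => C n) n ((C n).d x) := by
  simp [totalD]

theorem lof_mem_totalDeg (C : ℕ → DGVect K) (n : ℕ) (k : ℤ) (x : C n)
    (hx : x ∈ (C n).deg (k + n)) :
    DirectSum.lof K ℕ (fun n => C n) n x ∈ totalDeg C k := by
  intro m
  by_cases h : n = m
  · subst h
    simpa using hx
  · have : (DirectSum.lof K ℕ (fun n => C n) n x) m = 0 :=
      DirectSum.of_eq_of_ne (β := fun n => (C n).carrier) n m x (Ne.symm h)
    rw [this]
    exact zero_mem _

theorem total_ind (C : ℕ → DGVect K) {P : (⨁ n, C n) → Prop} (h0 : P 0)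
    (h : ∀ n x, P (DirectSum.lof K ℕ (fun n => C n) n x)) (hadd : ∀ x y, P x → P y → P (x + y))
    (x) : P x :=
  DirectSum.induction_on x h0 (fun n x => h n x) hadd

/-- An element of `⨁ₙ Cₙ` is the sum of its components. -/
theorem eq_sum_lof (C : ℕ → DGVect K) (x : ⨁ n, C n) :
    ∃ s : Finset ℕ, x = ∑ n ∈ s, DirectSum.lof K ℕ (fun n => C n) n (x n) := by
  classical
  exact ⟨DFinsupp.support x, (DirectSum.sum_support_of x).symm⟩

/-- The total dg vector space `⨁ₙ Cₙ[-n]` with differential `δ ± d`. -/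
def total (C : ℕ → DGVect K) (δ : ∀ n, C n →ₗ[K] C (n + 1))
    (hdeg : ∀ n k, ∀ x ∈ (C n).deg k, δ n x ∈ (C (n + 1)).deg k)
    (hcomm : ∀ n x, δ n ((C n).d x) = (C (n + 1)).d (δ n x))
    (hsq : ∀ n x, δ (n + 1) (δ n x) = 0) : DGVect K where
  carrier := ⨁ n, C n
  deg := totalDeg C
  isInternal := by
    refine isInternal_of_proj _
      (fun k => DFinsupp.mapRange.linearMap fun n => (C n).proj (k + n)) ?_ ?_ ?_
    · intro k x hx
      exact DFinsupp.ext fun n => (C n).proj_self _ _ (hx n)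
    · intro k l hkl x hx
      exact DFinsupp.ext fun n => (C n).proj_ne _ (l + n) (by simpa using hkl) _ (hx n)
    · rw [eq_top_iff]
      rintro x -
      refine total_ind C (P := fun x => x ∈ iSup (totalDeg C)) (zero_mem _) ?_
        (fun x y => add_mem) x
      intro n y
      refine (C n).induction
        (P := fun y => DirectSum.lof K ℕ (fun n => C n) n y ∈ iSup (totalDeg C)) y ?_ (by simp)
        (fun y z hy hz => by rw [map_add]; exact add_mem hy hz)
      intro k z hz
      exact Submodule.mem_iSup_of_mem (k - n) (lof_mem_totalDeg C n _ z (by simpa using hz))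
  d := totalD C δ
  d_mem := by
    intro k x hx
    obtain ⟨s, hs⟩ := eq_sum_lof C x
    rw [hs, map_sum]
    refine Submodule.sum_mem _ fun n _ => ?_
    rw [totalD_lof]
    refine add_mem (lof_mem_totalDeg C _ _ _ ?_)
      (Submodule.smul_mem _ _ (lof_mem_totalDeg C _ _ _ ?_))
    · have := hdeg n _ _ (hx n)
      convert this using 2
      push_cast
      ring
    · have := (C n).d_mem _ _ (hx n)
      convert this using 2
      ring
  d_d := by
    intro x
    refine total_ind C (P := fun x => totalD C δ (totalD C δ x) = 0) (by simp) ?_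
      (fun x y hx hy => by simp [hx, hy]) x
    intro n y
    rw [totalD_lof, map_add, map_smul, totalD_lof, totalD_lof, hsq, (C n).d_d, hcomm, pow_succ]
    simp

/-- The submodule of `⨁ₙ Cₙ` of the elements with components in the given submodules. -/
def sumSub (C : ℕ → DGVect K) (S : ∀ n, Submodule K (C n)) : Submodule K (⨁ n, C n) where
  carrier := {x | ∀ n, x n ∈ S n}
  add_mem' := fun hx hy n => by simpa using add_mem (hx n) (hy n)
  zero_mem' := fun n => by simp
  smul_mem' := fun a x hx n => Submodule.smul_mem _ a (hx n)

theorem lof_mem_sumSub (C : ℕ → DGVect K) (S : ∀ n, Submodule K (C n)) (n : ℕ) (x : C n)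
    (hx : x ∈ S n) : DirectSum.lof K ℕ (fun n => C n) n x ∈ sumSub C S := by
  intro m
  by_cases h : n = m
  · subst h
    simpa using hx
  · have : (DirectSum.lof K ℕ (fun n => C n) n x) m = 0 :=
      DirectSum.of_eq_of_ne (β := fun n => (C n).carrier) n m x (Ne.symm h)
    rw [this]
    exact zero_mem _

section totalSub

variable (C : ℕ → DGVect K) (δ : ∀ n, C n →ₗ[K] C (n + 1))
    (hdeg : ∀ n k, ∀ x ∈ (C n).deg k, δ n x ∈ (C (n + 1)).deg k)
    (hcomm : ∀ n x, δ n ((C n).d x) = (C (n + 1)).d (δ n x))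
    (hsq : ∀ n x, δ (n + 1) (δ n x) = 0) (S : ∀ n, Submodule K (C n))

/-- The component in `Cₙ` of an element of the total dg vector space. -/
def totalComponent (n : ℕ) : total C δ hdeg hcomm hsq →ₗ[K] C n :=
  DirectSum.component K ℕ (fun n => C n) n

theorem totalComponent_proj (k : ℤ) (x : total C δ hdeg hcomm hsq) (n : ℕ) :
    totalComponent C δ hdeg hcomm hsq n ((total C δ hdeg hcomm hsq).proj k x) =
      (C n).proj (k + n) (totalComponent C δ hdeg hcomm hsq n x) := by
  refine (total C δ hdeg hcomm hsq).induction
    (P := fun x => totalComponent C δ hdeg hcomm hsq n ((total C δ hdeg hcomm hsq).proj k x) =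
      (C n).proj (k + n) (totalComponent C δ hdeg hcomm hsq n x)) x ?_ (by simp) ?_
  · intro l y hy
    have hy' : totalComponent C δ hdeg hcomm hsq n y ∈ (C n).deg (l + n) := hy n
    by_cases h : l = k
    · subst h
      rw [(total C δ hdeg hcomm hsq).proj_self l y hy, (C n).proj_self _ _ hy']
    · rw [(total C δ hdeg hcomm hsq).proj_ne k l h y hy,
        (C n).proj_ne _ (l + n) (by simpa using h) _ hy', map_zero]
  · intro y z hy hz
    simp only [map_add, hy, hz]

theorem homogeneous_sumSub (hS : ∀ n, (C n).Homogeneous (S n)) :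
    (total C δ hdeg hcomm hsq).Homogeneous (sumSub C S) := by
  intro x hx k n
  have := totalComponent_proj C δ hdeg hcomm hsq k x n
  exact this ▸ hS n _ (hx n) _

theorem d_mem_sumSub (hd : ∀ n, ∀ x ∈ S n, (C n).d x ∈ S n)
    (hδ : ∀ n, ∀ x ∈ S n, δ n x ∈ S (n + 1)) :
    ∀ x ∈ sumSub C S, (total C δ hdeg hcomm hsq).d x ∈ sumSub C S := by
  intro x hx
  change totalD C δ x ∈ _
  have hx' : ∀ n, x n ∈ S n := hx
  obtain ⟨s, hs⟩ := eq_sum_lof C x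
  rw [hs, map_sum]
  refine Submodule.sum_mem _ fun n _ => ?_
  rw [totalD_lof]
  exact add_mem (lof_mem_sumSub C S _ _ (hδ n _ (hx' n)))
    (Submodule.smul_mem _ _ (lof_mem_sumSub C S _ _ (hd n _ (hx' n))))

end totalSub

end DGVect

/-! ## Commutative `Σ`-cosimplicial dg vector spaces -/

/-- A commutative `Σ`-cosimplicial dg vector space: a contravariant functor from the category of the
finite pointed sets `n₊ = {*, 1, …, n}` to dg vector spaces.  A pointed map `m₊ → n₊` is given by its
values on `1, …, m`, the base point of `n₊` being `none`. In the notation with formal variables,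
`map α y = (∏_{α j = *} x_j) · y (∏_{α j = 1} x_j, …, ∏_{α j = n} x_j)`. -/
structure CommCosimplicial (K : Type u) [Field K] where
  obj : ℕ → DGVect K
  map : ∀ {m n : ℕ}, (Fin m → Option (Fin n)) → (obj n →ₗ[K] obj m)
  map_deg : ∀ {m n : ℕ} (α : Fin m → Option (Fin n)) (k : ℤ),
    ∀ x ∈ (obj n).deg k, map α x ∈ (obj m).deg k
  map_d : ∀ {m n : ℕ} (α : Fin m → Option (Fin n)) (x : obj n),
    map α ((obj n).d x) = (obj m).d (map α x)
  map_id : ∀ {n : ℕ} (x : obj n), map (fun j : Fin n => some j) x = x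
  map_comp : ∀ {l m n : ℕ} (β : Fin l → Option (Fin m)) (α : Fin m → Option (Fin n)) (x : obj n),
    map β (map α x) = map (fun j => (β j).bind α) x

/-- The pointed map `(n+1)₊ → n₊` that induces the coface `dᵢ`, `0 ≤ i ≤ n + 1`, in terms of the
points `1, …, n + 1`: it is monotone and identifies `i` with `i + 1`, where `0` and `n + 1` (in the
target), `0` and `n + 2` (in the source) stand for the base point. -/
def coface (n : ℕ) (i : Fin (n + 2)) : Fin (n + 1) → Option (Fin n) := fun j =>
  let c : ℕ := if (j : ℕ) + 1 ≤ i then j + 1 else j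
  if h : 1 ≤ c ∧ c ≤ n then some ⟨c - 1, by omega⟩ else none

/-- The injective pointed map `n₊ → (n+1)₊` that induces a codegeneracy: it misses the point `i`. -/
def codegen (n : ℕ) (i : Fin (n + 1)) : Fin n → Option (Fin (n + 1)) := fun j => some (i.succAbove j)

/-- The pointed map that substitutes the product `xᵢ xᵢ₊₁` for the `i`-th variable. -/
def mergeMap {n : ℕ} (i : Fin n) : Fin (n + 1) → Option (Fin n) := fun j => some (i.predAbove j)

/-- The pointed map that sends the point `k` to the base point and is monotone on the others:
`y ↦ x_k · y (x_1, …, x̂_k, …, x_{n+1})`. -/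
def splitMap {n : ℕ} (k : Fin (n + 1)) : Fin (n + 1) → Option (Fin n) := finSuccEquiv' k

theorem coface_eq_some {n : ℕ} (i : Fin (n + 2)) (j : Fin (n + 1)) (p : Fin n) :
    coface n i j = some p ↔ (p : ℕ) + 1 = if (j : ℕ) + 1 ≤ i then (j : ℕ) + 1 else j := by
  have := p.2
  simp only [coface]
  split_ifs <;> simp [Fin.ext_iff] <;> omega

theorem coface_castSucc_succ {n : ℕ} (i : Fin n) : coface n i.succ.castSucc = mergeMap i := by
  funext j
  have := i.2
  have := j.2
  rw [mergeMap, coface_eq_some]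
  simp only [Fin.predAbove, Fin.lt_def, Fin.val_castSucc, Fin.val_succ]
  split_ifs <;> simp <;> omega

theorem coface_zero (n : ℕ) : coface n 0 = splitMap 0 := by
  funext j
  refine Fin.cases ?_ (fun j => ?_) j
  · simp [coface, splitMap]
  · simp [coface, splitMap, finSuccEquiv'_zero]

theorem coface_last (n : ℕ) : coface n (Fin.last (n + 1)) = splitMap (Fin.last n) := by
  funext j
  refine Fin.lastCases ?_ (fun j => ?_) j
  · simp [coface, splitMap]
  · have := j.2
    rw [splitMap, finSuccEquiv'_last_apply_castSucc, coface_eq_some]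
    simp

theorem coface_bind_eq_some {n : ℕ} (i : Fin (n + 2)) (j : Fin (n + 3)) (k : Fin (n + 2))
    (p : Fin n) : (coface (n + 1) j k).bind (coface n i) = some p ↔
      ∃ q : ℕ, (q + 1 = if (k : ℕ) + 1 ≤ j then (k : ℕ) + 1 else k) ∧
        (p : ℕ) + 1 = if q + 1 ≤ i then q + 1 else q := by
  simp only [Option.bind_eq_some_iff, coface_eq_some]
  constructor
  · rintro ⟨q, h⟩
    exact ⟨q, h⟩
  · rintro ⟨q, h1, h2⟩
    have := k.2
    have := p.2
    have := i.2
    have : q < n + 1 := by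
      split_ifs at h1 h2 <;> omega
    exact ⟨⟨q, this⟩, h1, h2⟩

theorem coface_comp {n : ℕ} (i : Fin (n + 2)) (j : Fin (n + 3)) (h : (j : ℕ) ≤ i) :
    (fun k => (coface (n + 1) j k).bind (coface n i)) =
      fun k => (coface (n + 1) i.succ k).bind (coface n ⟨j, by omega⟩) := by
  funext k
  refine Option.ext fun p => ?_
  rw [coface_bind_eq_some, coface_bind_eq_some]
  have := i.2
  have := k.2
  simp only [Fin.val_succ]
  constructor
  · rintro ⟨q, h1, h2⟩
    refine ⟨if (k : ℕ) + 1 ≤ i + 1 then k else k - 1, ?_, ?_⟩ <;> split_ifs at * <;> omega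
  · rintro ⟨q, h1, h2⟩
    refine ⟨if (k : ℕ) + 1 ≤ j then k else k - 1, ?_, ?_⟩ <;> split_ifs at * <;> omega

theorem codegen_bind_coface {n : ℕ} (i : Fin (n + 2)) (j : Fin (n + 1)) (k p : Fin n) :
    (codegen n j k).bind (coface n i) = some p ↔
      ∃ q : ℕ, q = (if (k : ℕ) < j then (k : ℕ) else k + 1) ∧
        (p : ℕ) + 1 = if q + 1 ≤ i then q + 1 else q := by
  simp only [codegen, Option.bind_some, coface_eq_some, exists_eq_left, Fin.succAbove, Fin.lt_def,
    Fin.val_castSucc]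
  split_ifs <;> simp_all

theorem codegen_bind_coface_self {n : ℕ} (i : Fin (n + 2)) (j : Fin (n + 1)) (k : Fin n)
    (h : i = j.castSucc ∨ i = j.succ) : (codegen n j k).bind (coface n i) = some k := by
  rw [codegen_bind_coface, exists_eq_left]
  rcases h with rfl | rfl <;> simp only [Fin.val_castSucc, Fin.val_succ] <;> split_ifs <;> omega

namespace CommCosimplicial

variable {K : Type u} [Field K] (Y : CommCosimplicial K)

/-- The alternating sum of the cofaces. -/
def cofaceSum (n : ℕ) : Y.obj n →ₗ[K] Y.obj (n + 1) :=
  ∑ i : Fin (n + 2), (-1 : K) ^ (i : ℕ) • Y.map (coface n i)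

theorem cofaceSum_apply (n : ℕ) (x : Y.obj n) :
    Y.cofaceSum n x = ∑ i : Fin (n + 2), (-1 : K) ^ (i : ℕ) • Y.map (coface n i) x := by
  simp [cofaceSum]

theorem cofaceSum_deg (n : ℕ) (k : ℤ) (x : Y.obj n) (hx : x ∈ (Y.obj n).deg k) :
    Y.cofaceSum n x ∈ (Y.obj (n + 1)).deg k := by
  rw [cofaceSum_apply]
  exact Submodule.sum_mem _ fun i _ => Submodule.smul_mem _ _ (Y.map_deg _ _ _ hx)

theorem cofaceSum_d (n : ℕ) (x : Y.obj n) :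
    Y.cofaceSum n ((Y.obj n).d x) = (Y.obj (n + 1)).d (Y.cofaceSum n x) := by
  simp [cofaceSum_apply, Y.map_d]

theorem cofaceSum_sq (n : ℕ) (x : Y.obj n) : Y.cofaceSum (n + 1) (Y.cofaceSum n x) = 0 := by
  simp only [cofaceSum_apply, map_sum, map_smul, Finset.smul_sum, smul_smul, Y.map_comp]
  rw [← Fintype.sum_prod_type']
  let S : Finset (Fin (n + 2) × Fin (n + 3)) := {ij | (ij.2 : ℕ) ≤ (ij.1 : ℕ)}
  rw [← Finset.sum_add_sum_compl S, ← eq_neg_iff_add_eq_zero, ← Finset.sum_neg_distrib]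
  refine Finset.sum_bij (fun ij hij =>
    ((⟨ij.2, lt_of_le_of_lt (Finset.mem_filter.mp hij).2 ij.1.2⟩, ij.1.succ) :
      Fin (n + 2) × Fin (n + 3))) ?_ ?_ ?_ ?_
  · rintro ⟨i, j⟩ hij
    simp only [S, Finset.mem_filter_univ, Finset.mem_compl, Fin.val_succ] at hij ⊢
    omega
  · rintro ⟨i, j⟩ hij ⟨i', j'⟩ hij' h
    simp only [Prod.mk.injEq, Fin.ext_iff, Fin.val_succ] at h ⊢
    omega
  · rintro ⟨i, j⟩ hij
    simp only [S, Finset.mem_filter_univ, Finset.mem_compl, not_le] at hij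
    refine ⟨(⟨j - 1, by omega⟩, ⟨i, by omega⟩), ?_, ?_⟩
    · simp only [S, Finset.mem_filter_univ]
      omega
    · simp only [Prod.mk.injEq, Fin.ext_iff, Fin.val_succ, true_and]
      omega
  · rintro ⟨i, j⟩ hij
    have hij' : (j : ℕ) ≤ i := (Finset.mem_filter.mp hij).2
    dsimp only
    rw [coface_comp i j hij', ← neg_smul]
    congr 1
    rw [Fin.val_succ]
    ring

/-- The (unnormalized) cochain complex `⨁ₙ Yⁿ`, the differential being the alternating sum of the
cofaces plus `(-1)ⁿ` times the internal differential. -/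
def cochains : DGVect K :=
  DGVect.total Y.obj Y.cofaceSum Y.cofaceSum_deg Y.cofaceSum_d Y.cofaceSum_sq

/-- The normalized part of `Yⁿ`: the intersection of the kernels of the codegeneracies. -/
def normalized : (n : ℕ) → Submodule K (Y.obj n)
  | 0 => ⊤
  | n + 1 => ⨅ i : Fin (n + 1), LinearMap.ker (Y.map (codegen n i))

/-- `y(x_1, …, x_i x_{i+1}, …) = x_i y(…, x̂_i, …) + y(…, x̂_{i+1}, …) x_{i+1}` for all `i`. -/
def IsMultiderivation {n : ℕ} (y : Y.obj n) : Prop :=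
  ∀ i : Fin n, Y.map (mergeMap i) y = Y.map (splitMap i.castSucc) y + Y.map (splitMap i.succ) y

/-- `y(x_{σ 1}, …, x_{σ n}) = (-1)^σ y(x_1, …, x_n)` for all `σ`. -/
def IsAlternating {n : ℕ} (y : Y.obj n) : Prop :=
  ∀ σ : Equiv.Perm (Fin n),
    Y.map (fun j => some (σ.symm j)) y = ((Equiv.Perm.sign σ : ℤ) : K) • y

/-- The space of alternating multiderivations in `Yⁿ`. -/
def altMulti (n : ℕ) : Submodule K (Y.obj n) where
  carrier := {y | Y.IsAlternating y ∧ Y.IsMultiderivation y}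
  add_mem' := by
    rintro x y ⟨hx, hx'⟩ ⟨hy, hy'⟩
    refine ⟨fun σ => ?_, fun i => ?_⟩
    · rw [map_add, hx σ, hy σ, smul_add]
    · rw [map_add, hx' i, hy' i, map_add, map_add]
      abel
  zero_mem' := ⟨fun σ => by simp, fun i => by simp⟩
  smul_mem' := by
    rintro a x ⟨hx, hx'⟩
    refine ⟨fun σ => ?_, fun i => ?_⟩
    · rw [map_smul, hx σ, smul_comm]
    · rw [map_smul, hx' i, map_smul, map_smul, smul_add]

theorem homogeneous_normalized (n : ℕ) : (Y.obj n).Homogeneous (Y.normalized n) := by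
  intro x hx k
  cases n with
  | zero => trivial
  | succ n =>
    simp only [normalized, Submodule.mem_iInf, LinearMap.mem_ker] at hx ⊢
    intro i
    rw [DGVect.map_proj _ (fun k x => Y.map_deg _ k x), hx i, map_zero]

theorem d_mem_normalized (n : ℕ) : ∀ x ∈ Y.normalized n, (Y.obj n).d x ∈ Y.normalized n := by
  intro x hx
  cases n with
  | zero => trivial
  | succ n =>
    simp only [normalized, Submodule.mem_iInf, LinearMap.mem_ker] at hx ⊢
    intro i
    rw [Y.map_d, hx i, map_zero]

theorem map_eq_zero_of_normalized {m n : ℕ} (x : Y.obj n) (hx : x ∈ Y.normalized n)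
    (α : Fin m → Option (Fin n)) (p : Fin n) (hp : ∀ j, α j ≠ some p) : Y.map α x = 0 := by
  cases n with
  | zero => exact p.elim0
  | succ n =>
    have h : α = fun j => ((α j).bind fun q => finSuccEquiv' p q).bind (codegen n p) := by
      funext j
      rcases hj : α j with _ | q
      · rfl
      · have hq : q ≠ p := fun h => hp j (h ▸ hj)
        obtain ⟨r, rfl⟩ := Fin.exists_succAbove_eq hq
        simp [codegen]
    simp only [normalized, Submodule.mem_iInf, LinearMap.mem_ker] at hx
    rw [h, ← Y.map_comp, hx p, map_zero]

theorem cofaceSum_mem_normalized (n : ℕ) :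
    ∀ x ∈ Y.normalized n, Y.cofaceSum n x ∈ Y.normalized (n + 1) := by
  intro x hx
  simp only [normalized, Submodule.mem_iInf, LinearMap.mem_ker]
  intro j
  simp only [cofaceSum_apply, map_sum, map_smul, Y.map_comp]
  have h1 : (fun k => (codegen n j k).bind (coface n j.castSucc)) = fun k => some k := by
    funext k
    exact codegen_bind_coface_self _ _ _ (Or.inl rfl)
  have h2 : (fun k => (codegen n j k).bind (coface n j.succ)) = fun k => some k := by
    funext k
    exact codegen_bind_coface_self _ _ _ (Or.inr rfl)
  rw [← Finset.sum_subset (Finset.subset_univ {j.castSucc, j.succ})]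
  · rw [Finset.sum_pair (by simp [Fin.ext_iff]), h1, h2, Y.map_id, ← add_smul]
    simp [pow_succ]
  · intro i _ hi
    simp only [Finset.mem_insert, Finset.mem_singleton, not_or, Fin.ext_iff, Fin.val_castSucc,
      Fin.val_succ] at hi
    have := i.2
    have := j.2
    rw [Y.map_eq_zero_of_normalized x hx _
      (if h : (i : ℕ) < j then ⟨j - 1, by omega⟩ else ⟨j, by omega⟩), smul_zero]
    intro k
    have := k.2
    rw [Ne, codegen_bind_coface, exists_eq_left]
    split_ifs <;> simp only [] <;> omega

theorem homogeneous_altMulti (n : ℕ) : (Y.obj n).Homogeneous (Y.altMulti n) := by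
  rintro x ⟨h, h'⟩ k
  refine ⟨fun σ => ?_, fun i => ?_⟩
  · rw [DGVect.map_proj _ (fun k x => Y.map_deg _ k x), h σ, map_smul]
  · rw [DGVect.map_proj _ (fun k x => Y.map_deg _ k x), h' i, map_add,
      DGVect.map_proj _ (fun k x => Y.map_deg _ k x),
      DGVect.map_proj _ (fun k x => Y.map_deg _ k x)]

theorem d_mem_altMulti (n : ℕ) : ∀ x ∈ Y.altMulti n, (Y.obj n).d x ∈ Y.altMulti n := by
  rintro x ⟨h, h'⟩
  refine ⟨fun σ => ?_, fun i => ?_⟩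
  · rw [Y.map_d, h σ, map_smul]
  · rw [Y.map_d, h' i, map_add, Y.map_d, Y.map_d]

theorem altMulti_le_normalized (n : ℕ) : Y.altMulti n ≤ Y.normalized n := by
  rintro x ⟨-, h⟩
  cases n with
  | zero => trivial
  | succ n =>
    simp only [normalized, Submodule.mem_iInf, LinearMap.mem_ker]
    intro i
    have key := congrArg (Y.map (fun j : Fin n =>
      some (i.castSucc.succAbove (i.succAbove j)))) (h i)
    have e : ∀ α : Fin (n + 2) → Option (Fin (n + 1)),
        (α = mergeMap i ∨ α = splitMap i.castSucc ∨ α = splitMap i.succ) →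
        (fun j : Fin n => (some (i.castSucc.succAbove (i.succAbove j))).bind α) = codegen n i := by
      rintro α hα
      funext j
      have hj : i.succAbove j ≠ i := Fin.succAbove_ne i j
      simp only [Option.bind_some, codegen]
      rcases hα with rfl | rfl | rfl
      · simp [mergeMap]
      · simp [splitMap]
      · have : i.castSucc.succAbove (i.succAbove j) = i.succ.succAbove (i.succAbove j) := by
          simp only [Fin.succAbove, Fin.lt_def, Fin.ext_iff] at hj ⊢
          split_ifs at hj ⊢ <;> simp_all <;> omega
        rw [this]
        simp [splitMap]
    rw [map_add, Y.map_comp, Y.map_comp, Y.map_comp, e _ (Or.inl rfl), e _ (Or.inr (Or.inl rfl)),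
      e _ (Or.inr (Or.inr rfl))] at key
    simpa using key

theorem alt_sum_aux {M : Type*} [AddCommGroup M] [Module K M] (t : ℕ → M) (n : ℕ) :
    ∑ i ∈ Finset.range n, (-1 : K) ^ (i + 1) • (t i + t (i + 1)) = (-1 : K) ^ n • t n - t 0 := by
  induction n with
  | zero => simp
  | succ n ih =>
    rw [Finset.sum_range_succ, ih, pow_succ, smul_add]
    module

theorem cofaceSum_altMulti (n : ℕ) (x : Y.obj n) (hx : x ∈ Y.altMulti n) :
    Y.cofaceSum n x = 0 := by
  obtain ⟨-, h⟩ := hx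
  rw [cofaceSum_apply, Fin.sum_univ_castSucc, Fin.sum_univ_succ]
  simp only [coface_castSucc_succ, Fin.val_castSucc, Fin.val_succ, h _]
  rw [coface_last, Fin.castSucc_zero, coface_zero]
  let t : ℕ → Y.obj (n + 1) := fun k =>
    if hk : k < n + 1 then Y.map (splitMap ⟨k, hk⟩) x else 0
  have ht : ∀ k : Fin (n + 1), Y.map (splitMap k) x = t k := by
    intro k
    simp only [t, dif_pos k.2]
  have h' : ∀ i : Fin n, Y.map (mergeMap i) x = t i + t (i + 1) := fun i => by
    rw [h i, ht, ht, Fin.val_castSucc, Fin.val_succ]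
  simp only [ht, Fin.val_castSucc, Fin.val_succ]
  rw [Fin.sum_univ_eq_sum_range (fun i => (-1 : K) ^ (i + 1) • (t i + t (i + 1))) n, alt_sum_aux]
  simp [pow_succ]

/-- The totalization `Tot Y`: the normalized cochain complex. -/
def Tot : DGVect K :=
  Y.cochains.sub (DGVect.sumSub Y.obj Y.normalized)
    (DGVect.homogeneous_sumSub _ _ _ _ _ _ Y.homogeneous_normalized)
    (DGVect.d_mem_sumSub _ _ _ _ _ _ Y.d_mem_normalized Y.cofaceSum_mem_normalized)

/-- The subcomplex `AM(Y)` of the alternating multiderivations. -/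
def AM : DGVect K :=
  Y.cochains.sub (DGVect.sumSub Y.obj Y.altMulti)
    (DGVect.homogeneous_sumSub _ _ _ _ _ _ Y.homogeneous_altMulti)
    (DGVect.d_mem_sumSub _ _ _ _ _ _ Y.d_mem_altMulti
      fun n x hx => by rw [Y.cofaceSum_altMulti n x hx]; exact zero_mem _)

/-- The inclusion of `AM(Y)` in `Tot Y`. -/
def inclAM : DGVect.Hom Y.AM Y.Tot :=
  Y.cochains.subIncl _ _ _ _ fun _ hx n => Y.altMulti_le_normalized n (hx n)

/-- `Y` is smooth if the inclusion of `AM(Y)` in `Tot Y` is a quasi-isomorphism. -/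
def Smooth : Prop := Y.inclAM.IsQuasiIso

/-- The commutative `Σ`-cosimplicial subspace on a family of submodules stable under all the
structure maps. -/
def sub (S : ∀ n, Submodule K (Y.obj n)) (hS : ∀ n, (Y.obj n).Homogeneous (S n))
    (hd : ∀ n, ∀ x ∈ S n, (Y.obj n).d x ∈ S n)
    (hmap : ∀ {m n : ℕ} (α : Fin m → Option (Fin n)), ∀ x ∈ S n, Y.map α x ∈ S m) :
    CommCosimplicial K where
  obj n := (Y.obj n).sub (S n) (hS n) (hd n)
  map α := (Y.map α).restrict (hmap α)
  map_deg := fun α k _ hx => Y.map_deg α k _ hx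
  map_d := fun α _ => Subtype.ext (Y.map_d α _)
  map_id := fun _ => Subtype.ext (Y.map_id _)
  map_comp := fun β α _ => Subtype.ext (Y.map_comp β α _)

end CommCosimplicial

/-! ## Oriented graphs -/

/-- A finite graph with `n` external vertices, numbered by `Fin n`, together with an orientation:
the internal vertices and the edges are ordered (so they are numbered by `Fin I` and `Fin E`), and
every edge `e` is directed from `ends (e, false)` to `ends (e, true)`. The pairs `(e, b)` are the
half-edges. Loops and multiple edges are allowed. -/
@[ext]
structure OGraph (n : ℕ) where
  /-- the number of internal vertices -/
  I : ℕ
  /-- the number of edges -/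
  E : ℕ
  ends : Fin E × Bool → Fin n ⊕ Fin I

namespace OGraph

variable {n : ℕ} (G : OGraph n)

/-- The half-edges at a vertex (a loop contributes two of them). -/
def half (v : Fin n ⊕ Fin G.I) : Finset (Fin G.E × Bool) := {h | G.ends h = v}

/-- The valence of a vertex. -/
def valence (v : Fin n ⊕ Fin G.I) : ℕ := (G.half v).card

/-- Two vertices are adjacent if they are the two ends of an edge. -/
def Adj (x y : Fin n ⊕ Fin G.I) : Prop :=
  ∃ (e : Fin G.E) (b : Bool), G.ends (e, b) = x ∧ G.ends (e, !b) = y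

/-- Admissible graphs: the internal vertices have valence at least `3`, and every connected
component contains an external vertex. -/
def Admissible : Prop :=
  (∀ v : Fin G.I, 3 ≤ G.valence (Sum.inr v)) ∧
    ∀ v : Fin G.I, ∃ i : Fin n, Relation.ReflTransGen G.Adj (Sum.inr v) (Sum.inl i)

/-- All external vertices are univalent. -/
def ExtUnivalent : Prop := ∀ i : Fin n, G.valence (Sum.inl i) = 1

/-- The graph is connected and has at least one external vertex. -/
def IsConnected : Prop := 0 < n ∧ ∀ x y, Relation.ReflTransGen G.Adj x y

/-- An internal vertex is incident to an edge. -/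
def Incident (x y : Fin G.I ⊕ Fin G.E) : Prop :=
  ∃ (v : Fin G.I) (e : Fin G.E) (b : Bool), G.ends (e, b) = Sum.inr v ∧ x = Sum.inl v ∧ y = Sum.inr e

/-- What remains of the graph after the removal of small neighbourhoods of the external vertices is
connected (and non-empty). What remains consists of the internal vertices and of the (open or
truncated) edges, glued along the incidences between them. -/
def ConnectedOffExt : Prop :=
  Nonempty (Fin G.I ⊕ Fin G.E) ∧ ∀ x y, Relation.EqvGen G.Incident x y

/-- The sum of the degrees of the internal vertices, `-d` each, and of the edges, `d - 1` each. -/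
def degree (d : ℕ) : ℤ := ((d : ℤ) - 1) * G.E - d * G.I

/-- Renumbering of the external vertices, of the internal vertices and of the edges, by
permutations `ρ`, `σ`, `τ`, combined with the reversal of the edges `e` with `φ e = true`. -/
abbrev act (ρ : Equiv.Perm (Fin n)) (σ : Equiv.Perm (Fin G.I)) (τ : Equiv.Perm (Fin G.E))
    (φ : Fin G.E → Bool) : OGraph n where
  I := G.I
  E := G.E
  ends h := Sum.map ρ σ (G.ends (τ h.1, xor (φ h.1) h.2))

/-- Old vertices as vertices of a graph with one more internal vertex, the new one being the first
in the order. -/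
def lift {I : ℕ} : Fin n ⊕ Fin I → Fin n ⊕ Fin (I + 1) := Sum.map id Fin.succ

/-- `(v, A)` is an expansion of the vertex `v`: the half-edges in `A` are to be moved from `v` to a
new internal vertex, connected with `v` by a new edge. The new vertex, and `v` if it is internal,
must be at least trivalent after the expansion. -/
def IsExpansion (v : Fin n ⊕ Fin G.I) (A : Finset (Fin G.E × Bool)) : Prop :=
  A ⊆ G.half v ∧ 2 ≤ A.card ∧ (v.isRight = true → 2 ≤ (G.half v \ A).card)

instance (v : Fin n ⊕ Fin G.I) (A : Finset (Fin G.E × Bool)) : Decidable (G.IsExpansion v A) :=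
  inferInstanceAs (Decidable (_ ∧ _ ∧ _))

/-- The result of an expansion of the vertex `v`. The new vertex and the new edge are put at the
first places of the orientation, and the new edge is directed from `v` to the new vertex. -/
abbrev expand (v : Fin n ⊕ Fin G.I) (A : Finset (Fin G.E × Bool)) : OGraph n where
  I := G.I + 1
  E := G.E + 1
  ends h := Fin.cases (if h.2 then Sum.inr 0 else lift v)
    (fun e => if (e, h.2) ∈ A then Sum.inr 0 else lift (G.ends (e, h.2))) h.1

/-- The pointed map `α`, extended by the identity of the internal vertices. -/
def extMap {m I : ℕ} (α : Fin m → Option (Fin n)) : Fin m ⊕ Fin I → Option (Fin n ⊕ Fin I) :=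
  Sum.elim (fun j => (α j).map Sum.inl) (fun v => some (Sum.inr v))

/-- The reconnections of the half-edges of `G` along the pointed map `α : m₊ → n₊`: each half-edge
at the external vertex `i` is attached to one of the vertices in the preimage of `i`. -/
def reconnections {m : ℕ} (α : Fin m → Option (Fin n)) :
    Finset (Fin G.E × Bool → Fin m ⊕ Fin G.I) :=
  {f | ∀ h, extMap α (f h) = some (G.ends h)}

end OGraph

open OGraph

section space

variable (K : Type u) [Field K] (d : ℕ)

/-- The sign of a renumbering in the orientation: the internal vertices have degree `-d`, the edges
have degree `d - 1` (whose parity is that of `d + 1`), and the reversal of an edge has the sign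
`(-1)^d`. -/
def orientSign {I E : ℕ} (σ : Equiv.Perm (Fin I)) (τ : Equiv.Perm (Fin E)) (φ : Fin E → Bool) : K :=
  ((Equiv.Perm.sign σ : ℤ) : K) ^ d * ((Equiv.Perm.sign τ : ℤ) : K) ^ (d + 1) *
    ∏ e, if φ e then (-1 : K) ^ d else 1

/-- The orientation relations. The external vertices, of degree `-1`, may be renumbered by the
permutations in `R`. -/
def orientRel (n : ℕ) (R : Set (Equiv.Perm (Fin n))) : Submodule K (OGraph n →₀ K) :=
  Submodule.span K {x | ∃ (G : OGraph n) (ρ : Equiv.Perm (Fin n)) (σ : Equiv.Perm (Fin G.I))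
    (τ : Equiv.Perm (Fin G.E)) (φ : Fin G.E → Bool), ρ ∈ R ∧
      x = Finsupp.single (G.act ρ σ τ φ) 1 -
        Finsupp.single G (((Equiv.Perm.sign ρ : ℤ) : K) * orientSign K d σ τ φ)}

/-- The space spanned by the oriented graphs modulo the orientation relations. -/
abbrev GraphSpace (n : ℕ) (R : Set (Equiv.Perm (Fin n))) : Type u :=
  (OGraph n →₀ K) ⧸ orientRel K d n R

variable (n : ℕ) (R : Set (Equiv.Perm (Fin n)))

variable {n}

/-- The class of an oriented graph. -/
def cls (G : OGraph n) : GraphSpace K d n R := (orientRel K d n R).mkQ (Finsupp.single G 1)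

variable {R}

theorem cls_act (G : OGraph n) (ρ : Equiv.Perm (Fin n)) (hρ : ρ ∈ R) (σ τ φ) :
    cls K d R (G.act ρ σ τ φ) =
      (((Equiv.Perm.sign ρ : ℤ) : K) * orientSign K d σ τ φ) • cls K d R G := by
  have h : Finsupp.single (G.act ρ σ τ φ) (1 : K) -
      Finsupp.single G (((Equiv.Perm.sign ρ : ℤ) : K) * orientSign K d σ τ φ) ∈
        orientRel K d n R := Submodule.subset_span ⟨G, ρ, σ, τ, φ, hρ, rfl⟩
  have h2 := (Submodule.Quotient.mk_eq_zero _).2 h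
  rw [Submodule.Quotient.mk_sub, sub_eq_zero] at h2
  refine h2.trans ?_
  rw [cls, Submodule.mkQ_apply, ← Submodule.Quotient.mk_smul, Finsupp.smul_single, smul_eq_mul,
    mul_one]

/-- Linear maps out of the space of graphs. -/
def liftCls {M : Type u} [AddCommGroup M] [Module K M] (F : OGraph n → M)
    (hF : ∀ (G : OGraph n) (ρ : Equiv.Perm (Fin n)) (σ τ φ), ρ ∈ R → F (G.act ρ σ τ φ) =
      (((Equiv.Perm.sign ρ : ℤ) : K) * orientSign K d σ τ φ) • F G) :
    GraphSpace K d n R →ₗ[K] M :=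
  (orientRel K d n R).liftQ (Finsupp.linearCombination K F) (by
    rw [orientRel, Submodule.span_le]
    rintro _ ⟨G, ρ, σ, τ, φ, hρ, rfl⟩
    rw [SetLike.mem_coe, LinearMap.mem_ker, map_sub, Finsupp.linearCombination_single,
      Finsupp.linearCombination_single, hF G ρ σ τ φ hρ, one_smul, sub_self])

variable {K d}

@[simp]
theorem liftCls_cls {M : Type u} [AddCommGroup M] [Module K M] (F : OGraph n → M) (hF)
    (G : OGraph n) : liftCls K d (R := R) F hF (cls K d R G) = F G := by
  have : liftCls K d (R := R) F hF (cls K d R G) = Finsupp.linearCombination K F (Finsupp.single G 1) :=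
    rfl
  rw [this]
  simp

theorem hom_ext {M : Type u} [AddCommGroup M] [Module K M] {f g : GraphSpace K d n R →ₗ[K] M}
    (h : ∀ G, f (cls K d R G) = g (cls K d R G)) : f = g := by
  refine Submodule.linearMap_qext _ (Finsupp.lhom_ext' fun G => LinearMap.ext_ring ?_)
  exact h G

theorem span_cls : Submodule.span K (Set.range (cls K d R)) = ⊤ := by
  rw [← Submodule.ker_mkQ (Submodule.span K (Set.range (cls K d R))), LinearMap.ker_eq_top]
  refine hom_ext fun G => ?_
  rw [LinearMap.zero_apply, Submodule.mkQ_apply, Submodule.Quotient.mk_eq_zero]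
  exact Submodule.subset_span ⟨G, rfl⟩

end space

namespace OGraph

variable {n : ℕ} (G : OGraph n)

theorem mem_half (v : Fin n ⊕ Fin G.I) (h : Fin G.E × Bool) : h ∈ G.half v ↔ G.ends h = v := by
  simp [half]

/-- The permutation of the half-edges underlying a renumbering. -/
def actHalf {E : ℕ} (τ : Equiv.Perm (Fin E)) (φ : Fin E → Bool) : Equiv.Perm (Fin E × Bool) where
  toFun h := (τ h.1, xor (φ h.1) h.2)
  invFun h := (τ.symm h.1, xor (φ (τ.symm h.1)) h.2)
  left_inv h := by simp
  right_inv h := by simp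

theorem act_half (ρ σ τ φ) (v : Fin n ⊕ Fin G.I) :
    (G.act ρ σ τ φ).half (Equiv.sumCongr ρ σ v) = (G.half v).map (actHalf τ φ).symm.toEmbedding := by
  ext h
  rw [mem_half, Finset.mem_map_equiv, Equiv.symm_symm, mem_half]
  exact (Equiv.sumCongr ρ σ).apply_eq_iff_eq

theorem act_isExpansion (ρ σ τ φ) (v : Fin n ⊕ Fin G.I) (A : Finset (Fin G.E × Bool)) :
    (G.act ρ σ τ φ).IsExpansion (Equiv.sumCongr ρ σ v) (A.map (actHalf τ φ).symm.toEmbedding) ↔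
      G.IsExpansion v A := by
  unfold IsExpansion
  rw [act_half]
  erw [Finset.map_subset_map, Finset.card_map, ← Finset.map_sdiff, Finset.card_map]
  rcases v with v | v <;> simp

/-- The extension of a permutation by a fixed point at the first place. -/
def consPerm {k : ℕ} (σ : Equiv.Perm (Fin k)) : Equiv.Perm (Fin (k + 1)) :=
  Equiv.Perm.decomposeFin.symm (0, σ)

@[simp] theorem consPerm_zero {k : ℕ} (σ : Equiv.Perm (Fin k)) : consPerm σ 0 = 0 := by
  simp [consPerm]

@[simp] theorem consPerm_succ {k : ℕ} (σ : Equiv.Perm (Fin k)) (i : Fin k) :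
    consPerm σ i.succ = (σ i).succ := by
  simp [consPerm]

@[simp] theorem sign_consPerm {k : ℕ} (σ : Equiv.Perm (Fin k)) :
    Equiv.Perm.sign (consPerm σ) = Equiv.Perm.sign σ := by
  simp [consPerm]

theorem act_expand (ρ σ τ φ) (v : Fin n ⊕ Fin G.I) (A : Finset (Fin G.E × Bool)) :
    (G.act ρ σ τ φ).expand (Equiv.sumCongr ρ σ v) (A.map (actHalf τ φ).symm.toEmbedding) =
      (G.expand v A).act ρ (consPerm σ) (consPerm τ)
        (Fin.cons (α := fun _ => Bool) false φ : Fin (G.E + 1) → Bool) := by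
  refine OGraph.ext rfl rfl (heq_of_eq ?_)
  funext ⟨e, b⟩
  have hl : ∀ x : Fin n ⊕ Fin G.I,
      lift (Sum.map ρ σ x) = Sum.map ρ (consPerm σ) (lift x) := by
    rintro (x | x) <;> simp [lift]
  refine Fin.cases ?_ (fun e => ?_) e
  · cases b
    · exact hl v
    · simp [expand, act]
  · have hA : (e, b) ∈ A.map (actHalf τ φ).symm.toEmbedding ↔ (τ e, xor (φ e) b) ∈ A := by
      rw [Finset.mem_map_equiv]
      rfl
    simp only [expand, act, Fin.cases_succ, consPerm_succ, Fin.cons_succ]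
    split_ifs with h1 h2 h2
    · simp
    · exact absurd (hA.1 h1) h2
    · exact absurd (hA.2 h2) h1
    · exact hl _

/-- The coefficient of the expansions of a vertex: those of an internal vertex occur twice, as the
two resulting internal vertices may be interchanged. -/
def weight (K : Type u) [Field K] {I : ℕ} (v : Fin n ⊕ Fin I) : K :=
  Sum.elim (fun _ => 1) (fun _ => 2⁻¹) v

end OGraph

theorem orientSign_cons (K : Type u) [Field K] (d : ℕ) {I E : ℕ} (σ : Equiv.Perm (Fin I))
    (τ : Equiv.Perm (Fin E)) (φ : Fin E → Bool) :
    orientSign K d (consPerm σ) (consPerm τ)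
      (Fin.cons (α := fun _ => Bool) false φ : Fin (E + 1) → Bool) = orientSign K d σ τ φ := by
  simp [orientSign, Fin.prod_univ_succ]

section differential

variable (K : Type u) [Field K] (d : ℕ) {n : ℕ} (R : Set (Equiv.Perm (Fin n)))

/-- The sum of the expansions of the vertices of a graph. -/
def expansionSum (G : OGraph n) : GraphSpace K d n R :=
  ∑ v : Fin n ⊕ Fin G.I, ∑ A : Finset (Fin G.E × Bool),
    if G.IsExpansion v A then (weight K v) • cls K d R (G.expand v A) else 0

theorem expansionSum_act (G : OGraph n) (ρ σ τ φ) (hρ : ρ ∈ R) :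
    expansionSum K d R (G.act ρ σ τ φ) =
      (((Equiv.Perm.sign ρ : ℤ) : K) * orientSign K d σ τ φ) • expansionSum K d R G := by
  unfold expansionSum
  rw [Finset.smul_sum]
  symm
  refine Fintype.sum_equiv (Equiv.sumCongr ρ σ) _ _ fun v => ?_
  rw [Finset.smul_sum]
  refine Fintype.sum_equiv (Equiv.finsetCongr (actHalf τ φ).symm) _ _ fun A => ?_
  rw [Equiv.finsetCongr_apply]
  have hw : weight K (Equiv.sumCongr ρ σ v) = weight K v := by
    rcases v with v | v <;> rfl
  by_cases h : G.IsExpansion v A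
  · rw [if_pos h, if_pos ((act_isExpansion G ρ σ τ φ v A).2 h), act_expand, cls_act K d _ ρ hρ,
      orientSign_cons, smul_comm]
    congr 1
    exact hw.symm
  · rw [if_neg h, if_neg (fun h' => h ((act_isExpansion G ρ σ τ φ v A).1 h')), smul_zero]

/-- The differential: the sum of the expansions of the vertices. -/
def diff : GraphSpace K d n R →ₗ[K] GraphSpace K d n R :=
  liftCls K d (expansionSum K d R) fun G ρ σ τ φ hρ => expansionSum_act K d R G ρ σ τ φ hρ

/-- The homogeneous components of the space of graphs. -/
def graphDeg (k : ℤ) : Submodule K (GraphSpace K d n R) :=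
  Submodule.span K {x | ∃ G : OGraph n, G.degree d = k ∧ x = cls K d R G}

theorem graphDeg_isInternal : DirectSum.IsInternal (graphDeg K d R) := by
  let p : ℤ → GraphSpace K d n R →ₗ[K] GraphSpace K d n R := fun k =>
    liftCls K d (fun G => if G.degree d = k then cls K d R G else 0) (by
      intro G ρ σ τ φ hρ
      have : (G.act ρ σ τ φ).degree d = G.degree d := rfl
      rw [this]
      split_ifs
      · exact cls_act K d G ρ hρ σ τ φ
      · simp)
  refine isInternal_of_proj _ p ?_ ?_ ?_
  · intro k x hx
    induction hx using Submodule.span_induction with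
    | mem y hy =>
      obtain ⟨G, hG, rfl⟩ := hy
      rw [liftCls_cls, if_pos hG]
    | zero => simp
    | add y z _ _ hy hz => rw [map_add, hy, hz]
    | smul a y _ hy => rw [map_smul, hy]
  · intro k l hkl x hx
    induction hx using Submodule.span_induction with
    | mem y hy =>
      obtain ⟨G, hG, rfl⟩ := hy
      rw [liftCls_cls, if_neg (fun h => hkl (hG.symm.trans h))]
    | zero => simp
    | add y z _ _ hy hz => rw [map_add, hy, hz, add_zero]
    | smul a y _ hy => rw [map_smul, hy, smul_zero]
  · rw [eq_top_iff, ← span_cls, Submodule.span_le]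
    rintro _ ⟨G, rfl⟩
    exact Submodule.mem_iSup_of_mem (G.degree d) (Submodule.subset_span ⟨G, rfl, rfl⟩)

theorem diff_mem (k : ℤ) : ∀ x ∈ graphDeg K d R k, diff K d R x ∈ graphDeg K d R (k - 1) := by
  intro x hx
  induction hx using Submodule.span_induction with
  | mem y hy =>
    obtain ⟨G, hG, rfl⟩ := hy
    rw [diff, liftCls_cls]
    refine Submodule.sum_mem _ fun v _ => Submodule.sum_mem _ fun A _ => ?_
    split_ifs with h
    · refine Submodule.smul_mem _ _ (Submodule.subset_span ⟨_, ?_, rfl⟩)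
      rw [← hG]
      simp only [degree]
      push_cast
      ring
    · exact zero_mem _
  | zero => simp
  | add y z _ _ hy hz => rw [map_add]; exact add_mem hy hz
  | smul a y _ hy => rw [map_smul]; exact Submodule.smul_mem _ _ hy

end differential
section square

open Finset

variable {K : Type u} [Field K] {d : ℕ} {n : ℕ} {R : Set (Equiv.Perm (Fin n))}

namespace OGraph

/-- A graph with two new internal vertices and two new edges, from `p₀` to `q₀` and from `p₁` to
`q₁`. -/
abbrev twoStep (I E : ℕ) (p₀ q₀ p₁ q₁ : Fin n ⊕ Fin (I + 2))
    (f : Fin E × Bool → Fin n ⊕ Fin (I + 2)) : OGraph n where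
  I := I + 2
  E := E + 2
  ends h := Fin.cases (if h.2 then q₀ else p₀)
    (fun e => Fin.cases (if h.2 then q₁ else p₁) (fun e => f (e, h.2)) e) h.1

theorem twoStep_eq_act {I E : ℕ} (p₀ q₀ p₁ q₁ : Fin n ⊕ Fin (I + 2))
    (f : Fin E × Bool → Fin n ⊕ Fin (I + 2)) (σ : Equiv.Perm (Fin (I + 2))) :
    twoStep I E (Sum.map id σ p₀) (Sum.map id σ q₀) (Sum.map id σ p₁) (Sum.map id σ q₁)
      (fun h => Sum.map id σ (f h)) = (twoStep I E p₀ q₀ p₁ q₁ f).act 1 σ 1 (fun _ => false) := by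
  refine OGraph.ext rfl rfl (heq_of_eq ?_)
  funext ⟨e, b⟩
  refine Fin.cases ?_ (fun e => Fin.cases ?_ (fun e => ?_) e) e
  · cases b <;> rfl
  · cases b <;> rfl
  · simp

theorem twoStep_swap_edges {I E : ℕ} (p₀ q₀ p₁ q₁ : Fin n ⊕ Fin (I + 2))
    (f : Fin E × Bool → Fin n ⊕ Fin (I + 2)) :
    twoStep I E p₁ q₁ p₀ q₀ f =
      (twoStep I E p₀ q₀ p₁ q₁ f).act 1 1 (Equiv.swap 0 1) (fun _ => false) := by
  refine OGraph.ext rfl rfl (heq_of_eq ?_)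
  funext ⟨e, b⟩
  have key : ∀ e', Equiv.swap (0 : Fin (E + 2)) 1 e = e' →
      (twoStep I E p₁ q₁ p₀ q₀ f).ends (e, b) = (twoStep I E p₀ q₀ p₁ q₁ f).ends (e', b) →
      (twoStep I E p₁ q₁ p₀ q₀ f).ends (e, b) =
        ((twoStep I E p₀ q₀ p₁ q₁ f).act 1 1 (Equiv.swap 0 1) (fun _ => false)).ends (e, b) := by
    intro e' h1 h2
    rw [h2, ← h1]
    simp only [Bool.false_xor, Equiv.Perm.coe_one, Sum.map_id_id, id_eq]
  revert key
  refine Fin.cases ?_ (fun e => Fin.cases ?_ (fun e => ?_) e) e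
  · exact fun key => key (Fin.succ 0) (Equiv.swap_apply_left _ _) rfl
  · exact fun key => key 0 (Equiv.swap_apply_right _ _) rfl
  · exact fun key => key e.succ.succ
      (Equiv.swap_apply_of_ne_of_ne (Fin.succ_ne_zero _) (by simp [Fin.ext_iff])) rfl

theorem twoStep_flip_zero {I E : ℕ} (p₀ q₀ p₁ q₁ : Fin n ⊕ Fin (I + 2))
    (f : Fin E × Bool → Fin n ⊕ Fin (I + 2)) :
    twoStep I E q₀ p₀ p₁ q₁ f =
      (twoStep I E p₀ q₀ p₁ q₁ f).act 1 1 1 (fun e => decide (e = 0)) := by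
  refine OGraph.ext rfl rfl (heq_of_eq ?_)
  funext ⟨e, b⟩
  simp only [Equiv.Perm.coe_one, Sum.map_id_id, id_eq]
  refine Fin.cases ?_ (fun e => ?_) e
  · cases b <;> rfl
  · cases b <;> rfl

end OGraph

/-- `-1 ∈ K`, to the power `d`. -/
theorem orientSign_vertex {I E : ℕ} (i j : Fin I) (h : i ≠ j) :
    orientSign K d (Equiv.swap i j) (1 : Equiv.Perm (Fin E)) (fun _ => false) = (-1) ^ d := by
  simp [orientSign, Equiv.Perm.sign_swap h]

theorem orientSign_edge {I E : ℕ} (i j : Fin E) (h : i ≠ j) :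
    orientSign K d (1 : Equiv.Perm (Fin I)) (Equiv.swap i j) (fun _ => false) = (-1) ^ (d + 1) := by
  simp [orientSign, Equiv.Perm.sign_swap h]

theorem orientSign_flip {I E : ℕ} (i : Fin E) :
    orientSign K d (1 : Equiv.Perm (Fin I)) (1 : Equiv.Perm (Fin E))
      (fun e => decide (e = i)) = (-1) ^ d := by
  simp [orientSign]

theorem cls_swap_vertices (hR : (1 : Equiv.Perm (Fin n)) ∈ R) {I E : ℕ} (p₀ q₀ p₁ q₁ : Fin n ⊕ Fin (I + 2))
    (f : Fin E × Bool → Fin n ⊕ Fin (I + 2)) (i j : Fin (I + 2)) (h : i ≠ j) :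
    cls K d R (twoStep I E (Sum.map id (Equiv.swap i j) p₀) (Sum.map id (Equiv.swap i j) q₀)
      (Sum.map id (Equiv.swap i j) p₁) (Sum.map id (Equiv.swap i j) q₁)
      (fun h => Sum.map id (Equiv.swap i j) (f h))) =
    (-1 : K) ^ d • cls K d R (twoStep I E p₀ q₀ p₁ q₁ f) := by
  rw [twoStep_eq_act, cls_act K d _ 1 hR, orientSign_vertex i j h]
  simp

theorem cls_swap_edges (hR : (1 : Equiv.Perm (Fin n)) ∈ R) {I E : ℕ} (p₀ q₀ p₁ q₁ : Fin n ⊕ Fin (I + 2))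
    (f : Fin E × Bool → Fin n ⊕ Fin (I + 2)) :
    cls K d R (twoStep I E p₁ q₁ p₀ q₀ f) =
    (-1 : K) ^ (d + 1) • cls K d R (twoStep I E p₀ q₀ p₁ q₁ f) := by
  rw [twoStep_swap_edges, cls_act K d _ 1 hR, orientSign_edge 0 1 (by simp)]
  simp

theorem cls_flip_zero (hR : (1 : Equiv.Perm (Fin n)) ∈ R) {I E : ℕ} (p₀ q₀ p₁ q₁ : Fin n ⊕ Fin (I + 2))
    (f : Fin E × Bool → Fin n ⊕ Fin (I + 2)) :
    cls K d R (twoStep I E q₀ p₀ p₁ q₁ f) =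
    (-1 : K) ^ d • cls K d R (twoStep I E p₀ q₀ p₁ q₁ f) := by
  rw [twoStep_flip_zero, cls_act K d _ 1 hR]
  have := orientSign_flip (K := K) (d := d) (I := I + 2) (0 : Fin (E + 2))
  rw [this]
  simp

/-- Sets of half-edges of a graph with a new first edge: `s` and `t` tell whether the two halves of
the new edge belong to the set. -/
def halfCons {E : ℕ} (s t : Bool) (B : Finset (Fin E × Bool)) : Finset (Fin (E + 1) × Bool) :=
  {h | Fin.cases (motive := fun _ => Bool) (if h.2 then t else s) (fun e => decide ((e, h.2) ∈ B))
    h.1 = true}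

theorem mem_halfCons_zero {E : ℕ} (s t b : Bool) (B : Finset (Fin E × Bool)) :
    ((0, b) : Fin (E + 1) × Bool) ∈ halfCons s t B ↔ (if b then t else s) = true := by
  simp [halfCons]

theorem mem_halfCons_succ {E : ℕ} (s t b : Bool) (B : Finset (Fin E × Bool)) (e : Fin E) :
    (e.succ, b) ∈ halfCons s t B ↔ (e, b) ∈ B := by
  simp [halfCons]

theorem halfCons_ext {E : ℕ} {A B : Finset (Fin (E + 1) × Bool)}
    (h0 : (0, false) ∈ A ↔ (0, false) ∈ B) (h1 : (0, true) ∈ A ↔ (0, true) ∈ B)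
    (h : ∀ e b, (Fin.succ e, b) ∈ A ↔ (Fin.succ e, b) ∈ B) : A = B := by
  ext ⟨e, b⟩
  refine Fin.cases ?_ (fun e => h e b) e
  cases b
  · exact h0
  · exact h1

/-- `halfCons` as a bijection. -/
def halfConsEquiv (E : ℕ) :
    Finset (Fin E × Bool) × Bool × Bool ≃ Finset (Fin (E + 1) × Bool) where
  toFun x := halfCons x.2.1 x.2.2 x.1
  invFun B := (({h | (h.1.succ, h.2) ∈ B} : Finset (Fin E × Bool)),
    decide ((0, false) ∈ B), decide ((0, true) ∈ B))
  left_inv x := by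
    obtain ⟨B, s, t⟩ := x
    refine Prod.ext ?_ (Prod.ext ?_ ?_)
    · ext ⟨e, b⟩
      simp [mem_halfCons_succ]
    · simp [mem_halfCons_zero]
    · simp [mem_halfCons_zero]
  right_inv B := by
    refine halfCons_ext ?_ ?_ ?_
    · simp [mem_halfCons_zero]
    · simp [mem_halfCons_zero]
    · simp [mem_halfCons_succ]

theorem sum_halfCons {E : ℕ} {M : Type*} [AddCommMonoid M] (F : Finset (Fin (E + 1) × Bool) → M) :
    ∑ B, F B = ∑ B, (F (halfCons false false B) + F (halfCons true false B) +
      F (halfCons false true B) + F (halfCons true true B)) := by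
  rw [← (halfConsEquiv E).sum_comp F, Fintype.sum_prod_type]
  refine Finset.sum_congr rfl fun B _ => ?_
  simp only [Fintype.sum_prod_type, Fintype.sum_bool]
  simp only [halfConsEquiv, Equiv.coe_fn_mk]
  abel

theorem halfCons_subset {E : ℕ} {s t s' t' : Bool} {A B : Finset (Fin E × Bool)} :
    halfCons s t A ⊆ halfCons s' t' B ↔ (s = true → s' = true) ∧ (t = true → t' = true) ∧ A ⊆ B := by
  constructor
  · intro h
    refine ⟨fun hs => ?_, fun ht => ?_, fun x hx => ?_⟩
    · simpa [mem_halfCons_zero] using h ((mem_halfCons_zero s t false A).2 (by simpa using hs))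
    · simpa [mem_halfCons_zero] using h ((mem_halfCons_zero s t true A).2 (by simpa using ht))
    · exact (mem_halfCons_succ s' t' x.2 B x.1).1 (h ((mem_halfCons_succ s t x.2 A x.1).2 hx))
  · rintro ⟨h1, h2, h3⟩ ⟨e, b⟩
    refine Fin.cases ?_ (fun e => ?_) e
    · rw [mem_halfCons_zero, mem_halfCons_zero]
      cases b <;> simpa
    · rw [mem_halfCons_succ, mem_halfCons_succ]
      exact fun h => h3 h

theorem halfCons_sdiff {E : ℕ} (s t s' t' : Bool) (A B : Finset (Fin E × Bool)) :
    halfCons s t A \ halfCons s' t' B = halfCons (s && !s') (t && !t') (A \ B) := by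
  refine halfCons_ext ?_ ?_ ?_ <;> simp [mem_halfCons_zero, mem_halfCons_succ]

theorem card_halfCons {E : ℕ} (s t : Bool) (B : Finset (Fin E × Bool)) :
    (halfCons s t B).card = s.toNat + t.toNat + B.card := by
  rw [halfCons, Finset.card_filter, Fintype.sum_prod_type, Fin.sum_univ_succ]
  simp only [Fin.cases_zero, Fin.cases_succ, Fintype.sum_bool]
  have : B.card = ∑ x : Fin E, ((if (x, true) ∈ B then 1 else 0) + if (x, false) ∈ B then 1 else 0) := by
    conv_lhs => rw [← Finset.filter_univ_mem B, Finset.card_filter, Fintype.sum_prod_type]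
    simp only [Fintype.sum_bool]
  rw [this]
  cases s <;> cases t <;> simp

namespace OGraph

variable (G : OGraph n)

theorem lift_injective {I : ℕ} : Function.Injective (lift : Fin n ⊕ Fin I → Fin n ⊕ Fin (I + 1)) :=
  Sum.map_injective.2 ⟨Function.injective_id, Fin.succ_injective _⟩

theorem lift_ne {I : ℕ} (x : Fin n ⊕ Fin I) : lift x ≠ Sum.inr 0 := by
  rcases x with x | x <;> simp [lift]

theorem expand_half_lift (v u : Fin n ⊕ Fin G.I) (A : Finset (Fin G.E × Bool)) :
    (G.expand v A).half (lift u) = halfCons (decide (u = v)) false (G.half u \ A) := by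
  refine halfCons_ext ?_ ?_ ?_
  · rw [mem_half, mem_halfCons_zero]
    simp [lift_injective.eq_iff, eq_comm]
  · rw [mem_half, mem_halfCons_zero]
    simp [(lift_ne u).symm]
  · intro e b
    rw [mem_half, mem_halfCons_succ, Finset.mem_sdiff, mem_half]
    simp only [Fin.cases_succ]
    split_ifs with h
    · simp [h, (lift_ne u).symm]
    · simp [h, lift_injective.eq_iff]

theorem expand_half_zero (v : Fin n ⊕ Fin G.I) (A : Finset (Fin G.E × Bool)) :
    (G.expand v A).half (Sum.inr 0) = halfCons false true A := by
  refine halfCons_ext ?_ ?_ ?_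
  · rw [mem_half, mem_halfCons_zero]
    simp [lift_ne]
  · rw [mem_half, mem_halfCons_zero]
    simp
  · intro e b
    rw [mem_half, mem_halfCons_succ]
    simp only [Fin.cases_succ]
    split_ifs with h
    · simp [h]
    · simp [h, lift_ne]

theorem isExpansion_lift (v u : Fin n ⊕ Fin G.I) (A B : Finset (Fin G.E × Bool)) (s t : Bool) :
    (G.expand v A).IsExpansion (lift u) (halfCons s t B) ↔
      t = false ∧ (s = true → u = v) ∧ B ⊆ G.half u \ A ∧ 2 ≤ s.toNat + B.card ∧
        (u.isRight = true → 2 ≤ (decide (u = v) && !s).toNat + ((G.half u \ A) \ B).card) := by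
  have hu : (lift u).isRight = u.isRight := by rcases u with u | u <;> rfl
  unfold IsExpansion
  rw [expand_half_lift, halfCons_subset, halfCons_sdiff, card_halfCons, card_halfCons, hu]
  cases t <;> simp [and_assoc]

theorem isExpansion_zero (v : Fin n ⊕ Fin G.I) (A B : Finset (Fin G.E × Bool)) (s t : Bool) :
    (G.expand v A).IsExpansion (Sum.inr 0) (halfCons s t B) ↔
      s = false ∧ B ⊆ A ∧ 2 ≤ t.toNat + B.card ∧ 2 ≤ (!t).toNat + (A \ B).card := by
  unfold IsExpansion
  rw [expand_half_zero, halfCons_subset, halfCons_sdiff, card_halfCons, card_halfCons]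
  cases s <;> simp

theorem expand_expand (v : Fin n ⊕ Fin G.I) (w : Fin n ⊕ Fin (G.I + 1))
    (A B : Finset (Fin G.E × Bool)) (s t : Bool) :
    (G.expand v A).expand w (halfCons s t B) =
      twoStep G.I G.E (lift w) (Sum.inr 0) (if s then Sum.inr 0 else lift (lift v))
        (if t then Sum.inr 0 else Sum.inr 1)
        (fun h => if h ∈ B then Sum.inr 0 else if h ∈ A then Sum.inr 1 else
          lift (lift (G.ends h))) := by
  refine OGraph.ext rfl rfl (heq_of_eq ?_)
  funext ⟨e, b⟩
  refine Fin.cases ?_ (fun e => Fin.cases ?_ (fun e => ?_) e) e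
  · rfl
  · simp only [Fin.cases_succ, Fin.cases_zero, mem_halfCons_zero]
    cases b <;> cases s <;> cases t <;> rfl
  · simp only [Fin.cases_succ, mem_halfCons_succ]
    split_ifs <;> rfl

end OGraph

theorem eq_zero_of_eq_neg_self [CharZero K] {M : Type*} [AddCommGroup M] [Module K M] {x : M}
    (h : x = -x) : x = 0 := by
  have h2 : (2 : K) • x = 0 := by
    rw [two_smul]
    exact eq_neg_iff_add_eq_zero.1 h
  exact (smul_eq_zero.1 h2).resolve_left two_ne_zero

theorem sum_superset {α M : Type*} [Fintype α] [DecidableEq α] [AddCommMonoid M] (B : Finset α)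
    (F : Finset α → M) :
    ∑ A, (if B ⊆ A then F A else 0) = ∑ X, if Disjoint X B then F (X ∪ B) else 0 := by
  rw [← Finset.sum_filter, ← Finset.sum_filter]
  refine Finset.sum_nbij' (fun A => A \ B) (fun X => X ∪ B) ?_ ?_ ?_ ?_ ?_
  · intro A _
    simp [Finset.sdiff_disjoint]
  · intro X _
    simp
  · intro A hA
    exact Finset.sdiff_union_of_subset (by simpa using hA)
  · intro X hX
    exact Finset.union_sdiff_cancel_right (by simpa using hX)
  · intro A hA
    rw [Finset.sdiff_union_of_subset (by simpa using hA)]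

section terms

variable (K d R) (G : OGraph n)

/-- Successive expansions of `v` and `u` with disjoint sets of old half-edges moved. -/
def termA (v : Fin n ⊕ Fin G.I) (A : Finset (Fin G.E × Bool)) (u : Fin n ⊕ Fin G.I)
    (B : Finset (Fin G.E × Bool)) : GraphSpace K d n R :=
  if G.IsExpansion v A ∧ (G.expand v A).IsExpansion (lift u) (halfCons false false B) then
    (weight K v * weight K u) •
      cls K d R ((G.expand v A).expand (lift u) (halfCons false false B)) else 0

/-- The vertex `v` is expanded twice, and the second new vertex is put on the first new edge. -/
def termP (v : Fin n ⊕ Fin G.I) (X Y : Finset (Fin G.E × Bool)) : GraphSpace K d n R :=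
  if X ⊆ G.half v ∧ Y ⊆ G.half v ∧ Disjoint X Y ∧ 1 ≤ X.card ∧ 2 ≤ Y.card ∧
      (v.isRight = true → 2 ≤ ((G.half v \ X) \ Y).card) then
    cls K d R (twoStep G.I G.E (lift (lift v)) (Sum.inr 0) (Sum.inr 0) (Sum.inr 1)
      (fun h => if h ∈ X then Sum.inr 0 else if h ∈ Y then Sum.inr 1 else
        lift (lift (G.ends h)))) else 0

variable {K d R}

theorem neg_one_pow_mul_succ : (-1 : K) ^ d * (-1 : K) ^ (d + 1) = -1 := by
  rw [pow_succ, ← mul_assoc, ← mul_pow]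
  simp

theorem map_swap_lift (x : Fin n ⊕ Fin G.I) :
    Sum.map id (Equiv.swap (0 : Fin (G.I + 2)) 1) (lift (lift x)) = lift (lift x) := by
  rcases x with x | x
  · rfl
  · simp only [lift, Sum.map_inr, Sum.inr.injEq]
    exact Equiv.swap_apply_of_ne_of_ne (Fin.succ_ne_zero _) (by simp [Fin.ext_iff])

theorem termA_swap (hR : (1 : Equiv.Perm (Fin n)) ∈ R) (v : Fin n ⊕ Fin G.I)
    (A : Finset (Fin G.E × Bool)) (u : Fin n ⊕ Fin G.I) (B : Finset (Fin G.E × Bool)) :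
    termA K d R G u B v A = - termA K d R G v A u B := by
  have hcond : (G.IsExpansion u B ∧
      (G.expand u B).IsExpansion (lift v) (halfCons false false A)) ↔
      (G.IsExpansion v A ∧ (G.expand v A).IsExpansion (lift u) (halfCons false false B)) := by
    rw [isExpansion_lift, isExpansion_lift]
    simp only [OGraph.IsExpansion]
    have key : ∀ (v u : Fin n ⊕ Fin G.I) (A B : Finset (Fin G.E × Bool)),
        ((A ⊆ G.half v ∧ 2 ≤ A.card ∧ (v.isRight = true → 2 ≤ (G.half v \ A).card)) ∧
        True ∧ (false = true → u = v) ∧ B ⊆ G.half u \ A ∧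
          2 ≤ false.toNat + B.card ∧ (u.isRight = true →
            2 ≤ (decide (u = v) && !false).toNat + ((G.half u \ A) \ B).card)) →
        ((B ⊆ G.half u ∧ 2 ≤ B.card ∧ (u.isRight = true → 2 ≤ (G.half u \ B).card)) ∧
        True ∧ (false = true → v = u) ∧ A ⊆ G.half v \ B ∧
          2 ≤ false.toNat + A.card ∧ (v.isRight = true →
            2 ≤ (decide (v = u) && !false).toNat + ((G.half v \ B) \ A).card)) := by
      rintro v u A B ⟨⟨h1, h2, h3⟩, -, -, h4, h5, h6⟩
      have hBu : B ⊆ G.half u := h4.trans Finset.sdiff_subset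
      have hdis : Disjoint A B :=
        (Finset.disjoint_of_subset_left h4 Finset.sdiff_disjoint).symm
      have hA : A ⊆ G.half v \ B := Finset.subset_sdiff.2 ⟨h1, hdis⟩
      simp only [Bool.toNat_false, zero_add, Bool.not_false, Bool.and_true] at h5 h6 ⊢
      by_cases huv : u = v
      · subst huv
        refine ⟨⟨hBu, h5, fun hu => ?_⟩, trivial, fun _ => rfl, hA, h2, fun hu => ?_⟩
        · exact h2.trans (Finset.card_le_card hA)
        · rw [sdiff_sdiff_comm]
          exact h6 hu
      · have hne : ∀ h ∈ G.half v, h ∉ G.half u := fun h hv hu =>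
          huv (((mem_half G u h).1 hu).symm.trans ((mem_half G v h).1 hv))
        have e1 : G.half v \ B = G.half v :=
          Finset.sdiff_eq_self_of_disjoint
            (Finset.disjoint_left.2 fun h hv hB => hne h hv (hBu hB))
        have e2 : G.half u \ A = G.half u :=
          Finset.sdiff_eq_self_of_disjoint
            (Finset.disjoint_left.2 fun h hu hA => hne h (h1 hA) hu)
        rw [e2] at h6
        simp only [huv, decide_false, Bool.toNat_false, zero_add] at h6
        refine ⟨⟨hBu, h5, h6⟩, trivial, fun h => by simp at h, hA, h2, fun hv => ?_⟩
        rw [e1]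
        exact (h3 hv).trans (Nat.le_add_left _ _)
    exact ⟨key _ _ _ _, key _ _ _ _⟩
  unfold termA
  by_cases hc : G.IsExpansion v A ∧ (G.expand v A).IsExpansion (lift u) (halfCons false false B)
  swap
  · rw [if_neg hc, if_neg (fun h => hc (hcond.1 h)), neg_zero]
  rw [if_pos hc, if_pos (hcond.2 hc), mul_comm (weight K u), ← smul_neg]
  congr 1
  have hdis : Disjoint A B := by
    have := ((isExpansion_lift G v u A B false false).1 hc.2).2.2.1
    exact (Finset.disjoint_of_subset_left this Finset.sdiff_disjoint).symm
  rw [expand_expand, expand_expand]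
  simp only [Bool.false_eq_true, if_false]
  rw [cls_swap_edges hR]
  have := cls_swap_vertices (K := K) (d := d) hR (I := G.I) (E := G.E) (lift (lift u)) (Sum.inr 0)
    (lift (lift v)) (Sum.inr 1)
    (fun h => if h ∈ B then Sum.inr 0 else if h ∈ A then Sum.inr 1 else lift (lift (G.ends h)))
    0 1 (by simp)
  rw [map_swap_lift, map_swap_lift] at this
  simp only [Sum.map_inr, Equiv.swap_apply_left, Equiv.swap_apply_right] at this
  have hf : (fun h => Sum.map id (Equiv.swap (0 : Fin (G.I + 2)) 1)
      (if h ∈ B then Sum.inr 0 else if h ∈ A then Sum.inr 1 else lift (lift (G.ends h)))) =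
      fun h => if h ∈ A then Sum.inr 0 else if h ∈ B then Sum.inr 1 else
        lift (lift (G.ends h)) := by
    funext h
    by_cases hA : h ∈ A
    · have hB : h ∉ B := Finset.disjoint_left.1 hdis hA
      simp [hA, hB]
    · by_cases hB : h ∈ B
      · simp [hA, hB]
      · simp only [hA, hB, if_false]
        exact map_swap_lift G _
  rw [hf] at this
  rw [this, smul_smul, mul_comm, neg_one_pow_mul_succ, neg_one_smul]

/-- The double expansions in which the second new vertex lies on the first new edge, obtained by
expanding `v` again. -/
theorem term_three (v : Fin n ⊕ Fin G.I) (A B : Finset (Fin G.E × Bool)) :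
    (if G.IsExpansion v A ∧ (G.expand v A).IsExpansion (lift v) (halfCons true false B) then
      (weight K v * weight K v) •
        cls K d R ((G.expand v A).expand (lift v) (halfCons true false B)) else 0) =
      (weight K v * weight K v) • termP K d R G v B A := by
  unfold termP
  rw [smul_ite, smul_zero]
  refine if_congr ?_ ?_ rfl
  · rw [isExpansion_lift]
    simp only [OGraph.IsExpansion]
    constructor
    · rintro ⟨⟨h1, h2, h3⟩, -, -, h4, h5, h6⟩
      refine ⟨h4.trans Finset.sdiff_subset, h1,
        Finset.disjoint_of_subset_left h4 Finset.sdiff_disjoint, ?_, h2, fun h => ?_⟩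
      · simpa [add_comm] using h5
      · have := h6 h
        rw [sdiff_sdiff_comm] at this
        simpa using this
    · rintro ⟨h1, h2, h3, h4, h5, h6⟩
      have hB : B ⊆ G.half v \ A := Finset.subset_sdiff.2 ⟨h1, h3⟩
      refine ⟨⟨h2, h5, fun h => ?_⟩, trivial, fun _ => trivial, hB, ?_, fun h => ?_⟩
      · refine (h6 h).trans (Finset.card_le_card ?_)
        exact Finset.sdiff_subset_sdiff Finset.sdiff_subset subset_rfl
      · simpa [add_comm] using h4
      · have := h6 h
        rw [sdiff_sdiff_comm] at this
        simpa using this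
  · rw [expand_expand]
    rfl

theorem isExpansion_union (v : Fin n ⊕ Fin G.I) (X Y : Finset (Fin G.E × Bool))
    (h : Disjoint X Y) (hX : 1 ≤ X.card) (hY : 2 ≤ Y.card) :
    G.IsExpansion v (X ∪ Y) ↔ X ⊆ G.half v ∧ Y ⊆ G.half v ∧ Disjoint X Y ∧ 1 ≤ X.card ∧
      2 ≤ Y.card ∧ (v.isRight = true → 2 ≤ ((G.half v \ X) \ Y).card) := by
  unfold OGraph.IsExpansion
  have e : G.half v \ (X ∪ Y) = (G.half v \ X) \ Y := by
    ext
    simp only [Finset.mem_sdiff, Finset.mem_union]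
    tauto
  rw [Finset.union_subset_iff, e]
  have : 2 ≤ (X ∪ Y).card := hY.trans (Finset.card_le_card Finset.subset_union_right)
  tauto

/-- The double expansions obtained by expanding the first new vertex, the second one being the end
of the path. -/
theorem term_two (hR : (1 : Equiv.Perm (Fin n)) ∈ R) (v : Fin n ⊕ Fin G.I)
    (X Y : Finset (Fin G.E × Bool)) :
    (if Disjoint X Y then
      (if G.IsExpansion v (X ∪ Y) ∧
          (G.expand v (X ∪ Y)).IsExpansion (Sum.inr 0) (halfCons false false Y) then
        cls K d R ((G.expand v (X ∪ Y)).expand (Sum.inr 0) (halfCons false false Y)) else 0)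
      else 0) = - termP K d R G v X Y := by
  unfold termP
  by_cases h : Disjoint X Y
  swap
  · rw [if_neg h, if_neg (by tauto), neg_zero]
  rw [if_pos h]
  have e : (X ∪ Y) \ Y = X := Finset.union_sdiff_cancel_right h
  by_cases hX : 1 ≤ X.card
  swap
  · rw [if_neg, if_neg (by tauto), neg_zero]
    rw [isExpansion_zero, e]
    simp only [Bool.not_false, Bool.toNat_true]
    omega
  by_cases hY : 2 ≤ Y.card
  swap
  · rw [if_neg, if_neg (by tauto), neg_zero]
    rw [isExpansion_zero, e]
    simp only [Bool.toNat_false]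
    omega
  have hc : (G.expand v (X ∪ Y)).IsExpansion (Sum.inr 0) (halfCons false false Y) := by
    rw [isExpansion_zero, e]
    simp only [Bool.not_false, Bool.toNat_true, Bool.toNat_false]
    exact ⟨trivial, Finset.subset_union_right, by omega, by omega⟩
  simp only [hc, and_true, isExpansion_union G v X Y h hX hY]
  split_ifs with hh
  swap
  · simp
  rw [expand_expand]
  simp only [Bool.false_eq_true, if_false]
  rw [cls_swap_edges hR]
  have := cls_swap_vertices (K := K) (d := d) hR (I := G.I) (E := G.E) (lift (lift v)) (Sum.inr 0)
    (Sum.inr 0) (Sum.inr 1)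
    (fun h => if h ∈ X then Sum.inr 0 else if h ∈ Y then Sum.inr 1 else lift (lift (G.ends h)))
    0 1 (by simp)
  rw [map_swap_lift] at this
  simp only [Sum.map_inr, Equiv.swap_apply_left, Equiv.swap_apply_right] at this
  have hf : (fun h => Sum.map id (Equiv.swap (0 : Fin (G.I + 2)) 1)
      (if h ∈ X then Sum.inr 0 else if h ∈ Y then Sum.inr 1 else lift (lift (G.ends h)))) =
      fun h => if h ∈ Y then Sum.inr 0 else if h ∈ X ∪ Y then Sum.inr 1 else
        lift (lift (G.ends h)) := by
    funext g
    by_cases hA : g ∈ X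
    · have hB : g ∉ Y := Finset.disjoint_left.1 h hA
      simp [hA, hB]
    · by_cases hB : g ∈ Y
      · simp [hA, hB]
      · simp only [hA, hB, if_false, Finset.mem_union, or_false]
        exact map_swap_lift G _
  rw [hf] at this
  have hl : lift (Sum.inr 0 : Fin n ⊕ Fin (G.I + 1)) = Sum.inr 1 := rfl
  rw [hl, this, smul_smul, mul_comm, neg_one_pow_mul_succ, neg_one_smul]

/-- The double expansions obtained by expanding the first new vertex, the first one being the end
of the path. -/
theorem term_two' (hR : (1 : Equiv.Perm (Fin n)) ∈ R) (v : Fin n ⊕ Fin G.I)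
    (X Y : Finset (Fin G.E × Bool)) :
    (if Disjoint Y X then
      (if G.IsExpansion v (Y ∪ X) ∧
          (G.expand v (Y ∪ X)).IsExpansion (Sum.inr 0) (halfCons false true X) then
        cls K d R ((G.expand v (Y ∪ X)).expand (Sum.inr 0) (halfCons false true X)) else 0)
      else 0) = - termP K d R G v X Y := by
  unfold termP
  by_cases h' : Disjoint Y X
  swap
  · rw [if_neg h', if_neg (by rintro ⟨-, -, h, -⟩; exact h' h.symm), neg_zero]
  have h := h'.symm
  rw [if_pos h']
  have e : (Y ∪ X) \ X = Y := Finset.union_sdiff_cancel_right h'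
  by_cases hX : 1 ≤ X.card
  swap
  · rw [if_neg, if_neg (by tauto), neg_zero]
    rw [isExpansion_zero, e]
    simp only [Bool.toNat_true]
    omega
  by_cases hY : 2 ≤ Y.card
  swap
  · rw [if_neg, if_neg (by tauto), neg_zero]
    rw [isExpansion_zero, e]
    simp only [Bool.not_true, Bool.toNat_false]
    omega
  have hc : (G.expand v (Y ∪ X)).IsExpansion (Sum.inr 0) (halfCons false true X) := by
    rw [isExpansion_zero, e]
    simp only [Bool.not_true, Bool.toNat_true, Bool.toNat_false]
    exact ⟨trivial, Finset.subset_union_right, by omega, by omega⟩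
  simp only [hc, and_true]
  rw [Finset.union_comm]
  simp only [isExpansion_union G v X Y h hX hY]
  split_ifs with hh
  swap
  · simp
  rw [Finset.union_comm, expand_expand]
  simp only [Bool.false_eq_true, if_false, if_true]
  have hl : lift (Sum.inr 0 : Fin n ⊕ Fin (G.I + 1)) = Sum.inr 1 := rfl
  have hf : (fun g => if g ∈ X then Sum.inr 0 else if g ∈ Y ∪ X then Sum.inr 1 else
        lift (lift (G.ends g))) =
      fun g => if g ∈ X then Sum.inr 0 else if g ∈ Y then Sum.inr 1 else
        lift (lift (G.ends g)) := by
    funext g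
    by_cases hA : g ∈ X <;> by_cases hB : g ∈ Y <;> simp [hA, hB]
  rw [hf, hl, cls_flip_zero hR, cls_swap_edges hR, smul_smul, neg_one_pow_mul_succ, neg_one_smul]

/-- Reversal of the path of length two that replaces an internal vertex. -/
theorem termP_reverse (hR : (1 : Equiv.Perm (Fin n)) ∈ R) (v : Fin G.I)
    (X Y : Finset (Fin G.E × Bool))
    (h : X ⊆ G.half (Sum.inr v) ∧ Y ⊆ G.half (Sum.inr v) ∧ Disjoint X Y ∧ 1 ≤ X.card ∧ 2 ≤ Y.card ∧
      ((Sum.inr v : Fin n ⊕ Fin G.I).isRight = true →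
        2 ≤ ((G.half (Sum.inr v) \ X) \ Y).card)) :
    termP K d R G (Sum.inr v) X ((G.half (Sum.inr v) \ X) \ Y) =
      - termP K d R G (Sum.inr v) X Y := by
  have hYX : Y ⊆ G.half (Sum.inr v) \ X := Finset.subset_sdiff.2 ⟨h.2.1, h.2.2.1.symm⟩
  have hZ : (G.half (Sum.inr v) \ X) \ ((G.half (Sum.inr v) \ X) \ Y) = Y :=
    Finset.sdiff_sdiff_eq_self hYX
  have h' : X ⊆ G.half (Sum.inr v) ∧ (G.half (Sum.inr v) \ X) \ Y ⊆ G.half (Sum.inr v) ∧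
      Disjoint X ((G.half (Sum.inr v) \ X) \ Y) ∧ 1 ≤ X.card ∧
        2 ≤ ((G.half (Sum.inr v) \ X) \ Y).card ∧
      ((Sum.inr v : Fin n ⊕ Fin G.I).isRight = true →
        2 ≤ ((G.half (Sum.inr v) \ X) \ ((G.half (Sum.inr v) \ X) \ Y)).card) := by
    refine ⟨h.1, Finset.sdiff_subset.trans Finset.sdiff_subset, ?_, h.2.2.2.1, h.2.2.2.2.2 rfl,
      fun _ => ?_⟩
    · exact (Finset.disjoint_of_subset_left Finset.sdiff_subset Finset.sdiff_disjoint).symm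
    · rw [hZ]
      exact h.2.2.2.2.1
  unfold termP
  rw [if_pos h, if_pos h']
  have hv : (1 : Fin (G.I + 2)) ≠ v.succ.succ := by simp [Fin.ext_iff]
  have key := cls_swap_vertices (K := K) (d := d) hR (I := G.I) (E := G.E)
    (lift (lift (Sum.inr v))) (Sum.inr 0) (Sum.inr 0) (Sum.inr 1)
    (fun h => if h ∈ X then Sum.inr 0 else if h ∈ Y then Sum.inr 1 else lift (lift (G.ends h)))
    1 v.succ.succ hv
  have h0 : Equiv.swap 1 v.succ.succ (0 : Fin (G.I + 2)) = 0 :=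
    Equiv.swap_apply_of_ne_of_ne (by simp) (Fin.succ_ne_zero _).symm
  have hl : (lift (lift (Sum.inr v)) : Fin n ⊕ Fin (G.I + 2)) = Sum.inr v.succ.succ := rfl
  have hf : (fun g => Sum.map id (Equiv.swap 1 v.succ.succ)
      (if g ∈ X then Sum.inr 0 else if g ∈ Y then Sum.inr 1 else lift (lift (G.ends g)))) =
      fun g => if g ∈ X then Sum.inr 0 else if g ∈ (G.half (Sum.inr v) \ X) \ Y then Sum.inr 1
        else lift (lift (G.ends g)) := by
    funext g
    by_cases hX : g ∈ X
    · simp [hX, h0]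
    · by_cases hY : g ∈ Y
      · have : G.ends g = Sum.inr v := (mem_half G _ _).1 (h.2.1 hY)
        simp [hX, hY, this, hl]
      · by_cases hZ : g ∈ G.half (Sum.inr v)
        · have : G.ends g = Sum.inr v := (mem_half G _ _).1 hZ
          simp [hX, hY, hZ, this, hl]
        · have hne : G.ends g ≠ Sum.inr v := fun h => hZ ((mem_half G _ _).2 h)
          simp only [hX, hY, hZ, if_false, Finset.mem_sdiff, false_and]
          rcases hg : G.ends g with i | w
          · rfl
          · have hw : w ≠ v := fun h => hne (by rw [hg, h])
            have : (lift (lift (Sum.inr w)) : Fin n ⊕ Fin (G.I + 2)) = Sum.inr w.succ.succ := rfl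
            rw [this, Sum.map_inr, Equiv.swap_apply_of_ne_of_ne]
            · simp [Fin.ext_iff]
            · simpa using hw
  rw [hl, hf] at key
  simp only [Sum.map_inr, Equiv.swap_apply_left, Equiv.swap_apply_right, h0] at key
  rw [hl, cls_flip_zero hR, cls_swap_edges hR, cls_flip_zero hR, key, smul_smul, smul_smul,
    smul_smul]
  have : (-1 : K) ^ d * (-1) ^ (d + 1) * (-1) ^ d * (-1) ^ d = -1 := by
    rw [neg_one_pow_mul_succ, mul_assoc, ← mul_pow]
    simp
  rw [this, neg_one_smul]

theorem sum_termP_inr [CharZero K] (hR : (1 : Equiv.Perm (Fin n)) ∈ R) (v : Fin G.I) :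
    ∑ X, ∑ Y, termP K d R G (Sum.inr v) X Y = 0 := by
  refine Finset.sum_eq_zero fun X _ => ?_
  let good : Finset (Finset (Fin G.E × Bool)) :=
    {Y | X ⊆ G.half (Sum.inr v) ∧ Y ⊆ G.half (Sum.inr v) ∧ Disjoint X Y ∧ 1 ≤ X.card ∧
      2 ≤ Y.card ∧ ((Sum.inr v : Fin n ⊕ Fin G.I).isRight = true →
        2 ≤ ((G.half (Sum.inr v) \ X) \ Y).card)}
  have h1 : ∑ Y, termP K d R G (Sum.inr v) X Y = ∑ Y ∈ good, termP K d R G (Sum.inr v) X Y := by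
    rw [Finset.sum_filter]
    refine Finset.sum_congr rfl fun Y _ => ?_
    split_ifs with h
    · rfl
    · rw [termP, if_neg h]
  have hgood : ∀ Y ∈ good, (G.half (Sum.inr v) \ X) \ Y ∈ good ∧
      (G.half (Sum.inr v) \ X) \ ((G.half (Sum.inr v) \ X) \ Y) = Y := by
    intro Y hY
    obtain ⟨h1, h2, h3, h4, h5, h6⟩ := (Finset.mem_filter.1 hY).2
    have hZ : (G.half (Sum.inr v) \ X) \ ((G.half (Sum.inr v) \ X) \ Y) = Y :=
      Finset.sdiff_sdiff_eq_self (Finset.subset_sdiff.2 ⟨h2, h3.symm⟩)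
    refine ⟨Finset.mem_filter.2 ⟨Finset.mem_univ _, h1,
      Finset.sdiff_subset.trans Finset.sdiff_subset, ?_, h4, h6 rfl, fun _ => ?_⟩, hZ⟩
    · exact (Finset.disjoint_of_subset_left Finset.sdiff_subset Finset.sdiff_disjoint).symm
    · rw [hZ]
      exact h5
  have h2 : ∑ Y ∈ good, termP K d R G (Sum.inr v) X Y =
      ∑ Y ∈ good, - termP K d R G (Sum.inr v) X Y := by
    refine Finset.sum_nbij' (fun Y => (G.half (Sum.inr v) \ X) \ Y)
      (fun Y => (G.half (Sum.inr v) \ X) \ Y) (fun Y hY => (hgood Y hY).1)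
      (fun Y hY => (hgood Y hY).1) (fun Y hY => (hgood Y hY).2) (fun Y hY => (hgood Y hY).2) ?_
    intro Y hY
    rw [termP_reverse G hR v X Y (Finset.mem_filter.1 hY).2, neg_neg]
  rw [h1]
  rw [Finset.sum_neg_distrib] at h2
  exact eq_zero_of_eq_neg_self (K := K) h2

end terms

theorem diff_expansionSum [CharZero K] (hR : (1 : Equiv.Perm (Fin n)) ∈ R) (G : OGraph n) :
    diff K d R (expansionSum K d R G) = 0 := by
  have hexp : ∀ (v : Fin n ⊕ Fin G.I) (A : Finset (Fin G.E × Bool)),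
      expansionSum K d R (G.expand v A) =
        (∑ B, ((2⁻¹ : K) •
            (if (G.expand v A).IsExpansion (Sum.inr 0) (halfCons false false B) then
              cls K d R ((G.expand v A).expand (Sum.inr 0) (halfCons false false B)) else 0) +
          (2⁻¹ : K) •
            (if (G.expand v A).IsExpansion (Sum.inr 0) (halfCons false true B) then
              cls K d R ((G.expand v A).expand (Sum.inr 0) (halfCons false true B)) else 0))) +
        ((∑ u, ∑ B, if (G.expand v A).IsExpansion (lift u) (halfCons false false B) then
          weight K u • cls K d R ((G.expand v A).expand (lift u) (halfCons false false B)) else 0) +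
        ∑ B, if (G.expand v A).IsExpansion (lift v) (halfCons true false B) then
          weight K v • cls K d R ((G.expand v A).expand (lift v) (halfCons true false B)) else 0) := by
    intro v A
    have hsplit : ∀ F : Fin n ⊕ Fin (G.I + 1) → GraphSpace K d n R,
        ∑ w, F w = F (Sum.inr 0) + ∑ u : Fin n ⊕ Fin G.I, F (lift u) := by
      intro F
      rw [Fintype.sum_sum_type, Fin.sum_univ_succ, Fintype.sum_sum_type]
      simp only [lift, Sum.map_inl, Sum.map_inr, id]
      abel
    unfold expansionSum
    rw [hsplit]
    congr 1
    · rw [sum_halfCons]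
      refine Finset.sum_congr rfl fun B _ => ?_
      have h1 : ∀ t, ¬ (G.expand v A).IsExpansion (Sum.inr 0) (halfCons true t B) := fun t h => by
        simpa using ((isExpansion_zero G v A B true t).1 h).1
      have hw : weight K (Sum.inr 0 : Fin n ⊕ Fin (G.I + 1)) = 2⁻¹ := rfl
      rw [if_neg (h1 _), if_neg (h1 _), add_zero, add_zero, smul_ite, smul_zero, smul_ite,
        smul_zero, hw]
    · have hw : ∀ u : Fin n ⊕ Fin G.I, weight K (lift u) = weight K u := by
        rintro (u | u) <;> rfl
      have h1 : ∀ u s B, ¬ (G.expand v A).IsExpansion (lift u) (halfCons s true B) :=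
        fun u s B h => by simpa using ((isExpansion_lift G v u A B s true).1 h).1
      have h2 : ∀ u B, u ≠ v → ¬ (G.expand v A).IsExpansion (lift u) (halfCons true false B) :=
        fun u B huv h => huv (((isExpansion_lift G v u A B true false).1 h).2.1 rfl)
      simp only [sum_halfCons, h1, if_false, add_zero, hw, Finset.sum_add_distrib]
      congr 1
      refine Finset.sum_eq_single_of_mem v (Finset.mem_univ v) fun u _ huv => ?_
      exact Finset.sum_eq_zero fun B _ => if_neg (h2 u B huv)
  have hD : diff K d R (expansionSum K d R G) =
      (∑ v, ∑ A, ∑ u, ∑ B, termA K d R G v A u B) +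
      ∑ v, ((∑ A, ∑ B, (weight K v * weight K v) • termP K d R G v B A) +
        ((weight K v * 2⁻¹) • ∑ B : Finset (Fin G.E × Bool), ∑ A, (if B ⊆ A then (if G.IsExpansion v A ∧
            (G.expand v A).IsExpansion (Sum.inr 0) (halfCons false false B) then
              cls K d R ((G.expand v A).expand (Sum.inr 0) (halfCons false false B)) else 0) else 0) +
        (weight K v * 2⁻¹) • ∑ B : Finset (Fin G.E × Bool), ∑ A, (if B ⊆ A then (if G.IsExpansion v A ∧
            (G.expand v A).IsExpansion (Sum.inr 0) (halfCons false true B) then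
              cls K d R ((G.expand v A).expand (Sum.inr 0) (halfCons false true B)) else 0)
              else 0))) := by
    rw [← Finset.sum_add_distrib]
    conv_lhs => rw [expansionSum]
    rw [map_sum]
    refine Finset.sum_congr rfl fun v _ => ?_
    rw [map_sum, Finset.sum_comm (f := fun B A : Finset (Fin G.E × Bool) => if B ⊆ A then (if G.IsExpansion v A ∧
            (G.expand v A).IsExpansion (Sum.inr 0) (halfCons false false B) then
              cls K d R ((G.expand v A).expand (Sum.inr 0) (halfCons false false B)) else 0) else 0),
      Finset.sum_comm (f := fun B A : Finset (Fin G.E × Bool) => if B ⊆ A then (if G.IsExpansion v A ∧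
            (G.expand v A).IsExpansion (Sum.inr 0) (halfCons false true B) then
              cls K d R ((G.expand v A).expand (Sum.inr 0) (halfCons false true B)) else 0) else 0)]
    rw [Finset.smul_sum, Finset.smul_sum, ← Finset.sum_add_distrib, ← Finset.sum_add_distrib,
      ← Finset.sum_add_distrib]
    refine Finset.sum_congr rfl fun A _ => ?_
    by_cases h : G.IsExpansion v A
    · have hsub : ∀ t B, (B ⊆ A ∧
          (G.expand v A).IsExpansion (Sum.inr 0) (halfCons false t B)) ↔
          (G.expand v A).IsExpansion (Sum.inr 0) (halfCons false t B) := fun t B =>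
        ⟨fun h => h.2, fun h => ⟨((isExpansion_zero G v A B false t).1 h).2.1, h⟩⟩
      rw [if_pos h, map_smul, diff, liftCls_cls, hexp]
      simp only [← term_three, termA, h, true_and, ← ite_and, hsub]
      simp only [smul_add, Finset.smul_sum, Finset.sum_add_distrib, smul_ite, smul_zero, smul_smul]
      abel
    · rw [if_neg h, map_zero]
      simp only [← term_three, termA, h, false_and, if_false, ite_self, Finset.sum_const_zero,
        smul_zero, add_zero]
  rw [hD]
  have hA : (∑ v, ∑ A, ∑ u, ∑ B, termA K d R G v A u B) = 0 := by
    have e : ∀ F : Fin n ⊕ Fin G.I → Finset (Fin G.E × Bool) → Fin n ⊕ Fin G.I →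
        Finset (Fin G.E × Bool) → GraphSpace K d n R,
        (∑ v, ∑ A, ∑ u, ∑ B, F v A u B) = ∑ p : (Fin n ⊕ Fin G.I) × Finset (Fin G.E × Bool),
          ∑ q : (Fin n ⊕ Fin G.I) × Finset (Fin G.E × Bool), F p.1 p.2 q.1 q.2 := by
      intro F
      simp only [Fintype.sum_prod_type]
    rw [e]
    have h2 : (∑ p : (Fin n ⊕ Fin G.I) × Finset (Fin G.E × Bool),
          ∑ q : (Fin n ⊕ Fin G.I) × Finset (Fin G.E × Bool), termA K d R G p.1 p.2 q.1 q.2) =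
        - ∑ p : (Fin n ⊕ Fin G.I) × Finset (Fin G.E × Bool),
          ∑ q : (Fin n ⊕ Fin G.I) × Finset (Fin G.E × Bool), termA K d R G p.1 p.2 q.1 q.2 := by
      conv_lhs => rw [Finset.sum_comm]
      simp only [← Finset.sum_neg_distrib]
      exact Finset.sum_congr rfl fun p _ => Finset.sum_congr rfl fun q _ =>
        termA_swap G hR p.1 p.2 q.1 q.2
    exact eq_zero_of_eq_neg_self (K := K) h2
  rw [hA, zero_add]
  refine Finset.sum_eq_zero fun v _ => ?_
  simp only [sum_superset]
  have e1 : ∀ B : Finset (Fin G.E × Bool), (∑ X, (if Disjoint X B then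
      (if G.IsExpansion v (X ∪ B) ∧
          (G.expand v (X ∪ B)).IsExpansion (Sum.inr 0) (halfCons false false B) then
        cls K d R ((G.expand v (X ∪ B)).expand (Sum.inr 0) (halfCons false false B)) else 0)
      else 0)) = ∑ X, - termP K d R G v X B := fun B =>
    Finset.sum_congr rfl fun X _ => term_two G hR v X B
  have e2 : ∀ B : Finset (Fin G.E × Bool), (∑ X, (if Disjoint X B then
      (if G.IsExpansion v (X ∪ B) ∧
          (G.expand v (X ∪ B)).IsExpansion (Sum.inr 0) (halfCons false true B) then
        cls K d R ((G.expand v (X ∪ B)).expand (Sum.inr 0) (halfCons false true B)) else 0)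
      else 0)) = ∑ X, - termP K d R G v B X := fun B =>
    Finset.sum_congr rfl fun X _ => term_two' G hR v B X
  simp only [e1, e2]
  rw [Finset.sum_comm (f := fun A B => (weight K v * weight K v) • termP K d R G v B A),
    Finset.sum_comm (f := fun B X => - termP K d R G v X B)]
  simp only [← Finset.smul_sum, Finset.sum_neg_distrib]
  rcases v with v | v
  · have : weight K (Sum.inl v : Fin n ⊕ Fin G.I) = 1 := rfl
    rw [this]
    rw [← add_smul, smul_neg, ← add_halves (1 : K)]
    have h2 : (1 : K) * 2⁻¹ + 1 * 2⁻¹ = 1 := by norm_num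
    simp only [add_halves]
    rw [h2]
    simp
  · rw [sum_termP_inr G hR v]
    simp

theorem diff_diff [CharZero K] (hR : (1 : Equiv.Perm (Fin n)) ∈ R) (x : GraphSpace K d n R) :
    diff K d R (diff K d R x) = 0 := by
  have : diff K d R ∘ₗ diff K d R = 0 := hom_ext fun G => by
    rw [LinearMap.comp_apply, diff, liftCls_cls]
    exact diff_expansionSum hR G
  exact LinearMap.congr_fun this x

end square
section pull

variable (K : Type u) [Field K] (d : ℕ)

namespace OGraph

theorem mem_reconnections {m n : ℕ} (G : OGraph n) (α : Fin m → Option (Fin n))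
    (f : Fin G.E × Bool → Fin m ⊕ Fin G.I) :
    f ∈ G.reconnections α ↔ ∀ h, extMap α (f h) = some (G.ends h) := by
  simp [reconnections]

/-- The graph with the same vertices and edges, and with other ends of the edges. -/
abbrev reconnect {m n : ℕ} (G : OGraph n) (f : Fin G.E × Bool → Fin m ⊕ Fin G.I) : OGraph m :=
  ⟨G.I, G.E, f⟩

theorem extMap_map {m n I : ℕ} (α : Fin m → Option (Fin n)) (σ : Equiv.Perm (Fin I))
    (x : Fin m ⊕ Fin I) :
    extMap α (Equiv.sumCongr 1 σ x) = (extMap α x).map (Equiv.sumCongr 1 σ) := by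
  rcases x with x | x
  · simp only [extMap, Equiv.sumCongr_apply, Sum.map_inl, Sum.elim_inl, Equiv.Perm.coe_one, id]
    rcases α x with _ | y <;> rfl
  · rfl

theorem extMap_bind {l m n I : ℕ} (β : Fin l → Option (Fin m)) (α : Fin m → Option (Fin n))
    (x : Fin l ⊕ Fin I) :
    extMap (fun j => (β j).bind α) x = (extMap β x).bind (extMap α) := by
  rcases x with x | x
  · simp only [extMap, Sum.elim_inl]
    rcases β x with _ | y <;> rfl
  · rfl

end OGraph

/-- The sum of the reconnections of a graph. -/
def reconnectionSum {m n : ℕ} (α : Fin m → Option (Fin n)) (G : OGraph n) :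
    GraphSpace K d m {1} :=
  ∑ f ∈ G.reconnections α, cls K d {1} (G.reconnect f)

theorem reconnectionSum_act {m n : ℕ} (α : Fin m → Option (Fin n)) (G : OGraph n) (ρ σ τ φ)
    (hρ : ρ ∈ ({1} : Set (Equiv.Perm (Fin n)))) :
    reconnectionSum K d α (G.act ρ σ τ φ) =
      (((Equiv.Perm.sign ρ : ℤ) : K) * orientSign K d σ τ φ) • reconnectionSum K d α G := by
  obtain rfl : ρ = 1 := hρ
  unfold reconnectionSum
  rw [Finset.smul_sum]
  symm
  let Φ : (Fin G.E × Bool → Fin m ⊕ Fin G.I) ≃ (Fin G.E × Bool → Fin m ⊕ Fin G.I) :=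
    Equiv.arrowCongr (actHalf τ φ).symm (Equiv.sumCongr 1 σ)
  have hΦ : ∀ f h, Φ f h = Equiv.sumCongr 1 σ (f (actHalf τ φ h)) := fun f h => rfl
  refine Finset.sum_equiv Φ (fun f => ?_) (fun f _ => ?_)
  · rw [mem_reconnections, mem_reconnections]
    have : ∀ h, extMap α (Φ f h) = some ((G.act 1 σ τ φ).ends h) ↔
        extMap α (f (actHalf τ φ h)) = some (G.ends (actHalf τ φ h)) := by
      intro h
      rw [hΦ, extMap_map]
      have e : (G.act 1 σ τ φ).ends h = Equiv.sumCongr 1 σ (G.ends (actHalf τ φ h)) := rfl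
      rw [e, ← Option.map_some]
      exact (Option.map_injective (Equiv.injective _)).eq_iff
    constructor
    · exact fun h g => (this g).2 (h _)
    · intro h g
      have := (this ((actHalf τ φ).symm g)).1 (h _)
      simpa using this
  · have := cls_act K d (R := {1}) (G.reconnect f) 1 rfl σ τ φ
    have e : (G.act 1 σ τ φ).reconnect (Φ f) = (G.reconnect f).act 1 σ τ φ := rfl
    rw [e, this]
    simp

/-- The structure map of a pointed map `α`: the sum of all the reconnections. It is the composition
with the elements of the commutative operad, represented by the graphs without edges and internal
vertices. -/
def pull {m n : ℕ} (α : Fin m → Option (Fin n)) : GraphSpace K d n {1} →ₗ[K] GraphSpace K d m {1} :=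
  liftCls K d (reconnectionSum K d α) fun G ρ σ τ φ hρ => reconnectionSum_act K d α G ρ σ τ φ hρ

theorem pull_deg {m n : ℕ} (α : Fin m → Option (Fin n)) (k : ℤ) :
    ∀ x ∈ graphDeg K d ({1} : Set (Equiv.Perm (Fin n))) k, pull K d α x ∈ graphDeg K d {1} k := by
  intro x hx
  induction hx using Submodule.span_induction with
  | mem y hy =>
    obtain ⟨G, hG, rfl⟩ := hy
    rw [pull, liftCls_cls]
    exact Submodule.sum_mem _ fun f _ => Submodule.subset_span ⟨_, hG, rfl⟩
  | zero => simp
  | add y z _ _ hy hz => rw [map_add]; exact add_mem hy hz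
  | smul a y _ hy => rw [map_smul]; exact Submodule.smul_mem _ _ hy

theorem pull_id {n : ℕ} (x : GraphSpace K d n {1}) : pull K d (fun j => some j) x = x := by
  have : pull K d (fun j : Fin n => some j) = LinearMap.id := hom_ext fun G => by
    rw [pull, liftCls_cls, reconnectionSum, Finset.sum_eq_single_of_mem G.ends]
    · rfl
    · rw [mem_reconnections]
      intro h
      rcases G.ends h <;> rfl
    · intro f hf hne
      refine absurd (funext fun h => ?_) hne
      have := (mem_reconnections _ _ _).1 hf h
      have e : ∀ x : Fin n ⊕ Fin G.I, extMap (fun j : Fin n => some j) x = some x := by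
        rintro (x | x) <;> rfl
      rw [e] at this
      exact Option.some_injective _ this
  rw [this]
  rfl

theorem pull_comp {l m n : ℕ} (β : Fin l → Option (Fin m)) (α : Fin m → Option (Fin n))
    (x : GraphSpace K d n {1}) :
    pull K d β (pull K d α x) = pull K d (fun j => (β j).bind α) x := by
  have : pull K d β ∘ₗ pull K d α = pull K d (fun j => (β j).bind α) := hom_ext fun G => by
    rw [LinearMap.comp_apply]
    simp only [pull, liftCls_cls, reconnectionSum, map_sum]
    rw [Finset.sum_sigma']
    refine Finset.sum_bij (fun p _ => p.2) ?_ ?_ ?_ ?_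
    · rintro ⟨f, g⟩ h
      obtain ⟨hf, hg⟩ := Finset.mem_sigma.1 h
      rw [mem_reconnections] at hf hg ⊢
      intro h
      rw [extMap_bind, hg h]
      exact hf h
    · rintro ⟨f, g⟩ h ⟨f', g'⟩ h' hgg
      obtain rfl : g = g' := hgg
      have hg := (mem_reconnections _ _ _).1 (Finset.mem_sigma.1 h).2
      have hg' := (mem_reconnections _ _ _).1 (Finset.mem_sigma.1 h').2
      have : f = f' := funext fun i => Option.some_injective _ ((hg i).symm.trans (hg' i))
      subst this
      rfl
    · intro g hg
      rw [mem_reconnections] at hg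
      have h1 : ∀ h, ∃ y, extMap β (g h) = some y ∧ extMap α y = some (G.ends h) := by
        intro h
        have := hg h
        rw [extMap_bind, Option.bind_eq_some_iff] at this
        exact this
      choose f hf using h1
      refine ⟨⟨f, g⟩, Finset.mem_sigma.2 ⟨?_, ?_⟩, rfl⟩
      · rw [mem_reconnections]
        exact fun h => (hf h).2
      · rw [mem_reconnections]
        exact fun h => (hf h).1
    · intro p _
      rfl
  exact LinearMap.congr_fun this x

theorem expansionSum_eq {n : ℕ} (R : Set (Equiv.Perm (Fin n))) (G : OGraph n) :
    expansionSum K d R G =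
      ∑ p : (Fin n ⊕ Fin G.I) × Finset (Fin G.E × Bool) with G.IsExpansion p.1 p.2,
        weight K p.1 • cls K d R (G.expand p.1 p.2) := by
  rw [Finset.sum_filter, Fintype.sum_prod_type]
  rfl

namespace OGraph

theorem extMap_lift {m n I : ℕ} (α : Fin m → Option (Fin n)) (x : Fin m ⊕ Fin I) :
    extMap α (lift x) = (extMap α x).map lift := by
  rcases x with x | x
  · simp only [extMap, lift, Sum.map_inl, Sum.elim_inl, id]
    rcases α x with _ | y <;> rfl
  · rfl

theorem exists_lift_of_extMap {m n I : ℕ} (α : Fin m → Option (Fin n)) (x : Fin m ⊕ Fin (I + 1))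
    (y : Fin n ⊕ Fin I) (h : extMap α x = some (lift y)) :
    ∃ z, x = lift z ∧ extMap α z = some y := by
  have key : ∃ z, x = lift z := by
    rcases x with x | x
    · exact ⟨Sum.inl x, rfl⟩
    · refine Fin.cases (fun h => ?_) (fun x _ => ⟨Sum.inr x, rfl⟩) x h
      exact absurd (Option.some_injective _ h).symm (lift_ne y)
  obtain ⟨z, rfl⟩ := key
  refine ⟨z, rfl, ?_⟩
  rw [extMap_lift, ← Option.map_some] at h
  exact Option.map_injective lift_injective h

theorem extMap_eq_zero {m n I : ℕ} (α : Fin m → Option (Fin n)) (x : Fin m ⊕ Fin (I + 1))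
    (h : extMap α x = some (Sum.inr 0)) : x = Sum.inr 0 := by
  rcases x with x | x
  · simp only [extMap, Sum.elim_inl] at h
    rcases hx : α x with _ | y <;> simp [hx] at h
  · have h1 : (Sum.inr x : Fin n ⊕ Fin (I + 1)) = Sum.inr 0 := Option.some_injective _ h
    rw [Sum.inr.inj h1]

theorem extMap_isRight {m n I : ℕ} (α : Fin m → Option (Fin n)) (x : Fin m ⊕ Fin I)
    (y : Fin n ⊕ Fin I) (h : extMap α x = some y) :
    (x.isRight = y.isRight) ∧ (x.isRight = true → ∃ v, x = Sum.inr v ∧ y = Sum.inr v) := by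
  rcases x with x | x
  · simp only [extMap, Sum.elim_inl] at h
    rcases hx : α x with _ | z
    · simp [hx] at h
    · simp only [hx, Option.map_some, Option.some.injEq] at h
      simp [← h]
  · have : y = Sum.inr x := (Option.some_injective _ h).symm
    simp [this]

theorem half_reconnect_inr {m n : ℕ} (G : OGraph n) (α : Fin m → Option (Fin n))
    (f : Fin G.E × Bool → Fin m ⊕ Fin G.I) (hf : f ∈ G.reconnections α) (v : Fin G.I) :
    (G.reconnect f).half (Sum.inr v) = G.half (Sum.inr v) := by
  ext h
  rw [mem_half, mem_half]
  have h1 := (mem_reconnections _ _ _).1 hf h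
  constructor
  · intro h2
    rw [show f h = Sum.inr v from h2] at h1
    exact (Option.some_injective _ h1).symm
  · intro h2
    rw [h2] at h1
    have := extMap_isRight α _ _ h1
    obtain ⟨w, hw, hw'⟩ := this.2 (this.1.trans rfl)
    rw [Sum.inr.injEq] at hw'
    rw [hw']
    exact hw

theorem weight_extMap {m n I : ℕ} (α : Fin m → Option (Fin n)) (x : Fin m ⊕ Fin I)
    (y : Fin n ⊕ Fin I) (h : extMap α x = some y) : weight K x = weight K y := by
  have := (extMap_isRight α x y h).1
  rcases x with x | x <;> rcases y with y | y <;> first | rfl | simp at this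

end OGraph

theorem pull_diff {m n : ℕ} (α : Fin m → Option (Fin n)) (x : GraphSpace K d n {1}) :
    pull K d α (diff K d {1} x) = diff K d {1} (pull K d α x) := by
  have : pull K d α ∘ₗ diff K d {1} = diff K d {1} ∘ₗ pull K d α := hom_ext fun G => by
    rw [LinearMap.comp_apply, LinearMap.comp_apply]
    simp only [pull, diff, liftCls_cls, expansionSum_eq, map_sum, map_smul, reconnectionSum,
      Finset.smul_sum]
    rw [Finset.sum_sigma', Finset.sum_sigma']
    symm
    let S := (G.reconnections α).sigma (fun f =>
        (Finset.univ.filter fun p : (Fin m ⊕ Fin G.I) × Finset (Fin G.E × Bool) =>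
          (G.reconnect f).IsExpansion p.1 p.2))
    have hval : ∀ a ∈ S, ∃ v, extMap α a.2.1 = some v := by
      rintro ⟨f, w, A⟩ h
      obtain ⟨hf, hw⟩ := Finset.mem_sigma.1 h
      obtain ⟨h1, h2, h3⟩ := (Finset.mem_filter.1 hw).2
      obtain ⟨x, hx⟩ := Finset.card_pos.1 (lt_of_lt_of_le two_pos h2)
      have := (mem_half (G.reconnect f) w x).1 (h1 hx)
      dsimp only at this ⊢
      rw [← this, (mem_reconnections _ _ _).1 hf x]
      exact ⟨_, rfl⟩
    choose V hV using hval
    refine Finset.sum_bij (s := S) (fun a ha => ⟨(V a ha, a.2.2),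
      ((G.reconnect a.1).expand a.2.1 a.2.2).ends⟩) ?_ ?_ ?_ ?_
    · rintro ⟨f, w, A⟩ h
      have hVw := hV ⟨f, w, A⟩ h
      obtain ⟨hf, hw⟩ := Finset.mem_sigma.1 h
      obtain ⟨h1, h2, h3⟩ := (Finset.mem_filter.1 hw).2
      dsimp only at hVw hf h1 h2 h3 ⊢
      generalize V ⟨f, w, A⟩ h = v at hVw ⊢
      rw [mem_reconnections] at hf
      refine Finset.mem_sigma.2 ⟨Finset.mem_filter.2 ⟨Finset.mem_univ _, ?_, h2, ?_⟩, ?_⟩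
      · intro x hx
        have := (mem_half (G.reconnect f) w x).1 (h1 hx)
        rw [mem_half]
        have h4 := hf x
        rw [show f x = w from this] at h4
        exact Option.some_injective _ (h4.symm.trans hVw)
      · intro hv
        have hr := extMap_isRight α w v hVw
        obtain ⟨u, rfl, rfl⟩ := hr.2 (hr.1.trans hv)
        rw [← half_reconnect_inr G α f ((mem_reconnections _ _ _).2 hf)]
        exact h3 rfl
      · rw [mem_reconnections]
        rintro ⟨e, b⟩
        refine Fin.cases ?_ (fun e => ?_) e
        · simp only [Fin.cases_zero]
          cases b
          · simp only [Bool.false_eq_true, if_false]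
            rw [extMap_lift, hVw]
            rfl
          · rfl
        · simp only [Fin.cases_succ]
          split_ifs with hA
          · rfl
          · rw [extMap_lift, hf]
            rfl
    · rintro ⟨f, w, A⟩ h ⟨f', w', A'⟩ h' heq
      dsimp only at heq
      obtain ⟨-, hw⟩ := Finset.mem_sigma.1 h
      obtain ⟨-, hw'⟩ := Finset.mem_sigma.1 h'
      obtain ⟨h1, -, -⟩ := (Finset.mem_filter.1 hw).2
      obtain ⟨h1', -, -⟩ := (Finset.mem_filter.1 hw').2
      dsimp only at h1 h1'
      rw [Sigma.mk.injEq, Prod.mk.injEq] at heq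
      obtain ⟨⟨-, rfl⟩, heq⟩ := heq
      have heq := eq_of_heq heq
      have e0 := congrFun heq (0, false)
      simp only [Fin.cases_zero, Bool.false_eq_true, if_false] at e0
      obtain rfl := lift_injective e0
      have : f = f' := by
        funext x
        by_cases hx : x ∈ A
        · exact ((mem_half (G.reconnect f) w x).1 (h1 hx)).trans
            ((mem_half (G.reconnect f') w x).1 (h1' hx)).symm
        · have e1 := congrFun heq (x.1.succ, x.2)
          simp only [Fin.cases_succ, Prod.mk.eta, hx, if_false] at e1
          exact lift_injective e1
      subst this
      rfl
    · rintro ⟨⟨v, A⟩, g⟩ h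
      obtain ⟨hv, hg⟩ := Finset.mem_sigma.1 h
      obtain ⟨h1, h2, h3⟩ := (Finset.mem_filter.1 hv).2
      dsimp only at hg h1 h2 h3
      rw [mem_reconnections] at hg
      have g0 := hg (0, false)
      simp only [Fin.cases_zero, Bool.false_eq_true, if_false] at g0
      obtain ⟨w, hw, hwv⟩ := exists_lift_of_extMap α _ _ g0
      have g1 := hg (0, true)
      simp only [Fin.cases_zero, if_true] at g1
      have hw1 := extMap_eq_zero α _ g1
      have gs : ∀ x : Fin G.E × Bool, ∃ y, (if x ∈ A then y = w else g (x.1.succ, x.2) = lift y) ∧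
          extMap α y = some (G.ends x) := by
        intro x
        by_cases hx : x ∈ A
        · refine ⟨w, by rw [if_pos hx], ?_⟩
          rw [hwv, (mem_half G v x).1 (h1 hx)]
        · have := hg (x.1.succ, x.2)
          simp only [Fin.cases_succ, Prod.mk.eta, hx, if_false] at this
          obtain ⟨y, hy, hy'⟩ := exists_lift_of_extMap α _ _ this
          exact ⟨y, by rw [if_neg hx]; exact hy, hy'⟩
      choose f hf hf' using gs
      have hfr : f ∈ G.reconnections α := (mem_reconnections _ _ _).2 hf'
      have hmem : (⟨f, w, A⟩ : (_ : Fin G.E × Bool → Fin m ⊕ Fin G.I) ×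
          ((Fin m ⊕ Fin G.I) × Finset (Fin G.E × Bool))) ∈ S := by
        refine Finset.mem_sigma.2 ⟨hfr, Finset.mem_filter.2 ⟨Finset.mem_univ _, ?_, h2, ?_⟩⟩
        · intro x hx
          have := hf x
          rw [if_pos hx] at this
          exact (mem_half _ _ _).2 this
        · intro hwr
          obtain ⟨u, rfl, rfl⟩ := (extMap_isRight α w v hwv).2 hwr
          rw [half_reconnect_inr G α f hfr]
          exact h3 rfl
      refine ⟨⟨f, w, A⟩, hmem, ?_⟩
      have hVv : V ⟨f, w, A⟩ hmem = v :=
        Option.some_injective _ ((hV _ hmem).symm.trans hwv)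
      dsimp only
      rw [hVv]
      congr 1
      funext ⟨e, b⟩
      refine Fin.cases ?_ (fun e => ?_) e
      · simp only [Fin.cases_zero]
        cases b
        · exact hw.symm
        · exact hw1.symm
      · simp only [Fin.cases_succ]
        have h4 := hf (e, b)
        have h5 := hg (e.succ, b)
        simp only [Fin.cases_succ] at h5
        by_cases hx : (e, b) ∈ A
        · rw [if_pos hx] at h5 ⊢
          exact (extMap_eq_zero α _ h5).symm
        · rw [if_neg hx] at h4 ⊢
          exact h4.symm
    · rintro ⟨f, w, A⟩ h
      rw [weight_extMap K α _ _ (hV _ h)]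
  exact LinearMap.congr_fun this x

end pull
/-! ### Stability of the conditions on graphs -/

namespace OGraph

variable {n : ℕ} (G : OGraph n)

theorem valence_expand_lift (v u : Fin n ⊕ Fin G.I) (A : Finset (Fin G.E × Bool)) :
    (G.expand v A).valence (lift u) = (decide (u = v)).toNat + (G.half u \ A).card := by
  rw [valence, expand_half_lift, card_halfCons]
  simp

theorem sdiff_half_of_ne (v u : Fin n ⊕ Fin G.I) (A : Finset (Fin G.E × Bool))
    (hA : A ⊆ G.half v) (h : u ≠ v) : G.half u \ A = G.half u := by
  refine Finset.sdiff_eq_self_of_disjoint (Finset.disjoint_left.2 fun x hx hxA => h ?_)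
  rw [← (mem_half G u x).1 hx, (mem_half G v x).1 (hA hxA)]

theorem reflTransGen_expand (v : Fin n ⊕ Fin G.I) (A : Finset (Fin G.E × Bool))
    (hA : A ⊆ G.half v) {x y : Fin n ⊕ Fin G.I} (h : Relation.ReflTransGen G.Adj x y) :
    Relation.ReflTransGen (G.expand v A).Adj (lift x) (lift y) := by
  have hnew : (G.expand v A).Adj (lift v) (Sum.inr 0) := ⟨0, false, rfl, rfl⟩
  have hnew' : (G.expand v A).Adj (Sum.inr 0) (lift v) := ⟨0, true, rfl, rfl⟩
  have hend : ∀ a : Fin G.E × Bool,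
      Relation.ReflTransGen (G.expand v A).Adj (lift (G.ends a))
        ((G.expand v A).ends (a.1.succ, a.2)) ∧
      Relation.ReflTransGen (G.expand v A).Adj ((G.expand v A).ends (a.1.succ, a.2))
        (lift (G.ends a)) := by
    intro a
    simp only [Fin.cases_succ, Prod.mk.eta]
    split_ifs with ha
    · rw [(mem_half G v a).1 (hA ha)]
      exact ⟨.single hnew, .single hnew'⟩
    · exact ⟨.refl, .refl⟩
  induction h with
  | refl => exact .refl
  | tail _ h ih =>
    obtain ⟨e, b, rfl, rfl⟩ := h
    refine ih.trans ((hend (e, b)).1.trans (.trans (.single ?_) (hend (e, !b)).2))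
    exact ⟨e.succ, b, rfl, rfl⟩

theorem Admissible.expand {G : OGraph n} (hG : G.Admissible) (v : Fin n ⊕ Fin G.I)
    (A : Finset (Fin G.E × Bool)) (h : G.IsExpansion v A) : (G.expand v A).Admissible := by
  obtain ⟨hA, h2, h3⟩ := h
  constructor
  · refine Fin.cases ?_ (fun u => ?_)
    · rw [valence, expand_half_zero, card_halfCons]
      simp
      omega
    · have := G.valence_expand_lift v (Sum.inr u) A
      refine le_of_le_of_eq ?_ this.symm
      by_cases huv : Sum.inr u = v
      · subst huv
        have := h3 rfl
        simp
        omega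
      · rw [G.sdiff_half_of_ne v _ A hA huv]
        exact (hG.1 u).trans (Nat.le_add_left _ _)
  · have key : ∀ u : Fin n ⊕ Fin G.I, ∃ i : Fin n,
        Relation.ReflTransGen (G.expand v A).Adj (lift u) (Sum.inl i) := by
      rintro (i | u)
      · exact ⟨i, .refl⟩
      · obtain ⟨i, hi⟩ := hG.2 u
        exact ⟨i, G.reflTransGen_expand v A hA hi⟩
    refine Fin.cases ?_ (fun u => key (Sum.inr u))
    obtain ⟨i, hi⟩ := key v
    exact ⟨i, .head ⟨0, true, rfl, rfl⟩ hi⟩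

theorem ExtUnivalent.expand {G : OGraph n} (hG : G.ExtUnivalent) (v : Fin n ⊕ Fin G.I)
    (A : Finset (Fin G.E × Bool)) (h : G.IsExpansion v A) : (G.expand v A).ExtUnivalent := by
  obtain ⟨hA, h2, h3⟩ := h
  intro i
  have hiv : Sum.inl i ≠ v := by
    rintro rfl
    have h4 := hG i
    have h5 := Finset.card_le_card hA
    rw [valence] at h4
    omega
  have := G.valence_expand_lift v (Sum.inl i) A
  rw [G.sdiff_half_of_ne v _ A hA hiv, decide_eq_false hiv, Bool.toNat_false, zero_add] at this
  exact this.trans (hG i)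

theorem IsConnected.expand {G : OGraph n} (hG : G.IsConnected) (v : Fin n ⊕ Fin G.I)
    (A : Finset (Fin G.E × Bool)) (h : G.IsExpansion v A) : (G.expand v A).IsConnected := by
  refine ⟨hG.1, ?_⟩
  have key : ∀ x y, Relation.ReflTransGen (G.expand v A).Adj (lift x) (lift y) := fun x y =>
    G.reflTransGen_expand v A h.1 (hG.2 x y)
  have hx : ∀ x, Relation.ReflTransGen (G.expand v A).Adj x (lift v) := by
    rintro (x | x)
    · exact key (Sum.inl x) v
    · refine Fin.cases ?_ (fun x => key (Sum.inr x) v) x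
      exact .single ⟨0, true, rfl, rfl⟩
  have hy : ∀ y, Relation.ReflTransGen (G.expand v A).Adj (lift v) y := by
    rintro (y | y)
    · exact key v (Sum.inl y)
    · refine Fin.cases ?_ (fun y => key v (Sum.inr y)) y
      exact .single ⟨0, false, rfl, rfl⟩
  exact fun x y => (hx x).trans (hy y)

theorem ConnectedOffExt.expand {G : OGraph n} (hG : G.ConnectedOffExt) (v : Fin n ⊕ Fin G.I)
    (A : Finset (Fin G.E × Bool)) (h : G.IsExpansion v A) : (G.expand v A).ConnectedOffExt := by
  obtain ⟨hA, h2, h3⟩ := h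
  let L : Fin G.I ⊕ Fin G.E → Fin (G.I + 1) ⊕ Fin (G.E + 1) := Sum.map Fin.succ Fin.succ
  have hnew : Relation.EqvGen (G.expand v A).Incident (Sum.inl 0) (Sum.inr 0) :=
    .rel _ _ ⟨0, 0, true, rfl, rfl, rfl⟩
  have hmem : ∀ a ∈ A, Relation.EqvGen (G.expand v A).Incident (Sum.inl 0) (Sum.inr a.1.succ) := by
    intro a ha
    refine .rel _ _ ⟨0, a.1.succ, a.2, ?_, rfl, rfl⟩
    simp only [Fin.cases_succ, Prod.mk.eta, if_pos ha]
  have hL : ∀ x y, Relation.EqvGen G.Incident x y →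
      Relation.EqvGen (G.expand v A).Incident (L x) (L y) := by
    intro x y hxy
    induction hxy with
    | rel x y h =>
      obtain ⟨w, e, b, hw, rfl, rfl⟩ := h
      by_cases ha : (e, b) ∈ A
      · have hv : v = Sum.inr w := ((mem_half G v (e, b)).1 (hA ha)).symm.trans hw
        refine .trans _ _ _ (.trans _ _ _ ?_ (.symm _ _ hnew)) (hmem _ ha)
        refine .rel _ _ ⟨w.succ, 0, false, ?_, rfl, rfl⟩
        rw [hv]
        rfl
      · refine .rel _ _ ⟨w.succ, e.succ, b, ?_, rfl, rfl⟩
        simp only [Fin.cases_succ, if_neg ha, hw]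
        rfl
    | refl x => exact .refl _
    | symm x y _ ih => exact .symm _ _ ih
    | trans x y z _ _ ih1 ih2 => exact .trans _ _ _ ih1 ih2
  obtain ⟨a, ha⟩ := Finset.card_pos.1 (lt_of_lt_of_le two_pos h2)
  have key : ∀ x, Relation.EqvGen (G.expand v A).Incident x (L (Sum.inr a.1)) := by
    rintro (x | x)
    · exact Fin.cases (hmem a ha) (fun x => hL (Sum.inl x) _ (hG.2 _ _)) x
    · exact Fin.cases (.trans _ _ _ (.symm _ _ hnew) (hmem a ha))
        (fun x => hL (Sum.inr x) _ (hG.2 _ _)) x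
  exact ⟨⟨Sum.inl 0⟩, fun x y => .trans _ _ _ (key x) (.symm _ _ (key y))⟩

theorem Admissible.reconnect {m : ℕ} {G : OGraph n} (hG : G.Admissible)
    (α : Fin m → Option (Fin n)) (f : Fin G.E × Bool → Fin m ⊕ Fin G.I)
    (hf : f ∈ G.reconnections α) : (G.reconnect f).Admissible := by
  constructor
  · intro v
    rw [valence, half_reconnect_inr G α f hf]
    exact hG.1 v
  · have hf' := (mem_reconnections _ _ _).1 hf
    have hint : ∀ (h : Fin G.E × Bool) (v : Fin G.I), G.ends h = Sum.inr v → f h = Sum.inr v := by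
      intro h v hv
      have := half_reconnect_inr G α f hf v
      exact (mem_half (G.reconnect f) _ _).1 (this ▸ (mem_half G _ _).2 hv)
    intro v
    obtain ⟨i, hi⟩ := hG.2 v
    have key : ∀ x, Relation.ReflTransGen G.Adj x (Sum.inl i) → ∀ v, x = Sum.inr v →
        ∃ j : Fin m, Relation.ReflTransGen (G.reconnect f).Adj (Sum.inr v) (Sum.inl j) := by
      intro x hx
      induction hx using Relation.ReflTransGen.head_induction_on with
      | refl => simp
      | head h _ ih =>
        rintro v rfl
        obtain ⟨e, b, h1, h2⟩ := h
        rcases hy : f (e, !b) with j | w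
        · exact ⟨j, .single ⟨e, b, hint _ _ h1, hy⟩⟩
        · have h3 := hf' (e, !b)
          rw [hy] at h3
          obtain ⟨j, hj⟩ := ih w (h2.symm.trans (Option.some_injective _ h3).symm)
          exact ⟨j, .head ⟨e, b, hint _ _ h1, hy⟩ hj⟩
    exact key _ hi v rfl

theorem ConnectedOffExt.reconnect {m : ℕ} {G : OGraph n} (hG : G.ConnectedOffExt)
    (α : Fin m → Option (Fin n)) (f : Fin G.E × Bool → Fin m ⊕ Fin G.I)
    (hf : f ∈ G.reconnections α) : (G.reconnect f).ConnectedOffExt := by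
  refine ⟨hG.1, fun x y => Relation.EqvGen.mono (r := G.Incident) ?_ _ _ (hG.2 x y)⟩
  rintro x y ⟨v, e, b, hv, hx, hy⟩
  refine ⟨v, e, b, ?_, hx, hy⟩
  have := half_reconnect_inr G α f hf v
  exact (mem_half (G.reconnect f) _ _).1 (this ▸ (mem_half G _ _).2 hv)

end OGraph

/-! ### The graph complexes -/

section spans

variable (K : Type u) [Field K] (d : ℕ)

/-- The subspace spanned by the graphs with the property `Q`. -/
def graphSpan {n : ℕ} (R : Set (Equiv.Perm (Fin n))) (Q : OGraph n → Prop) :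
    Submodule K (GraphSpace K d n R) :=
  Submodule.span K {x | ∃ G, Q G ∧ x = cls K d R G}

theorem diff_mem_graphSpan {n : ℕ} (R : Set (Equiv.Perm (Fin n))) (Q : OGraph n → Prop)
    (hQ : ∀ G, Q G → ∀ v A, G.IsExpansion v A → Q (G.expand v A)) :
    ∀ x ∈ graphSpan K d R Q, diff K d R x ∈ graphSpan K d R Q := by
  intro x hx
  induction hx using Submodule.span_induction with
  | mem y hy =>
    obtain ⟨G, hG, rfl⟩ := hy
    rw [diff, liftCls_cls]
    refine Submodule.sum_mem _ fun v _ => Submodule.sum_mem _ fun A _ => ?_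
    split_ifs with h
    · exact Submodule.smul_mem _ _ (Submodule.subset_span ⟨_, hQ G hG v A h, rfl⟩)
    · exact zero_mem _
  | zero => simp
  | add y z _ _ hy hz => rw [map_add]; exact add_mem hy hz
  | smul a y _ hy => rw [map_smul]; exact Submodule.smul_mem _ _ hy

theorem pull_mem_graphSpan {m n : ℕ} (α : Fin m → Option (Fin n)) (Q : OGraph n → Prop)
    (Q' : OGraph m → Prop) (hQ : ∀ G, Q G → ∀ f ∈ G.reconnections α, Q' (G.reconnect f)) :
    ∀ x ∈ graphSpan K d {1} Q, pull K d α x ∈ graphSpan K d {1} Q' := by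
  intro x hx
  induction hx using Submodule.span_induction with
  | mem y hy =>
    obtain ⟨G, hG, rfl⟩ := hy
    rw [pull, liftCls_cls]
    exact Submodule.sum_mem _ fun f hf => Submodule.subset_span ⟨_, hQ G hG f hf, rfl⟩
  | zero => simp
  | add y z _ _ hy hz => rw [map_add]; exact add_mem hy hz
  | smul a y _ hy => rw [map_smul]; exact Submodule.smul_mem _ _ hy

/-- The map that forgets the labels of the external vertices. -/
def forgetLabels (n : ℕ) : GraphSpace K d n {1} →ₗ[K] GraphSpace K d n Set.univ :=
  liftCls K d (cls K d Set.univ) fun G ρ σ τ φ _ => cls_act K d G ρ (Set.mem_univ ρ) σ τ φ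

end spans

section complexes

variable (K : Type u) [Field K] [CharZero K] (d : ℕ)

/-- The dg vector space of all the oriented graphs with `n` external vertices, modulo the
orientation relations. -/
def allGraphs (n : ℕ) (R : Set (Equiv.Perm (Fin n))) (hR : 1 ∈ R) : DGVect K where
  carrier := GraphSpace K d n R
  deg := graphDeg K d R
  isInternal := graphDeg_isInternal K d R
  d := diff K d R
  d_mem := diff_mem K d R
  d_d := diff_diff hR

theorem homogeneous_graphSpan {n : ℕ} (R : Set (Equiv.Perm (Fin n))) (hR : 1 ∈ R)
    (Q : OGraph n → Prop) : (allGraphs K d n R hR).Homogeneous (graphSpan K d R Q) := by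
  have h : ∀ x ∈ {x : allGraphs K d n R hR | ∃ G, Q G ∧ x = cls K d R G},
      ∃ k, x ∈ (allGraphs K d n R hR).deg k := by
    rintro x ⟨G, -, hx⟩
    have hG : x ∈ graphDeg K d R (G.degree d) := Submodule.subset_span ⟨G, rfl, hx⟩
    exact ⟨G.degree d, hG⟩
  exact DGVect.homogeneous_span _ _ h

/-- The commutative `Σ`-cosimplicial dg vector space of all the oriented graphs. -/
def allGraphsCosimplicial : CommCosimplicial K where
  obj n := allGraphs K d n {1} rfl
  map α := pull K d α
  map_deg α := pull_deg K d α
  map_d α x := pull_diff K d α x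
  map_id x := pull_id K d x
  map_comp β α x := pull_comp K d β α x

/-- `D_d`: the space `D_d(n)` is spanned by the admissible graphs with `n` external vertices (the
orientation relations only relate isomorphic graphs, so that no other relations arise). -/
def graphsD : CommCosimplicial K :=
  (allGraphsCosimplicial K d).sub (fun _ => graphSpan K d {1} OGraph.Admissible)
    (fun _ => homogeneous_graphSpan K d {1} rfl _)
    (fun _ => diff_mem_graphSpan K d {1} _ fun _ hG v A h => hG.expand v A h)
    (fun α => pull_mem_graphSpan K d α _ _ fun _ hG f hf => hG.reconnect α f hf)

/-- `P_d`: the space `P_d(n)`, the primitive part of `D_d(n)`, is spanned by the admissible graphs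
that become connected after the removal of small neighbourhoods of the external vertices. -/
def graphsP : CommCosimplicial K :=
  (allGraphsCosimplicial K d).sub
    (fun _ => graphSpan K d {1} fun G => G.Admissible ∧ G.ConnectedOffExt)
    (fun _ => homogeneous_graphSpan K d {1} rfl _)
    (fun _ => diff_mem_graphSpan K d {1} _ fun _ hG v A h =>
      ⟨hG.1.expand v A h, hG.2.expand v A h⟩)
    (fun α => pull_mem_graphSpan K d α _ _ fun _ hG f hf =>
      ⟨hG.1.reconnect α f hf, hG.2.reconnect α f hf⟩)

/-- All the oriented graphs with unlabelled external vertices of degree `-1`, for all the numbers of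
external vertices. In the expansions, the new vertex and the new edge are put in front of the
external vertices, which results in the sign `(-1)ⁿ` in the differential. -/
def allUnlabelledGraphs : DGVect K :=
  DGVect.total (fun n => allGraphs K d n Set.univ (Set.mem_univ 1)) (fun _ => 0) (fun _ _ _ _ => zero_mem _)
    (fun _ _ => by simp) (fun _ _ => rfl)

/-- The graph complex spanned by the possibly empty or disconnected uni-`≥ 3`-valent graphs, each
component of which has a univalent (external) vertex. External vertices being univalent, only
internal vertices have expansions. -/
def uniGraphs : DGVect K :=
  (allUnlabelledGraphs K d).sub
    (DGVect.sumSub _ fun _ => graphSpan K d Set.univ fun G => G.Admissible ∧ G.ExtUnivalent)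
    (DGVect.homogeneous_sumSub _ _ _ _ _ _ fun _ => homogeneous_graphSpan K d Set.univ (Set.mem_univ 1) _)
    (DGVect.d_mem_sumSub _ _ _ _ _ _ (fun _ => diff_mem_graphSpan K d _ _
      fun _ hG v A h => ⟨hG.1.expand v A h, hG.2.expand v A h⟩) fun _ _ _ => zero_mem _)

/-- The graph complex spanned by the connected uni-`≥ 3`-valent graphs with a non-empty set of
univalent (external) vertices. -/
def connectedUniGraphs : DGVect K :=
  (allUnlabelledGraphs K d).sub
    (DGVect.sumSub _ fun _ => graphSpan K d Set.univ fun G =>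
      G.Admissible ∧ G.ExtUnivalent ∧ G.IsConnected)
    (DGVect.homogeneous_sumSub _ _ _ _ _ _ fun _ => homogeneous_graphSpan K d Set.univ (Set.mem_univ 1) _)
    (DGVect.d_mem_sumSub _ _ _ _ _ _ (fun _ => diff_mem_graphSpan K d _ _
      fun _ hG v A h => ⟨hG.1.expand v A h, hG.2.1.expand v A h, hG.2.2.expand v A h⟩)
      fun _ _ _ => zero_mem _)

/-- The inclusion in the space of all the graphs. -/
def uniGraphsIncl : uniGraphs K d →ₗ[K] allUnlabelledGraphs K d :=
  DGVect.subVal (allUnlabelledGraphs K d) _ _ _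

/-- The inclusion in the space of all the graphs. -/
def connectedUniGraphsIncl : connectedUniGraphs K d →ₗ[K] allUnlabelledGraphs K d :=
  DGVect.subVal (allUnlabelledGraphs K d) _ _ _

/-- The map that forgets the labels of the external vertices, on the alternating multiderivations
in `D_d`. -/
def forgetD : (graphsD K d).AM →ₗ[K] allUnlabelledGraphs K d :=
  (DFinsupp.mapRange.linearMap fun n => forgetLabels K d n ∘ₗ (graphSpan K d {1} _).subtype) ∘ₗ
    DGVect.subVal (graphsD K d).cochains _ _ _

/-- The map that forgets the labels of the external vertices, on the alternating multiderivations
in `P_d`. -/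
def forgetP : (graphsP K d).AM →ₗ[K] allUnlabelledGraphs K d :=
  (DFinsupp.mapRange.linearMap fun n => forgetLabels K d n ∘ₗ (graphSpan K d {1} _).subtype) ∘ₗ
    DGVect.subVal (graphsP K d).cochains _ _ _

end complexes

end GC

end

/-!
The half-edges of a graph at its external vertices can be reattached freely, and the structure maps of
the spaces of graphs do nothing else. For graphs with `I` internal vertices and with the set `X` of
half-edges, the relevant cosimplicial space therefore consists of the functions on the set of all the
attachments `X → Fin n ⊕ Fin I` (`attachments`). In characteristic `0`, the graphs with `I` internal
vertices and `E` edges are a natural retract of it: averaging over the renumberings and reversals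
(`toAttach`) is a section of the sum over the attachments (`fromAttach`).

For the functions on attachments everything is explicit. The normalized functions are those supported
on the attachments that meet every external vertex, and the alternating multiderivations are the
alternating functions supported on the univalent attachments, in which every external vertex has
exactly one half-edge. Up to sign, the cosimplicial differential is the alternating sum of the merges
of neighbouring external vertices. The normalized complex is that of the cellular chains of
permutohedra, which are contractible; `exists_mergeSum_eq` proves the resulting exactness by induction
on `X`, with an explicit homotopy (`sum_merge_insert`) that moves one half-edge through all the
places. Together with antisymmetrization this gives `attachments_exact`: modulo the alternating
multiderivations, every normalized cocycle is a coboundary.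

The internal differential of the graphs raises the number `I` of internal vertices by one and
preserves `E - I`, and admissible graphs satisfy `3 * I ≤ 2 * E`. Hence the filtration by `I` is
finite where `E - I` is bounded, and the internal differential vanishes on its graded pieces.
Climbing up this filtration removes the parts of a relative cocycle one after the other
(`CommCosimplicial.smooth_of_filtration`), which proves smoothness. The argument applies to every class
of admissible graphs that is closed under expansions and that does not depend on where the external
half-edges are attached (`GraphClass`).

For the isomorphisms, the alternating multiderivations are spanned by graphs with univalent external
vertices (`mem_graphSpan_of_altMulti`), antisymmetrization inverts the forgetful map on them
(`labelings`), and the cosimplicial part of the differential vanishes (`exists_AM_iso`). For univalent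
external vertices, connectedness is not affected by the removal of the external vertices
(`connectedOffExt_iff_isConnected`).
-/

noncomputable section

namespace GC

open OGraph

/-! ### Attachments of a set of half-edges -/

/-- A vector space, as a dg vector space concentrated in degree `0`. -/
abbrev DGVect.concentrated (K : Type u) [Field K] (M : Type u) [AddCommGroup M] [Module K M] :
    DGVect K where
  carrier := M
  deg k := if k = 0 then ⊤ else ⊥
  isInternal := by
    refine isInternal_of_proj _ (fun k => if k = 0 then LinearMap.id else 0) ?_ ?_ ?_
    · intro k x hx
      split_ifs at hx ⊢ with h
      · rfl
      · exact ((Submodule.mem_bot K).1 hx).symm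
    · intro k l hkl x hx
      split_ifs at hx ⊢ with h1 h2
      · exact absurd (h2.trans h1.symm) hkl
      · exact (Submodule.mem_bot K).1 hx
      · rfl
      · rfl
    · exact eq_top_iff.2 fun x _ => Submodule.mem_iSup_of_mem 0 (by simp)
  d := 0
  d_mem := fun k x _ => by rw [LinearMap.zero_apply]; exact zero_mem _
  d_d := fun _ => rfl

section attach

variable {K : Type u} [Field K] {X : Type} {I : ℕ}

theorem extMap_comp_cases {m n : ℕ} (α : Fin m → Option (Fin n)) (e' : X → Fin m ⊕ Fin I) :
    (∃ e : X → Fin n ⊕ Fin I, ∀ x, extMap α (e' x) = some (e x)) ∨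
      ∃ x, extMap α (e' x) = none := by
  by_cases h : ∃ x, extMap α (e' x) = none
  · exact Or.inr h
  · push Not at h
    choose e he using fun x => Option.ne_none_iff_exists'.1 (h x)
    exact Or.inl ⟨e, he⟩

open Classical in
/-- The map of functions on attachments induced by a pointed map `α`: the value at `e'` is the value
at the composition of `e'` with `α`, and `0` if a half-edge is sent to the base point. -/
def attachPull (K : Type u) [Field K] (X : Type) (I : ℕ) {m n : ℕ} (α : Fin m → Option (Fin n)) :
    ((X → Fin n ⊕ Fin I) → K) →ₗ[K] ((X → Fin m ⊕ Fin I) → K) where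
  toFun φ e' := if h : ∀ x, (extMap α (e' x)).isSome then
    φ fun x => (extMap α (e' x)).get (h x) else 0
  map_add' φ ψ := by
    funext e'
    by_cases h : ∀ x, (extMap α (e' x)).isSome <;> simp [h]
  map_smul' a φ := by
    funext e'
    by_cases h : ∀ x, (extMap α (e' x)).isSome <;> simp [h]

theorem attachPull_of {m n : ℕ} {α : Fin m → Option (Fin n)} {e' : X → Fin m ⊕ Fin I}
    {e : X → Fin n ⊕ Fin I} (h : ∀ x, extMap α (e' x) = some (e x))
    (φ : (X → Fin n ⊕ Fin I) → K) : attachPull K X I α φ e' = φ e := by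
  simp [attachPull, h]

theorem attachPull_none {m n : ℕ} {α : Fin m → Option (Fin n)} {e' : X → Fin m ⊕ Fin I}
    (h : ∃ x, extMap α (e' x) = none) (φ : (X → Fin n ⊕ Fin I) → K) :
    attachPull K X I α φ e' = 0 := by
  obtain ⟨x, hx⟩ := h
  simp only [attachPull, LinearMap.coe_mk, AddHom.coe_mk]
  rw [dif_neg]
  intro h
  have := h x
  simp [hx] at this

/-- The functions on the ways of attaching the half-edges in `X` to the external vertices in `Fin n`
and to a fixed set `Fin I` of internal vertices. -/
abbrev attachments (K : Type u) [Field K] (X : Type) (I : ℕ) : CommCosimplicial K where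
  obj n := DGVect.concentrated K ((X → Fin n ⊕ Fin I) → K)
  map α := attachPull K X I α
  map_deg α k x hx := by
    by_cases hk : k = 0
    · simp [hk]
    · simp only [hk, if_false] at hx ⊢
      rw [(Submodule.mem_bot K).1 hx, map_zero]
      exact zero_mem _
  map_d α x := by
    exact map_zero (attachPull K X I α)
  map_id φ := by
    refine funext fun e => attachPull_of (fun x => ?_) φ
    rcases e x with p | v <;> rfl
  map_comp β α φ := by
    refine funext fun e'' => ?_
    have hb : ∀ e'' : X → _, ∀ x, extMap (fun j => (β j).bind α) (e'' x) =
        (extMap (I := I) β (e'' x)).bind (extMap α) := fun e'' x => extMap_bind β α (e'' x)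
    rcases extMap_comp_cases β e'' with ⟨e', he'⟩ | ⟨x, hx⟩
    · have h1 : attachPull K X I β (attachPull K X I α φ) e'' = _ := attachPull_of he' _
      refine h1.trans ?_
      rcases extMap_comp_cases α e' with ⟨e, he⟩ | ⟨x, hx⟩
      · rw [attachPull_of he]
        exact (attachPull_of (fun x => by rw [hb, he' x, Option.bind_some, he x]) φ).symm
      · rw [attachPull_none ⟨x, hx⟩]
        exact (attachPull_none ⟨x, by rw [hb, he' x, Option.bind_some, hx]⟩ φ).symm
    · have h1 : attachPull K X I β (attachPull K X I α φ) e'' = _ := attachPull_none ⟨x, hx⟩ _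
      refine h1.trans (attachPull_none ⟨x, by rw [hb, hx, Option.bind_none]⟩ φ).symm

/-- Every external vertex has a half-edge. -/
def IsFull {n : ℕ} (e : X → Fin n ⊕ Fin I) : Prop := ∀ p, ∃ x, e x = Sum.inl p

/-- Every external vertex has exactly one half-edge. -/
def IsUnivalent {n : ℕ} (e : X → Fin n ⊕ Fin I) : Prop := ∀ p, ∃! x, e x = Sum.inl p

theorem IsUnivalent.isFull {n : ℕ} {e : X → Fin n ⊕ Fin I} (h : IsUnivalent e) : IsFull e :=
  fun p => (h p).exists

/-- Substitution of `x_i x_{i+1}` for `x_i`, on the level of vertices. -/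
abbrev mergeVert {n I : ℕ} (i : Fin n) : Fin (n + 1) ⊕ Fin I → Fin n ⊕ Fin I :=
  Sum.map i.predAbove id

/-- Renumbering of the external vertices that skips the number `j`. -/
abbrev skipVert {n I : ℕ} (j : Fin (n + 1)) : Fin n ⊕ Fin I → Fin (n + 1) ⊕ Fin I :=
  Sum.map j.succAbove id

theorem attachPull_some {m n : ℕ} (a : Fin m → Fin n) (φ : (X → Fin n ⊕ Fin I) → K)
    (e : X → Fin m ⊕ Fin I) :
    attachPull K X I (fun j => some (a j)) φ e = φ (fun x => Sum.map a id (e x)) := by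
  refine attachPull_of (fun x => ?_) φ
  rcases e x with p | v <;> rfl

theorem mem_normalized_attachments {n : ℕ} (φ : (X → Fin n ⊕ Fin I) → K) :
    φ ∈ (attachments K X I).normalized n ↔ ∀ e, ¬ IsFull e → φ e = 0 := by
  cases n with
  | zero =>
    exact ⟨fun _ e he => absurd (fun p => p.elim0) he, fun _ => trivial⟩
  | succ n =>
    rw [CommCosimplicial.normalized]
    constructor
    · intro h e he
      simp only [IsFull, not_forall, not_exists] at he
      obtain ⟨p, hp⟩ := he
      have key : ∀ x, ∃ y : Fin n ⊕ Fin I, skipVert p y = e x := by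
        intro x
        rcases hx : e x with q | v
        · obtain ⟨r, hr⟩ := Fin.exists_succAbove_eq (x := q) (y := p) (by rintro rfl; exact hp x hx)
          exact ⟨Sum.inl r, by simp [hr]⟩
        · exact ⟨Sum.inr v, rfl⟩
      choose e' he' using key
      have h1 : attachPull K X I (codegen n p) φ e' = 0 :=
        congrFun (LinearMap.mem_ker.1 ((Submodule.mem_iInf _).1 h p)) e'
      rw [show codegen n p = fun j => some (p.succAbove j) from rfl, attachPull_some] at h1
      rw [← h1]
      exact congrArg φ (funext fun x => (he' x).symm)
    · intro h
      refine (Submodule.mem_iInf _).2 fun i => LinearMap.mem_ker.2 (funext fun e => ?_)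
      refine (attachPull_some i.succAbove φ e).trans (h _ fun hf => ?_)
      obtain ⟨x, hx⟩ := hf i
      change Sum.map i.succAbove id (e x) = _ at hx
      rcases hy : e x with q | v
      · rw [hy] at hx
        exact Fin.succAbove_ne i q (Sum.inl_injective hx)
      · rw [hy] at hx
        cases hx

theorem cofaceSum_attachments {n : ℕ} (φ : (X → Fin n ⊕ Fin I) → K)
    (e : X → Fin (n + 1) ⊕ Fin I) (h0 : ∃ x, e x = Sum.inl 0)
    (h1 : ∃ x, e x = Sum.inl (Fin.last n)) :
    ((attachments K X I).cofaceSum n φ : (X → Fin (n + 1) ⊕ Fin I) → K) e =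
      - ∑ i : Fin n, (-1) ^ (i : ℕ) * φ (mergeVert i ∘ e) := by
  have h : ((attachments K X I).cofaceSum n φ : (X → Fin (n + 1) ⊕ Fin I) → K) =
      ∑ i : Fin (n + 2), (-1 : K) ^ (i : ℕ) • attachPull K X I (coface n i) φ :=
    (attachments K X I).cofaceSum_apply n φ
  rw [h, Fin.sum_univ_castSucc, Fin.sum_univ_succ]
  simp only [coface_castSucc_succ, Fin.val_castSucc, Fin.val_succ]
  rw [coface_last, Fin.castSucc_zero, coface_zero]
  simp only [Pi.add_apply, Finset.sum_apply, Pi.smul_apply, smul_eq_mul]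
  obtain ⟨x, hx⟩ := h0
  obtain ⟨y, hy⟩ := h1
  rw [attachPull_none ⟨x, by simp [hx, extMap, splitMap]⟩,
    attachPull_none ⟨y, by simp [hy, extMap, splitMap]⟩, mul_zero, mul_zero, zero_add, add_zero,
    ← Finset.sum_neg_distrib]
  refine Finset.sum_congr rfl fun i _ => ?_
  rw [show mergeMap i = fun j => some (i.predAbove j) from rfl, attachPull_some, pow_succ]
  simp only [mul_neg, mul_one, neg_mul]
  rfl

theorem IsFull.hits {n : ℕ} {e : X → Fin (n + 1) ⊕ Fin I} (h : IsFull e) :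
    (∃ x, e x = Sum.inl 0) ∧ ∃ x, e x = Sum.inl (Fin.last n) := ⟨h _, h _⟩

/-- The alternating sum over the renumberings of the external vertices. -/
def altSum {n : ℕ} (φ : (X → Fin n ⊕ Fin I) → K) (e : X → Fin n ⊕ Fin I) : K :=
  ∑ σ : Equiv.Perm (Fin n), ((Equiv.Perm.sign σ : ℤ) : K) * φ (Sum.map σ id ∘ e)

theorem IsFull.perm {n : ℕ} {e : X → Fin n ⊕ Fin I} (h : IsFull e) (σ : Equiv.Perm (Fin n)) :
    IsFull (Sum.map σ id ∘ e) := by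
  intro p
  obtain ⟨x, hx⟩ := h (σ.symm p)
  exact ⟨x, by simp [hx]⟩

theorem IsUnivalent.perm {n : ℕ} {e : X → Fin n ⊕ Fin I} (h : IsUnivalent e)
    (σ : Equiv.Perm (Fin n)) : IsUnivalent (Sum.map σ id ∘ e) := by
  intro p
  obtain ⟨x, hx, hx'⟩ := h (σ.symm p)
  refine ⟨x, by simp [hx], fun y hy => hx' y ?_⟩
  rcases he : e y with q | v <;> simp only [Function.comp, he, Sum.map_inl, Sum.map_inr] at hy
  · rw [he, ← Sum.inl_injective hy, Equiv.symm_apply_apply]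
  · cases hy

theorem predAbove_swap {n : ℕ} (i : Fin n) (j : Fin (n + 1)) :
    i.predAbove (Equiv.swap i.castSucc i.succ j) = i.predAbove j := by
  by_cases h1 : j = i.castSucc
  · subst h1; simp
  by_cases h2 : j = i.succ
  · subst h2; simp
  rw [Equiv.swap_apply_of_ne_of_ne h1 h2]

theorem altSum_perm {n : ℕ} (φ : (X → Fin n ⊕ Fin I) → K) (e : X → Fin n ⊕ Fin I)
    (ρ : Equiv.Perm (Fin n)) :
    altSum φ (Sum.map ρ id ∘ e) = ((Equiv.Perm.sign ρ : ℤ) : K) * altSum φ e := by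
  unfold altSum
  rw [Finset.mul_sum]
  refine Fintype.sum_equiv (Equiv.mulRight ρ) _ _ fun σ => ?_
  have hs : ((Equiv.Perm.sign ρ : ℤ) : K) * ((Equiv.Perm.sign ρ : ℤ) : K) = 1 := by
    rw [← Int.cast_mul, Int.units_coe_mul_self, Int.cast_one]
  have : (Sum.map σ id ∘ Sum.map ρ id ∘ e : X → Fin n ⊕ Fin I) = Sum.map (σ * ρ) id ∘ e := by
    funext x
    rcases hx : e x with p | v <;> simp [hx]
  rw [this, Equiv.coe_mulRight, Equiv.Perm.sign_mul, Units.val_mul, Int.cast_mul]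
  linear_combination (-((Equiv.Perm.sign σ : ℤ) : K) * φ (Sum.map (σ * ρ) id ∘ e)) * hs

/-- A coboundary has vanishing alternating sums: the exchange of `i` and `i + 1` changes the sign,
but not the value of the `i`-th coface. -/
theorem altSum_cofaceSum [CharZero K] {n : ℕ} (φ : (X → Fin n ⊕ Fin I) → K)
    (e : X → Fin (n + 1) ⊕ Fin I) (he : IsFull e) :
    altSum ((attachments K X I).cofaceSum n φ : (X → Fin (n + 1) ⊕ Fin I) → K) e = 0 := by
  unfold altSum
  have h : ∀ σ : Equiv.Perm (Fin (n + 1)),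
      ((attachments K X I).cofaceSum n φ : (X → Fin (n + 1) ⊕ Fin I) → K) (Sum.map σ id ∘ e) =
      - ∑ i : Fin n, (-1) ^ (i : ℕ) * φ (mergeVert i ∘ Sum.map σ id ∘ e) := fun σ =>
    cofaceSum_attachments φ _ ((he.perm σ).hits).1 ((he.perm σ).hits).2
  simp only [h, mul_neg, Finset.sum_neg_distrib, Finset.mul_sum]
  rw [Finset.sum_comm, neg_eq_zero]
  refine Finset.sum_eq_zero fun i _ => ?_
  refine eq_zero_of_eq_neg_self (K := K) ?_
  rw [← Finset.sum_neg_distrib]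
  refine Fintype.sum_equiv (Equiv.mulLeft (Equiv.swap i.castSucc i.succ)) _ _ fun σ => ?_
  have : (mergeVert i ∘ Sum.map (Equiv.mulLeft (Equiv.swap i.castSucc i.succ) σ) id ∘ e :
      X → Fin n ⊕ Fin I) = mergeVert i ∘ Sum.map σ id ∘ e := by
    funext x
    rcases hx : e x with p | v <;> simp [hx, predAbove_swap]
  rw [this, Equiv.coe_mulLeft, Equiv.Perm.sign_mul, Equiv.Perm.sign_swap (by simp [Fin.ext_iff])]
  push_cast
  ring

end attach

/-! ### Multiderivations and univalent attachments -/

section multi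

variable {K : Type u} [Field K] {X : Type} {I : ℕ}

theorem val_succAbove {n : ℕ} (j : Fin (n + 1)) (x : Fin n) :
    (j.succAbove x : ℕ) = if (x : ℕ) < j then (x : ℕ) else x + 1 := by
  simp only [Fin.succAbove, Fin.lt_def, Fin.val_castSucc]
  split_ifs <;> simp

theorem val_predAbove {n : ℕ} (i : Fin n) (x : Fin (n + 1)) :
    (i.predAbove x : ℕ) = if (i : ℕ) < x then (x : ℕ) - 1 else x := by
  simp only [Fin.predAbove, Fin.lt_def, Fin.val_castSucc]
  split_ifs <;> simp

theorem splitMap_castSucc {n : ℕ} (i : Fin n) (q : Fin (n + 1)) (h : q ≠ i.castSucc) :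
    splitMap i.castSucc q = some (i.predAbove q) := by
  obtain ⟨r, rfl⟩ := Fin.exists_succAbove_eq h
  simp [splitMap]

theorem splitMap_succ {n : ℕ} (i : Fin n) (q : Fin (n + 1)) (h : q ≠ i.succ) :
    splitMap i.succ q = some (i.predAbove q) := by
  obtain ⟨r, rfl⟩ := Fin.exists_succAbove_eq h
  simp only [splitMap, finSuccEquiv'_succAbove, Option.some.injEq, Fin.ext_iff, val_predAbove,
    val_succAbove, Fin.val_succ]
  split_ifs <;> omega

theorem extMap_splitMap_castSucc {n : ℕ} (i : Fin n) (v : Fin (n + 1) ⊕ Fin I)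
    (h : v ≠ Sum.inl i.castSucc) :
    extMap (splitMap i.castSucc) v = some (mergeVert i v) := by
  rcases v with q | v
  · simp [extMap, splitMap_castSucc i q (fun hq => h (hq ▸ rfl))]
  · rfl

theorem extMap_splitMap_succ {n : ℕ} (i : Fin n) (v : Fin (n + 1) ⊕ Fin I)
    (h : v ≠ Sum.inl i.succ) :
    extMap (splitMap i.succ) v = some (mergeVert i v) := by
  rcases v with q | v
  · simp [extMap, splitMap_succ i q (fun hq => h (hq ▸ rfl))]
  · rfl

theorem attachPull_mergeMap {n : ℕ} (i : Fin n) (φ : (X → Fin n ⊕ Fin I) → K)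
    (e : X → Fin (n + 1) ⊕ Fin I) :
    attachPull K X I (mergeMap i) φ e = φ (mergeVert i ∘ e) :=
  attachPull_some i.predAbove φ e

/-- A multiderivation `φ` vanishes where two half-edges `x`, `y` are attached to the same external
vertex `p`: its value there is the value of the left hand side of the multiderivation rule at an
attachment in which `x` and `y` are separated, at which both terms on the right hand side vanish. -/
theorem isUnivalent_of_isMultiderivation {n : ℕ} {φ : (X → Fin n ⊕ Fin I) → K}
    (hφ : (attachments K X I).IsMultiderivation (n := n) φ)
    (hn : φ ∈ (attachments K X I).normalized n) (e : X → Fin n ⊕ Fin I) (he : φ e ≠ 0) :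
    IsUnivalent e := by
  classical
  have hf : IsFull e := by
    by_contra h
    exact he ((mem_normalized_attachments φ).1 hn e h)
  intro p
  obtain ⟨x, hx⟩ := hf p
  refine ⟨x, hx, fun y hy => ?_⟩
  by_contra hxy
  change e y = _ at hy
  let e' : X → Fin (n + 1) ⊕ Fin I := fun z => if z = x then Sum.inl p.castSucc else
    Sum.map p.castSucc.succAbove id (e z)
  have hx' : e' x = Sum.inl p.castSucc := if_pos rfl
  have hy' : e' y = Sum.inl p.succ := by
    simp [e', hxy, hy]
  have hm : mergeVert p ∘ e' = e := by
    funext z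
    by_cases hz : z = x
    · subst hz
      simp [hx', hx]
    · rcases hq : e z with q | v <;> simp [e', hz, hq]
  have h1 : attachPull K X I (mergeMap p) φ e' = attachPull K X I (splitMap p.castSucc) φ e' +
      attachPull K X I (splitMap p.succ) φ e' := congrFun (hφ p) e'
  rw [attachPull_mergeMap, hm, attachPull_none ⟨x, by simp [hx', extMap, splitMap]⟩,
    attachPull_none ⟨y, by simp [hy', extMap, splitMap]⟩, add_zero] at h1
  exact he h1

/-- Functions supported on the univalent attachments are multiderivations: if half-edges are at both of
the vertices to be merged, all the terms of the rule vanish, and if one of the vertices has no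
half-edge, the left hand side is one of the terms on the right hand side and the other one vanishes. -/
theorem isMultiderivation_of_isUnivalent {n : ℕ} {φ : (X → Fin n ⊕ Fin I) → K}
    (hφ : ∀ e, φ e ≠ 0 → IsUnivalent e) :
    (attachments K X I).IsMultiderivation (n := n) φ := by
  intro i
  refine funext fun e => ?_
  change attachPull K X I (mergeMap i) φ e = attachPull K X I (splitMap i.castSucc) φ e +
      attachPull K X I (splitMap i.succ) φ e
  rw [attachPull_mergeMap]
  by_cases ha : ∃ x, e x = Sum.inl i.castSucc <;> by_cases hb : ∃ x, e x = Sum.inl i.succ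
  · obtain ⟨x, hx⟩ := ha
    obtain ⟨y, hy⟩ := hb
    rw [attachPull_none ⟨x, by simp [hx, extMap, splitMap]⟩,
      attachPull_none ⟨y, by simp [hy, extMap, splitMap]⟩, add_zero]
    by_contra h
    have hxy := (hφ _ h i).unique (y₁ := x) (y₂ := y) (by simp [hx]) (by simp [hy])
    rw [hxy, hy] at hx
    simp [Fin.ext_iff] at hx
  · obtain ⟨x, hx⟩ := ha
    rw [attachPull_none ⟨x, by simp [hx, extMap, splitMap]⟩, zero_add]
    exact (attachPull_of (fun z => extMap_splitMap_succ i _ fun h => hb ⟨z, h⟩) φ).symm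
  · obtain ⟨x, hx⟩ := hb
    rw [attachPull_none (α := splitMap i.succ) ⟨x, by simp [hx, extMap, splitMap]⟩, add_zero]
    exact (attachPull_of (fun z => extMap_splitMap_castSucc i _ fun h => ha ⟨z, h⟩) φ).symm
  · rw [attachPull_of (fun z => extMap_splitMap_succ i _ fun h => hb ⟨z, h⟩),
      attachPull_of (fun z => extMap_splitMap_castSucc i _ fun h => ha ⟨z, h⟩)]
    have : φ (fun z => mergeVert i (e z)) = 0 := by
      by_contra h
      obtain ⟨x, hx⟩ := (hφ _ h i).exists
      rcases he : e x with q | v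
      · rw [he] at hx
        have h1 := Sum.inl_injective hx
        have h2 : q ≠ i.castSucc := fun hq => ha ⟨x, by rw [he, hq]⟩
        have h3 : q ≠ i.succ := fun hq => hb ⟨x, by rw [he, hq]⟩
        rw [Ne, Fin.ext_iff] at h2 h3
        rw [Fin.ext_iff, val_predAbove] at h1
        simp only [Fin.val_castSucc, Fin.val_succ] at h2 h3
        split_ifs at h1 <;> omega
      · rw [he] at hx
        cases hx
    rw [this, add_zero]
    exact this

/-- The homotopy formula behind the contraction: the sum over `j ≤ k` of the merges of an attachment
in which a further half-edge has been attached to a new external vertex at the place `j`. Merging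
this vertex with its neighbours gives a telescoping sum, and all the other merges commute with the
insertion of the new vertex. -/
theorem sum_merge_insert {n : ℕ} (A : Fin (n + 1) → (X → Fin (n + 1) ⊕ Fin I) → K)
    (k : Fin (n + 1)) (u : X → Fin (n + 1) ⊕ Fin I) :
    ∑ j : Fin (n + 2), (if (j : ℕ) ≤ k then (-1) ^ (j : ℕ) * ∑ i : Fin (n + 1), (-1) ^ (i : ℕ) *
      A (i.predAbove j) (mergeVert i ∘ skipVert j ∘ u) else 0) =
    A k u - ∑ i : Fin n, (-1) ^ (i : ℕ) * ∑ j : Fin (n + 1),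
      if (j : ℕ) ≤ i.predAbove k then (-1) ^ (j : ℕ) * A j (skipVert j ∘ mergeVert i ∘ u) else 0 := by
  let f : Fin (n + 1) → Fin (n + 2) → K := fun i j => if (j : ℕ) ≤ k then
    (-1) ^ (j : ℕ) * ((-1) ^ (i : ℕ) * A (i.predAbove j) (mergeVert i ∘ skipVert j ∘ u)) else 0
  have h1 : ∀ i, f i i.castSucc = if (i : ℕ) ≤ k then A i u else 0 := by
    intro i
    have : (mergeVert i ∘ skipVert i.castSucc ∘ u : X → Fin (n + 1) ⊕ Fin I) = u := by
      funext x
      rcases hx : u x with p | v <;> simp [hx]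
    simp only [f, this, Fin.predAbove_castSucc_self, Fin.val_castSucc, ← mul_assoc, ← mul_pow]
    simp
  have h2 : ∀ i, f i i.succ = if (i : ℕ) + 1 ≤ k then - A i u else 0 := by
    intro i
    have : (mergeVert i ∘ skipVert i.succ ∘ u : X → Fin (n + 1) ⊕ Fin I) = u := by
      funext x
      rcases hx : u x with p | v
      · simp only [Function.comp, hx, Sum.map_inl, Sum.inl.injEq, Fin.ext_iff, val_predAbove,
          val_succAbove, Fin.val_succ]
        split_ifs <;> omega
      · simp [hx]
    simp only [f, this, Fin.predAbove_succ_self, Fin.val_succ, pow_succ, ← mul_assoc]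
    split_ifs
    · have h : (-1 : K) ^ (i : ℕ) * (-1) ^ (i : ℕ) = 1 := by rw [← mul_pow]; simp
      linear_combination (-A i u) * h
    · rfl
  have h3 : ∑ i : Fin (n + 1), ((if (i : ℕ) ≤ k then A i u else 0) +
      if (i : ℕ) + 1 ≤ k then - A i u else 0) = A k u := by
    rw [Finset.sum_eq_single k]
    · simp
    · intro i _ hi
      rw [Ne, Fin.ext_iff] at hi
      split_ifs <;> first | omega | simp
    · simp
  have h4 : ∑ i : Fin (n + 1), ∑ l : Fin n, f i (i.castSucc.succAbove (i.succAbove l)) =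
      - ∑ i : Fin n, (-1) ^ (i : ℕ) * ∑ j : Fin (n + 1),
        if (j : ℕ) ≤ i.predAbove k then
          (-1) ^ (j : ℕ) * A j (skipVert j ∘ mergeVert i ∘ u) else 0 := by
    simp only [Finset.mul_sum]
    rw [← Finset.sum_neg_distrib]
    simp only [← Finset.sum_neg_distrib]
    rw [← Fintype.sum_prod_type', ← Fintype.sum_prod_type']
    refine Finset.sum_nbij'
      (fun il => if h : (il.2 : ℕ) < il.1
        then (⟨il.1 - 1, by have := il.1.2; omega⟩, il.2.castSucc)
        else (⟨il.1, by have := il.2.2; omega⟩, il.2.succ))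
      (fun ij => if h : (ij.1 : ℕ) < ij.2
        then (ij.1.castSucc, ⟨ij.2 - 1, by have := ij.2.2; omega⟩)
        else (ij.1.succ, ⟨ij.2, by have := ij.1.2; omega⟩)) ?_ ?_ ?_ ?_ ?_
    · simp
    · simp
    · rintro ⟨i, l⟩ -
      by_cases h : (l : ℕ) < i
      · have h' : ¬ (i : ℕ) - 1 < l := by omega
        simp [h, h', Fin.ext_iff]
        omega
      · have h' : (i : ℕ) < l + 1 := by omega
        simp [h, h']
    · rintro ⟨i, j⟩ -
      by_cases h : (i : ℕ) < j
      · have h' : ¬ (j : ℕ) - 1 < i := by omega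
        simp [h, h', Fin.ext_iff]
        omega
      · have h' : (j : ℕ) < i + 1 := by omega
        simp [h, h']
    · rintro ⟨i, l⟩ -
      have hf : ∀ (i' : Fin n) (j : Fin (n + 1)),
          (i : ℕ) = (if (l : ℕ) < i then i' + 1 else i' : ℕ) →
          (l : ℕ) = (if (l : ℕ) < i then j else j - 1 : ℕ) →
          ((l : ℕ) < i ∨ 0 < (j : ℕ)) →
          f i (i.castSucc.succAbove (i.succAbove l)) = - ((-1) ^ (i' : ℕ) *
            if (j : ℕ) ≤ i'.predAbove k then
              (-1) ^ (j : ℕ) * A j (skipVert j ∘ mergeVert i' ∘ u) else 0) := by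
        intro i' j hi hj hlt
        set J := i.castSucc.succAbove (i.succAbove l) with hJ
        have hJv : (J : ℕ) = if (l : ℕ) < i then (l : ℕ) else l + 2 := by
          simp only [hJ, val_succAbove, Fin.val_castSucc]
          split_ifs <;> omega
        have hp : i.predAbove J = j := by
          rw [Fin.ext_iff, val_predAbove, hJv]
          split_ifs at * <;> omega
        have hu : (mergeVert i ∘ skipVert J ∘ u : X → Fin (n + 1) ⊕ Fin I) =
            skipVert j ∘ mergeVert i' ∘ u := by
          funext x
          rcases hx : u x with p | v
          · simp only [Function.comp, hx, Sum.map_inl, Sum.inl.injEq, Fin.ext_iff, val_predAbove,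
              val_succAbove, hJv]
            split_ifs at * <;> omega
          · simp [hx]
        have hc : (J : ℕ) ≤ k ↔ (j : ℕ) ≤ i'.predAbove k := by
          rw [val_predAbove, hJv]
          split_ifs at * <;> omega
        have hs : (-1 : K) ^ (J : ℕ) * (-1) ^ (i : ℕ) = - ((-1) ^ (i' : ℕ) * (-1) ^ (j : ℕ)) := by
          rw [hJv]
          split_ifs at * with h
          · rw [hi, hj, pow_succ]
            ring
          · rw [hi, hj, show (j : ℕ) - 1 + 2 = j + 1 by omega, pow_succ]
            ring
        simp only [f, hp, hu, hc]
        split_ifs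
        · rw [← mul_assoc, hs]
          ring
        · simp
      by_cases h : (l : ℕ) < i
      · simp only [h, dif_pos]
        exact hf ⟨i - 1, by omega⟩ l.castSucc (by simp [h]; omega) (by simp [h]) (Or.inl h)
      · simp only [h, dif_neg, not_false_eq_true]
        exact hf ⟨i, by omega⟩ l.succ (by simp [h]) (by simp [h]) (Or.inr (by simp))
  calc _ = ∑ j, ∑ i, f i j := by
        refine Finset.sum_congr rfl fun j _ => ?_
        simp only [f]
        split_ifs
        · rw [Finset.mul_sum]
        · simp
    _ = ∑ i, ∑ j, f i j := Finset.sum_comm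
    _ = ∑ i, ((f i i.castSucc + f i i.succ) +
          ∑ l : Fin n, f i (i.castSucc.succAbove (i.succAbove l))) := by
        refine Finset.sum_congr rfl fun i _ => ?_
        rw [Fin.sum_univ_succAbove _ i.castSucc, Fin.sum_univ_succAbove _ i,
          Fin.succAbove_castSucc_self, add_assoc]
    _ = _ := by
        rw [Finset.sum_add_distrib, h4]
        simp only [h1, h2, h3]
        ring

end multi

/-! ### Exactness of the complex of attachments -/

section exactness

variable {K : Type u} [Field K] {X : Type} {I : ℕ}

/-- The alternating sum of the merges of two neighbouring external vertices: up to the sign, the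
cosimplicial differential of a normalized element. -/
def mergeSum {n : ℕ} (φ : (X → Fin n ⊕ Fin I) → K) (e : X → Fin (n + 1) ⊕ Fin I) : K :=
  ∑ i : Fin n, (-1) ^ (i : ℕ) * φ (mergeVert i ∘ e)

theorem mergeSum_eq_neg_cofaceSum {n : ℕ} (φ : (X → Fin n ⊕ Fin I) → K)
    (e : X → Fin (n + 1) ⊕ Fin I) (h0 : ∃ x, e x = Sum.inl 0)
    (h1 : ∃ x, e x = Sum.inl (Fin.last n)) :
    mergeSum φ e = - ((attachments K X I).cofaceSum n φ : (X → Fin (n + 1) ⊕ Fin I) → K) e := by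
  rw [cofaceSum_attachments φ e h0 h1, neg_neg, mergeSum]

theorem cofaceSum_eq_zero {n : ℕ} {φ : (X → Fin n ⊕ Fin I) → K} (hφ : ∀ e, ¬ IsFull e → φ e = 0)
    (h : ∀ e, IsFull e → mergeSum φ e = 0) :
    (attachments K X I).cofaceSum n φ = 0 := by
  have hn := (mem_normalized_attachments _).1 ((attachments K X I).cofaceSum_mem_normalized n φ
    ((mem_normalized_attachments φ).2 hφ))
  refine funext fun e => ?_
  by_cases he : IsFull e
  · have := mergeSum_eq_neg_cofaceSum φ e he.hits.1 he.hits.2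
    rw [h e he] at this
    exact neg_eq_zero.1 this.symm
  · exact hn e he

/-- Subtracting a coboundary from a normalized cocycle gives a normalized cocycle with the same
alternating sums. -/
theorem exists_sub_mergeSum [CharZero K] {n : ℕ} {φ : (X → Fin (n + 1) ⊕ Fin I) → K}
    {ψ : (X → Fin n ⊕ Fin I) → K} (hφ : ∀ e, ¬ IsFull e → φ e = 0)
    (h : ∀ e, IsFull e → mergeSum φ e = 0) (hψ : ∀ e, ¬ IsFull e → ψ e = 0) :
    ∃ θ : (X → Fin (n + 1) ⊕ Fin I) → K, (∀ e, ¬ IsFull e → θ e = 0) ∧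
      (∀ e, IsFull e → θ e = φ e - mergeSum ψ e) ∧ (∀ e, IsFull e → mergeSum θ e = 0) ∧
      ∀ e, IsFull e → altSum θ e = altSum φ e := by
  let U := attachments K X I
  let δψ : (X → Fin (n + 1) ⊕ Fin I) → K := U.cofaceSum n ψ
  have hδ : ∀ e, IsFull e → mergeSum ψ e = - δψ e := fun e he =>
    mergeSum_eq_neg_cofaceSum ψ e he.hits.1 he.hits.2
  refine ⟨φ + δψ, ?_, ?_, ?_, ?_⟩
  · intro e he
    have := (mem_normalized_attachments δψ).1
      (U.cofaceSum_mem_normalized n ψ ((mem_normalized_attachments ψ).2 hψ)) e he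
    rw [Pi.add_apply, hφ e he, this, add_zero]
  · intro e he
    rw [Pi.add_apply, hδ e he, sub_neg_eq_add]
  · intro e he
    rw [mergeSum_eq_neg_cofaceSum _ e he.hits.1 he.hits.2]
    have h1 : U.cofaceSum (n + 1) (φ + δψ) = 0 := by
      have h2 : U.cofaceSum (n + 1) δψ = 0 := U.cofaceSum_sq n ψ
      have h3 : U.cofaceSum (n + 1) φ = 0 := cofaceSum_eq_zero hφ h
      have h4 : U.cofaceSum (n + 1) (φ + δψ) = U.cofaceSum (n + 1) φ + U.cofaceSum (n + 1) δψ :=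
        map_add _ _ _
      rw [h4, h2, h3, add_zero]
    exact neg_eq_zero.2 (congrFun h1 e)
  · intro e he
    have h1 : altSum δψ e = 0 := altSum_cofaceSum ψ e he
    unfold altSum at h1 ⊢
    simp only [Pi.add_apply, mul_add, Finset.sum_add_distrib]
    rw [h1, add_zero]

/-- The attachment of one more half-edge. -/
abbrev consAttach {V : Type} (v : V) (u : X → V) : Option X → V := fun o => o.elim v u

theorem consAttach_eta {V : Type} (e : Option X → V) :
    consAttach (e none) (fun x => e (some x)) = e := by
  funext o
  cases o <;> rfl

theorem comp_consAttach {V W : Type} (f : V → W) (v : V) (u : X → V) :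
    f ∘ consAttach v u = consAttach (f v) (f ∘ u) := by
  funext o
  cases o <;> rfl

theorem isFull_consAttach_inr {n : ℕ} (j : Fin I) (u : X → Fin n ⊕ Fin I) :
    IsFull (consAttach (Sum.inr j) u) ↔ IsFull u := by
  simp [IsFull, Option.exists]

theorem isFull_consAttach_inl {n : ℕ} (k : Fin n) (u : X → Fin n ⊕ Fin I) :
    IsFull (consAttach (Sum.inl k) u) ↔ ∀ p, k = p ∨ ∃ x, u x = Sum.inl p := by
  simp [IsFull, Option.exists]

theorem isUnivalent_consAttach_inr {n : ℕ} (j : Fin I) (u : X → Fin n ⊕ Fin I)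
    (h : IsUnivalent u) : IsUnivalent (consAttach (Sum.inr j) u) := by
  intro p
  obtain ⟨x, hx, hx'⟩ := h p
  refine ⟨some x, hx, ?_⟩
  rintro (_ | y) hy
  · cases hy
  · exact congrArg some (hx' y hy)

theorem exists_skipVert {n : ℕ} (p : Fin (n + 1)) (e : X → Fin (n + 1) ⊕ Fin I)
    (h : ∀ x, e x ≠ Sum.inl p) : ∃ e' : X → Fin n ⊕ Fin I, skipVert p ∘ e' = e := by
  have key : ∀ x, ∃ y : Fin n ⊕ Fin I, skipVert p y = e x := by
    intro x
    rcases hx : e x with q | v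
    · obtain ⟨r, hr⟩ := Fin.exists_succAbove_eq (x := q) (y := p) (by rintro rfl; exact h x hx)
      exact ⟨Sum.inl r, by simp [hr]⟩
    · exact ⟨Sum.inr v, rfl⟩
  choose e' he' using key
  exact ⟨e', funext he'⟩

theorem isUnivalent_consAttach_last {n : ℕ} (w : X → Fin n ⊕ Fin I) (h : IsUnivalent w) :
    IsUnivalent (consAttach (Sum.inl (Fin.last n)) (skipVert (Fin.last n) ∘ w)) := by
  intro p
  refine Fin.lastCases ?_ (fun p => ?_) p
  · refine ⟨none, rfl, ?_⟩
    rintro (_ | y) hy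
    · rfl
    · rcases hw : w y with q | v
      · simp [hw] at hy
      · simp [hw] at hy
  · obtain ⟨x, hx, hx'⟩ := h p
    refine ⟨some x, by simp [hx], ?_⟩
    rintro (_ | y) hy
    · simp [Fin.ext_iff] at hy
      omega
    · refine congrArg some (hx' y ?_)
      rcases hw : w y with q | v
      · simp [hw] at hy
        simp [hw, hy]
      · simp [hw] at hy

/-- The extension of a permutation by a fixed point at the last place. -/
def snocPerm {n : ℕ} (σ : Equiv.Perm (Fin n)) : Equiv.Perm (Fin (n + 1)) :=
  finSuccEquivLast.symm.permCongr (Equiv.optionCongr σ)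

theorem snocPerm_last {n : ℕ} (σ : Equiv.Perm (Fin n)) : snocPerm σ (Fin.last n) = Fin.last n := by
  simp [snocPerm]

theorem snocPerm_castSucc {n : ℕ} (σ : Equiv.Perm (Fin n)) (p : Fin n) :
    snocPerm σ p.castSucc = (σ p).castSucc := by
  simp [snocPerm]

theorem sign_snocPerm {n : ℕ} (σ : Equiv.Perm (Fin n)) :
    Equiv.Perm.sign (snocPerm σ) = Equiv.Perm.sign σ := by
  simp [snocPerm]

theorem exists_snocPerm {n : ℕ} (τ : Equiv.Perm (Fin (n + 1))) (h : τ (Fin.last n) = Fin.last n) :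
    ∃ σ, snocPerm σ = τ := by
  refine ⟨Equiv.removeNone (finSuccEquivLast.permCongr τ), ?_⟩
  have h1 := map_equiv_removeNone (finSuccEquivLast.permCongr τ)
  have h2 : finSuccEquivLast.permCongr τ none = none := by simp [h]
  rw [h2, Equiv.swap_self] at h1
  rw [snocPerm, h1]
  ext x
  simp

theorem snocPerm_injective {n : ℕ} : Function.Injective (snocPerm (n := n)) := by
  intro σ τ h
  ext p
  have := congrArg (fun f : Equiv.Perm _ => f p.castSucc) h
  simpa [snocPerm_castSucc, Fin.ext_iff] using this

/-- Only the renumberings that fix the last external vertex contribute. -/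
theorem altSum_consAttach_last {n : ℕ} {θ : (Option X → Fin (n + 1) ⊕ Fin I) → K}
    (h : ∀ e, e none ≠ Sum.inl (Fin.last n) → θ e = 0) (w : X → Fin n ⊕ Fin I) :
    altSum (fun w => θ (consAttach (Sum.inl (Fin.last n)) (skipVert (Fin.last n) ∘ w))) w =
      altSum θ (consAttach (Sum.inl (Fin.last n)) (skipVert (Fin.last n) ∘ w)) := by
  unfold altSum
  refine Finset.sum_of_injOn snocPerm snocPerm_injective.injOn (fun _ _ => Finset.mem_univ _) ?_ ?_
  · intro τ _ hτ
    rw [h, mul_zero]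
    intro hl
    refine hτ ?_
    obtain ⟨σ, hσ⟩ := exists_snocPerm τ (by simpa using hl)
    exact ⟨σ, by simp, hσ⟩
  · intro σ _
    rw [sign_snocPerm, comp_consAttach]
    simp only [Sum.map_inl, snocPerm_last]
    congr 3
    funext x
    rcases hx : w x with p | v <;> simp [hx, snocPerm_castSucc]

/-- A function supported on the attachments with the additional half-edge alone at the last external
vertex is a coboundary if the function of the remaining half-edges is one. -/
theorem exists_mergeSum_of_last {n : ℕ} {θ : (Option X → Fin (n + 2) ⊕ Fin I) → K}
    (h1 : ∀ e, e none ≠ Sum.inl (Fin.last (n + 1)) → θ e = 0)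
    (h2 : ∀ e, (∃ x, e (some x) = Sum.inl (Fin.last (n + 1))) → θ e = 0)
    {χ : (X → Fin n ⊕ Fin I) → K} (hχ : ∀ w, ¬ IsFull w → χ w = 0)
    (h : ∀ w, IsFull w → θ (consAttach (Sum.inl (Fin.last (n + 1)))
      (skipVert (Fin.last (n + 1)) ∘ w)) = mergeSum χ w) :
    ∃ ψ : (Option X → Fin (n + 1) ⊕ Fin I) → K, (∀ e, ¬ IsFull e → ψ e = 0) ∧
      ∀ e, IsFull e → θ e = mergeSum ψ e := by
  classical
  have hsplit : ∀ v : X → Fin n ⊕ Fin I,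
      attachPull K X I (splitMap (Fin.last n)) χ (skipVert (Fin.last n) ∘ v) = χ v := by
    intro v
    refine attachPull_of (fun x => ?_) χ
    rcases hx : v x with p | j <;> simp [hx, extMap, splitMap, finSuccEquiv'_last_apply_castSucc]
  have hsplit0 : ∀ u : X → Fin (n + 1) ⊕ Fin I, (∃ x, u x = Sum.inl (Fin.last n)) →
      attachPull K X I (splitMap (Fin.last n)) χ u = 0 := by
    rintro u ⟨x, hx⟩
    exact attachPull_none ⟨x, by simp [hx, extMap, splitMap]⟩ χ
  refine ⟨fun e => if e none = Sum.inl (Fin.last n) then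
    attachPull K X I (splitMap (Fin.last n)) χ (fun x => e (some x)) else 0, ?_, ?_⟩
  · intro e he
    dsimp only
    split_ifs with hl
    · by_cases hu : ∃ x, e (some x) = Sum.inl (Fin.last n)
      · exact hsplit0 _ hu
      · push Not at hu
        obtain ⟨v, hv⟩ := exists_skipVert _ _ hu
        rw [← hv, hsplit]
        refine hχ v fun hf => he fun p => ?_
        refine Fin.lastCases ⟨none, hl⟩ (fun p => ?_) p
        obtain ⟨x, hx⟩ := hf p
        exact ⟨some x, (congrFun hv x).symm.trans (by simp [hx])⟩
    · rfl
  · intro e he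
    obtain ⟨k, hk⟩ : ∃ k, e none = k := ⟨_, rfl⟩
    by_cases hl : k = Sum.inl (Fin.last (n + 1))
    · rw [hl] at hk
      have hm : ∀ i : Fin (n + 1), mergeVert i (e none) = Sum.inl (Fin.last n) := by
        intro i
        rw [hk]
        simp only [Sum.map_inl, Sum.inl.injEq, Fin.ext_iff, val_predAbove, Fin.val_last]
        split_ifs <;> omega
      unfold mergeSum
      simp only [Function.comp, hm, if_true]
      by_cases hu : ∃ x, e (some x) = Sum.inl (Fin.last (n + 1))
      · rw [h2 e hu]
        symm
        refine Finset.sum_eq_zero fun i _ => ?_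
        obtain ⟨x, hx⟩ := hu
        rw [hsplit0 _ ⟨x, ?_⟩, mul_zero]
        rw [hx, ← hk, hm]
      · push Not at hu
        obtain ⟨w, hw⟩ := exists_skipVert _ _ hu
        have hew : e = consAttach (Sum.inl (Fin.last (n + 1)))
            (skipVert (Fin.last (n + 1)) ∘ w) := by
          rw [hw, ← hk]
          exact (consAttach_eta e).symm
        have hf : IsFull w := by
          intro p
          obtain ⟨_ | x, hx⟩ := he p.castSucc
          · rw [hk] at hx
            simp [Fin.ext_iff] at hx
            omega
          · refine ⟨x, ?_⟩
            rw [← congrFun hw x] at hx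
            rcases hwx : w x with q | v
            · simpa [hwx] using hx
            · simp [hwx] at hx
        rw [hew, h w hf, Fin.sum_univ_castSucc]
        have hlast : attachPull K X I (splitMap (Fin.last n)) χ (fun x => mergeVert (Fin.last n)
            (consAttach (Sum.inl (Fin.last (n + 1))) (skipVert (Fin.last (n + 1)) ∘ w)
              (some x))) = 0 := by
          obtain ⟨x, hx⟩ := hf (Fin.last n)
          exact hsplit0 _ ⟨x, by simp [hx]⟩
        rw [hlast, mul_zero, add_zero, mergeSum]
        refine Finset.sum_congr rfl fun i _ => ?_
        rw [← hsplit]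
        congr 1
        refine congrArg (attachPull K X I (splitMap (Fin.last n)) χ) (funext fun x => ?_)
        rcases hwx : w x with q | v
        · simp [hwx]
        · simp [hwx]
    · rw [h1 e (hk ▸ hl)]
      symm
      refine Finset.sum_eq_zero fun i _ => ?_
      simp only [Function.comp]
      split_ifs with hi
      · rw [hsplit0, mul_zero]
        -- the vertices `n` and `n + 1` have been merged, and the last one has another half-edge
        obtain ⟨_ | x, hx⟩ := he (Fin.last (n + 1))
        · exact absurd (hk.symm.trans hx) hl
        · refine ⟨x, ?_⟩
          rw [hx]
          simp only [Sum.map_inl, Sum.inl.injEq, Fin.ext_iff, val_predAbove, Fin.val_last]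
          split_ifs <;> omega
      · exact mul_zero _

theorem consAttach_not_isFull_last {n : ℕ} (w : X → Fin n ⊕ Fin I) (h : IsFull
    (consAttach (Sum.inl (Fin.last n)) (skipVert (Fin.last n) ∘ w))) : IsFull w := by
  intro p
  rcases (isFull_consAttach_inl _ _).1 h p.castSucc with hp | ⟨x, hx⟩
  · simp [Fin.ext_iff] at hp
    omega
  · refine ⟨x, ?_⟩
    rcases hw : w x with q | v
    · simpa [hw] using hx
    · simp [hw] at hx

/-- Exactness of the complex of normalized functions on attachments passes from `X` to the attachments
with one additional half-edge. -/
theorem exists_mergeSum_option [CharZero K]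
    (ih : ∀ (n : ℕ) (φ : (X → Fin (n + 1) ⊕ Fin I) → K), (∀ e, ¬ IsFull e → φ e = 0) →
      (∀ e, IsFull e → mergeSum φ e = 0) → (∀ e, IsUnivalent e → altSum φ e = 0) →
      ∃ ψ : (X → Fin n ⊕ Fin I) → K, (∀ e, ¬ IsFull e → ψ e = 0) ∧
        ∀ e, IsFull e → φ e = mergeSum ψ e)
    (n : ℕ) (φ : (Option X → Fin (n + 1) ⊕ Fin I) → K) (hφ : ∀ e, ¬ IsFull e → φ e = 0)
    (hc : ∀ e, IsFull e → mergeSum φ e = 0) (ha : ∀ e, IsUnivalent e → altSum φ e = 0) :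
    ∃ ψ : (Option X → Fin n ⊕ Fin I) → K, (∀ e, ¬ IsFull e → ψ e = 0) ∧
      ∀ e, IsFull e → φ e = mergeSum ψ e := by
  -- where the additional half-edge is at an internal vertex, the induction hypothesis applies
  have hint : ∀ j : Fin I, ∃ ψ : (X → Fin n ⊕ Fin I) → K, (∀ e, ¬ IsFull e → ψ e = 0) ∧
      ∀ e, IsFull e → φ (consAttach (Sum.inr j) e) = mergeSum ψ e := by
    intro j
    refine ih n (fun e => φ (consAttach (Sum.inr j) e))
      (fun e he => hφ _ (by rwa [isFull_consAttach_inr])) (fun e he => ?_) (fun e he => ?_)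
    · have := hc (consAttach (Sum.inr j) e) (by rwa [isFull_consAttach_inr])
      simpa only [mergeSum, comp_consAttach, Sum.map_inr, id_eq] using this
    · have := ha _ (isUnivalent_consAttach_inr j e he)
      simpa only [altSum, comp_consAttach, Sum.map_inr, id_eq] using this
  choose ψi hψi0 hψi using hint
  -- where it is at an external vertex, the homotopy moves it to new external vertices
  let ψ : (Option X → Fin n ⊕ Fin I) → K := fun e => Sum.elim
    (fun k : Fin n => ∑ j : Fin (n + 1), if (j : ℕ) ≤ k then
      (-1) ^ (j : ℕ) * φ (consAttach (Sum.inl j) (skipVert j ∘ fun x => e (some x))) else 0)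
    (fun j => ψi j fun x => e (some x)) (e none)
  have hψ0 : ∀ e, ¬ IsFull e → ψ e = 0 := by
    intro e he
    rw [← consAttach_eta e] at he
    rcases hk : e none with k | j
    · simp only [ψ, hk, Sum.elim_inl]
      refine Finset.sum_eq_zero fun j _ => ?_
      rw [hφ, mul_zero, ite_self]
      intro hf
      rw [hk, isFull_consAttach_inl] at he
      rw [isFull_consAttach_inl] at hf
      refine he fun p => Or.inr ?_
      obtain ⟨x, hx⟩ := (hf (j.succAbove p)).resolve_left (Fin.succAbove_ne j p).symm
      refine ⟨x, ?_⟩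
      rcases hy : e (some x) with q | v
      · simpa [hy] using hx
      · simp [hy] at hx
    · simp only [ψ, hk, Sum.elim_inr]
      refine hψi0 j _ ?_
      rwa [hk, isFull_consAttach_inr] at he
  have hker : ∀ e : Option X → Fin (n + 2) ⊕ Fin I, (∃ x, e x = Sum.inl 0) →
      (∃ x, e x = Sum.inl (Fin.last (n + 1))) → mergeSum φ e = 0 := by
    intro e h0 h1
    rw [mergeSum_eq_neg_cofaceSum φ e h0 h1, cofaceSum_eq_zero hφ hc]
    exact neg_zero
  obtain ⟨θ, hθ0, hθ, hθc, hθa⟩ := exists_sub_mergeSum hφ hc hψ0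
  have hθi : ∀ (j : Fin I) u, θ (consAttach (Sum.inr j) u) = 0 := by
    intro j u
    by_cases hf : IsFull u
    · rw [hθ _ ((isFull_consAttach_inr j u).2 hf), hψi j u hf, sub_eq_zero]
      simp only [mergeSum, comp_consAttach]
      rfl
    · exact hθ0 _ (by rwa [isFull_consAttach_inr])
  have hθe : ∀ (k : Fin (n + 1)) u, (k ≠ Fin.last n ∨ ∃ x, u x = Sum.inl k) →
      θ (consAttach (Sum.inl k) u) = 0 := by
    intro k u hku
    by_cases hf : IsFull (consAttach (Sum.inl k) u)
    · rw [hθ _ hf]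
      have h1 := sum_merge_insert (fun j w => φ (consAttach (Sum.inl j) w)) k u
      rw [Finset.sum_eq_zero] at h1
      · rw [h1]
        simp only [mergeSum, comp_consAttach]
        rfl
      · intro j _
        split_ifs with hj
        · have h2 := hker (consAttach (Sum.inl j) (skipVert j ∘ u)) ?_ ?_
          · simp only [mergeSum, comp_consAttach] at h2
            exact mul_eq_zero_of_right _ h2
          · by_cases hj0 : j = 0
            · exact ⟨none, congrArg Sum.inl hj0⟩
            · obtain ⟨x, hx⟩ := ((isFull_consAttach_inl k u).1 hf 0).resolve_left (by
                rintro rfl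
                refine hj0 (Fin.ext ?_)
                simpa using hj)
              exact ⟨some x, by simp [hx, Fin.succAbove_ne_zero_zero hj0]⟩
          · have hlast : ∃ x, u x = Sum.inl (Fin.last n) := by
              by_cases hk : k = Fin.last n
              · exact hk ▸ hku.resolve_left (not_not.2 hk)
              · exact ((isFull_consAttach_inl k u).1 hf _).resolve_left hk
            obtain ⟨x, hx⟩ := hlast
            refine ⟨some x, ?_⟩
            have := k.2
            simp only [Option.elim_some, Function.comp, hx, Sum.map_inl, Sum.inl.injEq,
              Fin.ext_iff, val_succAbove, Fin.val_last]
            split_ifs <;> omega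
        · rfl
    · exact hθ0 _ hf
  have hθ1 : ∀ e, e none ≠ Sum.inl (Fin.last n) → θ e = 0 := by
    intro e he
    rw [← consAttach_eta e]
    rcases hk : e none with k | j
    · exact hθe k _ (Or.inl fun h => he (by rw [hk, h]))
    · exact hθi j _
  have hθ2 : ∀ e, (∃ x, e (some x) = Sum.inl (Fin.last n)) → θ e = 0 := by
    intro e he
    by_cases hl : e none = Sum.inl (Fin.last n)
    · rw [← consAttach_eta e, hl]
      exact hθe _ _ (Or.inr he)
    · exact hθ1 e hl
  -- what remains comes from the attachments without the additional half-edge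
  have hθψ : ∃ ψ' : (Option X → Fin n ⊕ Fin I) → K, (∀ e, ¬ IsFull e → ψ' e = 0) ∧
      ∀ e, IsFull e → θ e = mergeSum ψ' e := by
    cases n with
    | zero =>
      refine ⟨0, fun _ _ => rfl, fun e he => ?_⟩
      have : Subsingleton (Fin (0 + 1)) := inferInstanceAs (Subsingleton (Fin 1))
      by_contra h
      have h' : θ e ≠ 0 := by simpa [mergeSum] using h
      have hu : IsUnivalent e := by
        intro p
        refine ⟨none, ?_, ?_⟩
        · rw [Subsingleton.elim p (Fin.last 0)]
          exact not_not.1 fun hl => h' (hθ1 e hl)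
        · rintro (_ | x) hx
          · rfl
          · exact absurd (hθ2 e ⟨x, Subsingleton.elim p (Fin.last 0) ▸ hx⟩) h'
      have := (hθa e he).trans (ha e hu)
      rw [altSum, Fintype.sum_subsingleton _ (1 : Equiv.Perm (Fin (0 + 1)))] at this
      simp at this
      exact h' this
    | succ n =>
      let θ' : (X → Fin (n + 1) ⊕ Fin I) → K := fun w =>
        θ (consAttach (Sum.inl (Fin.last (n + 1))) (skipVert (Fin.last (n + 1)) ∘ w))
      have hc' : ∀ w, IsFull w → mergeSum θ' w = 0 := by
        intro w hw
        have h1 := hθc (consAttach (Sum.inl (Fin.last (n + 2))) (skipVert (Fin.last (n + 2)) ∘ w)) ?_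
        · rw [mergeSum, Fin.sum_univ_castSucc] at h1
          rw [hθ2, mul_zero, add_zero] at h1
          · rw [← h1, mergeSum]
            refine Finset.sum_congr rfl fun i _ => ?_
            have hl : mergeVert (I := I) i.castSucc (Sum.inl (Fin.last (n + 2))) =
                Sum.inl (Fin.last (n + 1)) := by
              simp
            have hm : mergeVert i.castSucc ∘ skipVert (Fin.last (n + 2)) ∘ w =
                skipVert (Fin.last (n + 1)) ∘ mergeVert i ∘ w := by
              funext x
              rcases hx : w x with p | v <;> simp [hx]
            rw [comp_consAttach, hl, hm]
            rfl
          · obtain ⟨x, hx⟩ := hw (Fin.last (n + 1))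
            exact ⟨x, by simp [hx]⟩
        · rw [isFull_consAttach_inl]
          intro p
          refine Fin.lastCases (Or.inl rfl) (fun p => Or.inr ?_) p
          obtain ⟨x, hx⟩ := hw p
          exact ⟨x, by simp [hx]⟩
      have ha' : ∀ w, IsUnivalent w → altSum θ' w = 0 := by
        intro w hw
        refine (altSum_consAttach_last hθ1 w).trans ?_
        have hu := isUnivalent_consAttach_last w hw
        rw [hθa _ hu.isFull, ha _ hu]
      obtain ⟨χ, hχ0, hχ⟩ := ih n θ'
        (fun w hw => hθ0 _ fun hf => hw (consAttach_not_isFull_last w hf)) hc' ha'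
      exact exists_mergeSum_of_last hθ1 hθ2 hχ0 hχ
  obtain ⟨ψ', hψ'0, hψ'⟩ := hθψ
  refine ⟨ψ + ψ', fun e he => ?_, fun e he => ?_⟩
  · rw [Pi.add_apply, hψ0 e he, hψ'0 e he, add_zero]
  · have h1 := hθ e he
    rw [hψ' e he, eq_sub_iff_add_eq] at h1
    rw [← h1]
    simp only [mergeSum, Pi.add_apply, mul_add, Finset.sum_add_distrib]
    rw [add_comm]

/-- The complex of normalized functions on attachments is exact at the functions all whose
alternating sums over univalent attachments vanish. For `I = 0` the full attachments are the ordered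
partitions of `X`, that is, the faces of the permutohedron, merging corresponds to the inclusion of a
face, and the alternating sum is the augmentation of the cellular chains. -/
theorem exists_mergeSum_eq [CharZero K] [Finite X] : ∀ (n : ℕ) (φ : (X → Fin (n + 1) ⊕ Fin I) → K),
    (∀ e, ¬ IsFull e → φ e = 0) →
    (∀ e, IsFull e → mergeSum φ e = 0) → (∀ e, IsUnivalent e → altSum φ e = 0) →
    ∃ ψ : (X → Fin n ⊕ Fin I) → K, (∀ e, ¬ IsFull e → ψ e = 0) ∧
      ∀ e, IsFull e → φ e = mergeSum ψ e := by
  refine Finite.induction_empty_option (P := fun X : Type => ∀ (n : ℕ)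
    (φ : (X → Fin (n + 1) ⊕ Fin I) → K), (∀ e, ¬ IsFull e → φ e = 0) →
    (∀ e, IsFull e → mergeSum φ e = 0) → (∀ e, IsUnivalent e → altSum φ e = 0) →
    ∃ ψ : (X → Fin n ⊕ Fin I) → K, (∀ e, ¬ IsFull e → ψ e = 0) ∧
      ∀ e, IsFull e → φ e = mergeSum ψ e) ?_ ?_ ?_ X
  · intro X Y f ih n φ h0 hc ha
    have hfull : ∀ {m : ℕ} (e : Y → Fin m ⊕ Fin I), IsFull (e ∘ f) ↔ IsFull e := fun e =>
      forall_congr' fun p => f.exists_congr_left.trans (by simp)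
    have huni : ∀ {m : ℕ} (e : X → Fin m ⊕ Fin I), IsUnivalent e → IsUnivalent (e ∘ f.symm) := by
      intro m e he p
      obtain ⟨x, hx, hx'⟩ := he p
      exact ⟨f x, by simpa using hx, fun y hy => f.symm_apply_eq.1 (hx' _ hy)⟩
    obtain ⟨ψ, hψ0, hψ⟩ := ih n (fun e => φ (e ∘ f.symm))
      (fun e he => h0 _ fun h => he (by
        have := (hfull _).2 h
        simpa [Function.comp_assoc] using this))
      (fun e he => hc (e ∘ f.symm) ((hfull _).1 (by simpa [Function.comp_assoc] using he)))
      (fun e he => ha _ (huni e he))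
    refine ⟨fun e => ψ (e ∘ f), fun e he => hψ0 _ fun h => he ((hfull e).1 h), fun e he => ?_⟩
    have := hψ (e ∘ f) ((hfull e).2 he)
    simpa [Function.comp_assoc, mergeSum] using this
  · intro n φ h0 _ _
    refine ⟨0, fun _ _ => rfl, fun e he => ?_⟩
    obtain ⟨x, -⟩ := he 0
    exact x.elim
  · intro X _ ih
    exact exists_mergeSum_option ih

end exactness

/-! ### Relative acyclicity for the attachments -/

section attachExact

variable {K : Type u} [Field K] {X : Type} {I : ℕ}

theorem isAlternating_attachments {n : ℕ} (φ : (X → Fin n ⊕ Fin I) → K) :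
    (attachments K X I).IsAlternating (n := n) φ ↔ ∀ (σ : Equiv.Perm (Fin n)) e,
      φ (Sum.map σ id ∘ e) = ((Equiv.Perm.sign σ : ℤ) : K) * φ e := by
  have h : ∀ (σ : Equiv.Perm (Fin n)), (attachments K X I).map (fun j => some (σ.symm j)) φ =
      fun e => φ (Sum.map σ.symm id ∘ e) := fun σ => funext fun e =>
    attachPull_some σ.symm φ e
  constructor
  · intro hφ σ e
    have := (h σ.symm).symm.trans (hφ σ.symm)
    rw [Equiv.Perm.sign_symm] at this
    exact congrFun this e
  · intro hφ σ
    refine (h σ).trans (funext fun e => ?_)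
    rw [hφ, Equiv.Perm.sign_symm]
    rfl

theorem sign_mul_sign {n : ℕ} (σ : Equiv.Perm (Fin n)) :
    ((Equiv.Perm.sign σ : ℤ) : K) * ((Equiv.Perm.sign σ : ℤ) : K) = 1 := by
  rw [← Int.cast_mul, Int.units_coe_mul_self, Int.cast_one]

theorem altSum_of_alternating {n : ℕ} {φ : (X → Fin n ⊕ Fin I) → K} {e : X → Fin n ⊕ Fin I}
    (h : ∀ σ : Equiv.Perm (Fin n), φ (Sum.map σ id ∘ e) = ((Equiv.Perm.sign σ : ℤ) : K) * φ e) :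
    altSum φ e = (n.factorial : K) * φ e := by
  simp only [altSum, h, ← mul_assoc, sign_mul_sign, one_mul, Finset.sum_const, Finset.card_univ,
    Fintype.card_perm, Fintype.card_fin, nsmul_eq_mul]

/-- The relative acyclicity behind smoothness, for the functions on attachments: modulo the alternating
multiderivations, normalized cocycles are coboundaries. -/
theorem attachments_exact [CharZero K] [Finite X] (n : ℕ) (φ : (X → Fin (n + 1) ⊕ Fin I) → K)
    (hφ : φ ∈ (attachments K X I).normalized (n + 1))
    (hδ : (attachments K X I).cofaceSum (n + 1) φ ∈ (attachments K X I).altMulti (n + 2)) :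
    ∃ a ∈ (attachments K X I).altMulti (n + 1), ∃ ψ ∈ (attachments K X I).normalized n,
      φ = a + (attachments K X I).cofaceSum n ψ := by
  classical
  let U := attachments K X I
  have hφ' := (mem_normalized_attachments φ).1 hφ
  -- an alternating coboundary vanishes, since its alternating sums do
  let y : (X → Fin (n + 2) ⊕ Fin I) → K := U.cofaceSum (n + 1) φ
  have hy : y = 0 := by
    refine funext fun e => ?_
    by_cases he : IsFull e
    · have h1 : altSum y e = 0 := altSum_cofaceSum φ e he
      rw [altSum_of_alternating fun σ => (isAlternating_attachments y).1 hδ.1 σ e] at h1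
      exact (mul_eq_zero.1 h1).resolve_left (Nat.cast_ne_zero.2 (Nat.factorial_ne_zero _))
    · exact (mem_normalized_attachments y).1 (U.cofaceSum_mem_normalized _ φ hφ) e he
  -- the antisymmetrization of the univalent part of `φ`
  let a : (X → Fin (n + 1) ⊕ Fin I) → K := fun e =>
    if IsUnivalent e then ((n + 1).factorial : K)⁻¹ * altSum φ e else 0
  have huni : ∀ (σ : Equiv.Perm (Fin (n + 1))) (e : X → Fin (n + 1) ⊕ Fin I),
      IsUnivalent (Sum.map σ id ∘ e) ↔ IsUnivalent e := by
    refine fun σ e => ⟨fun h => ?_, fun h => h.perm σ⟩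
    have := h.perm σ.symm
    rwa [← Function.comp_assoc, Sum.map_comp_map, Equiv.symm_comp_self, Function.comp_id,
      Sum.map_id_id, Function.id_comp] at this
  have haalt : ∀ (σ : Equiv.Perm (Fin (n + 1))) e,
      a (Sum.map σ id ∘ e) = ((Equiv.Perm.sign σ : ℤ) : K) * a e := by
    intro σ e
    simp only [a, huni, altSum_perm]
    split_ifs
    · ring
    · simp
  have ha : a ∈ U.altMulti (n + 1) := by
    refine ⟨(isAlternating_attachments a).2 haalt,
      isMultiderivation_of_isUnivalent fun e he => ?_⟩
    by_contra h
    exact he (if_neg h)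
  let θ : (X → Fin (n + 1) ⊕ Fin I) → K := φ - a
  have hθ0 : ∀ e, ¬ IsFull e → θ e = 0 := by
    intro e he
    have h1 : a e = 0 := if_neg fun h => he h.isFull
    change φ e - a e = 0
    rw [hφ' e he, h1, sub_zero]
  have hθδ : U.cofaceSum (n + 1) θ = 0 := by
    have h1 : U.cofaceSum (n + 1) a = 0 := U.cofaceSum_altMulti _ a ha
    have h2 : U.cofaceSum (n + 1) θ = U.cofaceSum (n + 1) φ - U.cofaceSum (n + 1) a :=
      map_sub _ _ _
    rw [h2, h1, sub_zero]
    exact hy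
  obtain ⟨ψ, hψ0, hψ⟩ := exists_mergeSum_eq n θ hθ0
    (fun e he => by
      rw [mergeSum_eq_neg_cofaceSum θ e he.hits.1 he.hits.2]
      exact neg_eq_zero.2 (congrFun hθδ e))
    (fun e he => by
      have h1 : altSum θ e = altSum φ e - altSum a e := by
        simp only [altSum, θ, Pi.sub_apply, mul_sub, Finset.sum_sub_distrib]
      rw [h1, altSum_of_alternating fun σ => haalt σ e]
      simp only [a, if_pos he]
      rw [mul_inv_cancel_left₀ (Nat.cast_ne_zero.2 (Nat.factorial_ne_zero _)), sub_self])
  have hψn := (mem_normalized_attachments ψ).2 hψ0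
  refine ⟨a, ha, -ψ, neg_mem hψn, ?_⟩
  have h1 : U.cofaceSum n (-ψ) = - U.cofaceSum n ψ := map_neg _ _
  have h2 : θ = - (U.cofaceSum n ψ : (X → Fin (n + 1) ⊕ Fin I) → K) := by
    refine funext fun e => ?_
    by_cases he : IsFull e
    · rw [hψ e he, mergeSum_eq_neg_cofaceSum ψ e he.hits.1 he.hits.2]
      rfl
    · rw [hθ0 e he]
      exact (neg_eq_zero.2 ((mem_normalized_attachments _).1
        (U.cofaceSum_mem_normalized n ψ hψn) e he)).symm
  exact (sub_eq_iff_eq_add'.1 h2).trans (congrArg (a + ·) h1.symm)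

end attachExact

/-! ### Coefficients of graphs -/

section coefficients

variable (K : Type u) [Field K] (d : ℕ)

theorem orientSign_mul_self {I E : ℕ} (σ : Equiv.Perm (Fin I)) (τ : Equiv.Perm (Fin E))
    (φ : Fin E → Bool) : orientSign K d σ τ φ * orientSign K d σ τ φ = 1 := by
  have h1 : ∀ e, (if φ e then (-1 : K) ^ d else 1) * (if φ e then (-1 : K) ^ d else 1) = 1 := by
    intro e
    split_ifs
    · rw [← mul_pow]
      simp
    · simp
  simp only [orientSign]
  rw [mul_mul_mul_comm, ← Finset.prod_mul_distrib]
  simp only [h1]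
  rw [Finset.prod_const_one, mul_one, mul_mul_mul_comm, ← mul_pow, ← mul_pow, sign_mul_sign,
    sign_mul_sign, one_pow, one_pow, mul_one]

theorem orientSign_mul {I E : ℕ} (σ σ₀ : Equiv.Perm (Fin I)) (τ τ₀ : Equiv.Perm (Fin E))
    (φ φ₀ : Fin E → Bool) :
    orientSign K d (σ * σ₀) (τ₀ * τ) (fun e => xor (φ₀ (τ e)) (φ e)) =
      orientSign K d σ₀ τ₀ φ₀ * orientSign K d σ τ φ := by
  have h1 : ∏ e, (if xor (φ₀ (τ e)) (φ e) then (-1 : K) ^ d else 1) =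
      (∏ e, if φ₀ e then (-1 : K) ^ d else 1) * ∏ e, if φ e then (-1 : K) ^ d else 1 := by
    rw [← Equiv.prod_comp τ (fun e => if φ₀ e then (-1 : K) ^ d else 1),
      ← Finset.prod_mul_distrib]
    refine Finset.prod_congr rfl fun e _ => ?_
    have h2 : (-1 : K) ^ d * (-1) ^ d = 1 := by
      rw [← mul_pow]
      simp
    cases φ₀ (τ e) <;> cases φ e <;> simp [h2]
  simp only [orientSign, h1, Equiv.Perm.sign_mul]
  push_cast
  ring

/-- The renumberings of the internal vertices and of the edges, combined with reversals of edges. -/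
abbrev Reorientation (I E : ℕ) : Type :=
  Equiv.Perm (Fin I) × Equiv.Perm (Fin E) × (Fin E → Bool)

/-- The sign of a reorientation. -/
abbrev Reorientation.sgn {I E : ℕ} (g : Reorientation I E) : K := orientSign K d g.1 g.2.1 g.2.2

theorem act_act {n : ℕ} (G : OGraph n) (σ₀ τ₀ φ₀ σ τ φ) :
    (G.act 1 σ₀ τ₀ φ₀).act 1 σ τ φ =
      G.act 1 (σ * σ₀) (τ₀ * τ) (fun e => xor (φ₀ (τ e)) (φ e)) := by
  refine OGraph.ext rfl rfl (heq_of_eq (funext fun h => ?_))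
  simp only [Equiv.Perm.coe_mul, Function.comp, Bool.xor_assoc, Sum.map_map]
  rfl

open Classical in
/-- The coefficients of a graph at the graphs with `I` internal vertices and `E` edges: the coefficient
at the attachment `e` is the average of the signs of the reorientations of the graph, over all its
reorientations, where those that do not result in `e` count as `0`. No basis of the space of graphs is
chosen: in general a graph has several nonzero coefficients, and it has none if an odd symmetry makes
its class vanish. -/
def attachCoeff {n : ℕ} (I E : ℕ) (G : OGraph n) (e : Fin E × Bool → Fin n ⊕ Fin I) : K :=
  (Fintype.card (Reorientation G.I G.E) : K)⁻¹ * ∑ g : Reorientation G.I G.E,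
    if G.act 1 g.1 g.2.1 g.2.2 = ⟨I, E, e⟩ then g.sgn K d else 0

/-- The coefficients satisfy the orientation relations. -/
theorem attachCoeff_act {n : ℕ} (I E : ℕ) (G : OGraph n) (σ₀ τ₀ φ₀) :
    attachCoeff K d I E (G.act 1 σ₀ τ₀ φ₀) = orientSign K d σ₀ τ₀ φ₀ • attachCoeff K d I E G := by
  funext e
  rw [Pi.smul_apply, smul_eq_mul, attachCoeff, attachCoeff, mul_left_comm]
  congr 1
  rw [Finset.mul_sum]
  let c : Reorientation G.I G.E → Reorientation G.I G.E := fun g =>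
    (g.1 * σ₀, τ₀ * g.2.1, fun e => xor (φ₀ (g.2.1 e)) (g.2.2 e))
  have hc : Function.Bijective c := by
    refine Finite.injective_iff_bijective.1 ?_
    rintro ⟨σ, τ, φ⟩ ⟨σ', τ', φ'⟩ h
    simp only [c, Prod.mk.injEq, mul_left_inj, mul_right_inj] at h
    obtain ⟨rfl, rfl, h⟩ := h
    simp only [Prod.mk.injEq, true_and]
    funext e
    simpa using congrFun h e
  refine Fintype.sum_bijective c hc _ _ fun g => ?_
  rw [act_act]
  split_ifs with h
  · change _ = _ * orientSign K d (g.1 * σ₀) (τ₀ * g.2.1) (fun e => xor (φ₀ (g.2.1 e)) (g.2.2 e))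
    rw [orientSign_mul, ← mul_assoc, orientSign_mul_self, one_mul]
  · rw [mul_zero]

/-- The coefficients of the elements of the space of graphs at the graphs with `I` internal vertices
and `E` edges. -/
def toAttach (n I E : ℕ) : GraphSpace K d n {1} →ₗ[K] ((Fin E × Bool → Fin n ⊕ Fin I) → K) :=
  liftCls K d (attachCoeff K d I E) (by
    rintro G ρ σ τ φ rfl
    rw [attachCoeff_act]
    simp)

/-- The element of the space of graphs with given coefficients. -/
def fromAttach (n I E : ℕ) : ((Fin E × Bool → Fin n ⊕ Fin I) → K) →ₗ[K] GraphSpace K d n {1} where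
  toFun φ := ∑ e, φ e • cls K d {1} ⟨I, E, e⟩
  map_add' φ ψ := by simp [add_smul, Finset.sum_add_distrib]
  map_smul' a φ := by simp [mul_smul, Finset.smul_sum]

theorem fromAttach_apply (n I E : ℕ) (φ : (Fin E × Bool → Fin n ⊕ Fin I) → K) :
    fromAttach K d n I E φ = ∑ e, φ e • cls K d {1} ⟨I, E, e⟩ := rfl

variable {K d}

theorem toAttach_cls {n : ℕ} (I E : ℕ) (G : OGraph n) :
    toAttach K d n I E (cls K d {1} G) = attachCoeff K d I E G := liftCls_cls _ _ _

theorem attachCoeff_ne {n I E : ℕ} (G : OGraph n) (h : ¬ (G.I = I ∧ G.E = E)) :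
    attachCoeff K d I E G = 0 := by
  refine funext fun e => mul_eq_zero_of_right _ (Finset.sum_eq_zero fun g _ => if_neg fun hg => h ?_)
  exact ⟨congrArg OGraph.I hg, congrArg OGraph.E hg⟩

/-- Up to the choice of the numbers of vertices and edges, a graph can be recovered from its
coefficients: all its reorientations, taken with their signs, represent it. -/
theorem fromAttach_toAttach_cls [CharZero K] {n : ℕ} (I E : ℕ) (G : OGraph n) [Decidable (G.I = I ∧ G.E = E)] :
    fromAttach K d n I E (toAttach K d n I E (cls K d {1} G)) =
      if G.I = I ∧ G.E = E then cls K d {1} G else 0 := by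
  classical
  rw [toAttach_cls]
  split_ifs with h
  · obtain ⟨I', E', e₀⟩ := G
    obtain ⟨rfl, rfl⟩ := h
    simp only [fromAttach_apply, attachCoeff]
    simp only [mul_smul, ← Finset.smul_sum, Finset.sum_smul, ite_smul, zero_smul]
    rw [Finset.sum_comm]
    have key : ∀ g : Reorientation I' E', ∑ e, (if (OGraph.mk I' E' e₀).act 1 g.1 g.2.1 g.2.2 =
        ⟨I', E', e⟩ then g.sgn K d • cls K d {1} ⟨I', E', e⟩ else 0) =
        cls K d {1} (OGraph.mk I' E' e₀) := by
      intro g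
      rw [Finset.sum_eq_single ((OGraph.mk I' E' e₀).act 1 g.1 g.2.1 g.2.2).ends]
      · rw [if_pos rfl]
        have h1 := cls_act K d (R := {1}) (OGraph.mk I' E' e₀) 1 rfl g.1 g.2.1 g.2.2
        refine (congrArg (g.sgn K d • ·) h1).trans ?_
        simp only [smul_smul]
        rw [Equiv.Perm.sign_one, Units.val_one, Int.cast_one, one_mul, orientSign_mul_self,
          one_smul]
      · intro e _ he
        refine if_neg fun h => he ?_
        have := congrArg (fun G : OGraph n => (⟨G.I, G.E, G.ends⟩ : OGraph n)) h
        simpa [eq_comm] using this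
      · simp
    refine (congrArg (_ • ·) (Finset.sum_congr rfl fun g _ => key g)).trans ?_
    rw [Finset.sum_const, Finset.card_univ, ← Nat.cast_smul_eq_nsmul K, smul_smul,
      inv_mul_cancel₀ (Nat.cast_ne_zero.2 Fintype.card_ne_zero), one_smul]
  · rw [attachCoeff_ne G h, map_zero]

theorem mk_eq_mk {n I E : ℕ} {e e' : Fin E × Bool → Fin n ⊕ Fin I} :
    (⟨I, E, e⟩ : OGraph n) = ⟨I, E, e'⟩ ↔ e = e' := by
  simp

/-- The action of a reorientation on the attachments of half-edges. -/
def Reorientation.onAttach {I E : ℕ} (m : ℕ) (g : Reorientation I E) :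
    (Fin E × Bool → Fin m ⊕ Fin I) ≃ (Fin E × Bool → Fin m ⊕ Fin I) :=
  Equiv.arrowCongr (actHalf g.2.1 g.2.2).symm (Equiv.sumCongr 1 g.1)

theorem onAttach_mem_reconnections {m n : ℕ} (α : Fin m → Option (Fin n)) (G : OGraph n)
    (g : Reorientation G.I G.E) (f : Fin G.E × Bool → Fin m ⊕ Fin G.I) :
    g.onAttach m f ∈ (G.act 1 g.1 g.2.1 g.2.2).reconnections α ↔ f ∈ G.reconnections α := by
  rw [mem_reconnections, mem_reconnections]
  have : ∀ h, extMap α (g.onAttach m f h) = some ((G.act 1 g.1 g.2.1 g.2.2).ends h) ↔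
      extMap α (f (actHalf g.2.1 g.2.2 h)) = some (G.ends (actHalf g.2.1 g.2.2 h)) := by
    intro h
    have e : (G.act 1 g.1 g.2.1 g.2.2).ends h =
        Equiv.sumCongr 1 g.1 (G.ends (actHalf g.2.1 g.2.2 h)) := rfl
    have e' : g.onAttach m f h = Equiv.sumCongr 1 g.1 (f (actHalf g.2.1 g.2.2 h)) := rfl
    rw [e, e', extMap_map, ← Option.map_some]
    exact (Option.map_injective (Equiv.injective _)).eq_iff
  constructor
  · intro h g'
    have := (this ((actHalf g.2.1 g.2.2).symm g')).1 (h _)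
    simpa using this
  · exact fun h g' => (this g').2 (h _)

/-- The coefficients of the reconnections of a graph. -/
theorem sum_attachCoeff_reconnect {m n : ℕ} (α : Fin m → Option (Fin n)) (I E : ℕ) (G : OGraph n) :
    ∑ f ∈ G.reconnections α, attachCoeff K d I E (G.reconnect f) =
      attachPull K (Fin E × Bool) I α (attachCoeff K d I E G) := by
  classical
  by_cases h : G.I = I ∧ G.E = E
  · obtain ⟨I', E', e₀⟩ := G
    obtain ⟨rfl, rfl⟩ := h
    set G : OGraph n := ⟨I', E', e₀⟩ with hG
    have hrec : ∀ (g : Reorientation I' E') (e' : Fin E' × Bool → Fin m ⊕ Fin I'),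
        ∑ f ∈ G.reconnections α, (if (G.reconnect f).act 1 g.1 g.2.1 g.2.2 = ⟨I', E', e'⟩ then
          g.sgn K d else 0) =
        if e' ∈ (G.act 1 g.1 g.2.1 g.2.2).reconnections α then g.sgn K d else 0 := by
      intro g e'
      obtain ⟨f', rfl⟩ := (g.onAttach m).surjective e'
      rw [if_congr (onAttach_mem_reconnections α G g f') rfl rfl]
      refine Eq.trans ?_ (Finset.sum_ite_eq (G.reconnections α) f' fun _ => g.sgn K d)
      refine Finset.sum_congr rfl fun f _ => ?_
      refine if_congr ?_ rfl rfl
      have : (G.reconnect f).act 1 g.1 g.2.1 g.2.2 = ⟨I', E', g.onAttach m f⟩ := rfl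
      rw [this, mk_eq_mk, (g.onAttach m).injective.eq_iff]
      exact eq_comm
    funext e'
    have h1 : (∑ f ∈ G.reconnections α, attachCoeff K d I' E' (G.reconnect f)) e' =
        (Fintype.card (Reorientation I' E') : K)⁻¹ * ∑ g : Reorientation I' E',
          if e' ∈ (G.act 1 g.1 g.2.1 g.2.2).reconnections α then g.sgn K d else 0 := by
      have h2 : ∀ f, attachCoeff K d I' E' (G.reconnect f) e' =
          (Fintype.card (Reorientation I' E') : K)⁻¹ * ∑ g : Reorientation I' E',
            if (G.reconnect f).act 1 g.1 g.2.1 g.2.2 = ⟨I', E', e'⟩ then g.sgn K d else 0 :=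
        fun f => rfl
      simp only [Finset.sum_apply, h2]
      rw [← Finset.mul_sum, Finset.sum_comm]
      congr 1
      exact Finset.sum_congr rfl fun g _ => hrec g e'
    rw [h1]
    rcases extMap_comp_cases α e' with ⟨e, he⟩ | ⟨x, hx⟩
    · rw [attachPull_of he, attachCoeff]
      congr 1
      refine Finset.sum_congr rfl fun g _ => if_congr ?_ rfl rfl
      rw [mem_reconnections]
      refine Iff.trans ?_ (mk_eq_mk (e := (G.act 1 g.1 g.2.1 g.2.2).ends) (e' := e)).symm
      rw [funext_iff]
      exact forall_congr' fun h => by rw [he h, Option.some_inj, eq_comm]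
    · rw [attachPull_none ⟨x, hx⟩, Finset.sum_eq_zero, mul_zero]
      intro g _
      rw [if_neg]
      intro h
      have := (mem_reconnections _ _ _).1 h x
      rw [hx] at this
      cases this
  · rw [attachCoeff_ne G h, map_zero]
    exact Finset.sum_eq_zero fun f _ => attachCoeff_ne (G.reconnect f) h

theorem toAttach_pull {m n : ℕ} (α : Fin m → Option (Fin n)) (I E : ℕ)
    (y : GraphSpace K d n {1}) :
    toAttach K d m I E (pull K d α y) = attachPull K (Fin E × Bool) I α (toAttach K d n I E y) := by
  have : toAttach K d m I E ∘ₗ pull K d α =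
      attachPull K (Fin E × Bool) I α ∘ₗ toAttach K d n I E := by
    refine hom_ext fun G => ?_
    rw [LinearMap.comp_apply, LinearMap.comp_apply, toAttach_cls, pull, liftCls_cls,
      reconnectionSum, map_sum, ← sum_attachCoeff_reconnect]
    exact Finset.sum_congr rfl fun f _ => toAttach_cls I E _
  exact LinearMap.congr_fun this y

theorem fromAttach_pull {m n : ℕ} (α : Fin m → Option (Fin n)) (I E : ℕ)
    (φ : (Fin E × Bool → Fin n ⊕ Fin I) → K) :
    fromAttach K d m I E (attachPull K (Fin E × Bool) I α φ) =
      pull K d α (fromAttach K d n I E φ) := by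
  classical
  have h1 : ∀ e, attachPull K (Fin E × Bool) I α φ e =
      ∑ e₀, if e ∈ (OGraph.mk I E e₀).reconnections α then φ e₀ else 0 := by
    intro e
    rcases extMap_comp_cases α e with ⟨e₁, he⟩ | ⟨x, hx⟩
    · rw [attachPull_of he, Finset.sum_eq_single e₁]
      · rw [if_pos ((mem_reconnections _ _ _).2 he)]
      · intro e₂ _ hne
        refine if_neg fun h => hne (funext fun x => ?_)
        exact Option.some_injective _ (((mem_reconnections _ _ _).1 h x).symm.trans (he x))
      · simp
    · rw [attachPull_none ⟨x, hx⟩, Finset.sum_eq_zero]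
      intro e₀ _
      refine if_neg fun h => ?_
      rw [(mem_reconnections _ _ _).1 h x] at hx
      cases hx
  simp only [fromAttach_apply, h1, map_sum, map_smul, pull, liftCls_cls, reconnectionSum,
    Finset.sum_smul, Finset.smul_sum]
  rw [Finset.sum_comm]
  refine Finset.sum_congr rfl fun e₀ _ => ?_
  simp only [ite_smul, zero_smul]
  rw [← Finset.sum_filter]
  refine Finset.sum_congr ?_ fun _ _ => rfl
  ext f
  simp

end coefficients

/-! ### Natural maps of cosimplicial spaces -/

namespace CommCosimplicial

section naturality

variable {K : Type u} [Field K] {Y Z : CommCosimplicial K} {f : ∀ n, Y.obj n →ₗ[K] Z.obj n}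

theorem natural_normalized
    (hf : ∀ {m n : ℕ} (α : Fin m → Option (Fin n)) (y : Y.obj n),
      f m (Y.map α y) = Z.map α (f n y))
    {n : ℕ} {y : Y.obj n} (hy : y ∈ Y.normalized n) :
    f n y ∈ Z.normalized n := by
  cases n with
  | zero => trivial
  | succ n =>
    simp only [normalized, Submodule.mem_iInf, LinearMap.mem_ker] at hy ⊢
    intro i
    rw [← hf, hy i, map_zero]

theorem natural_altMulti
    (hf : ∀ {m n : ℕ} (α : Fin m → Option (Fin n)) (y : Y.obj n),
      f m (Y.map α y) = Z.map α (f n y))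
    {n : ℕ} {y : Y.obj n} (hy : y ∈ Y.altMulti n) :
    f n y ∈ Z.altMulti n := by
  refine ⟨fun σ => ?_, fun i => ?_⟩
  · rw [← hf, hy.1 σ, map_smul]
  · rw [← hf, ← hf, ← hf, hy.2 i, map_add]

theorem natural_cofaceSum
    (hf : ∀ {m n : ℕ} (α : Fin m → Option (Fin n)) (y : Y.obj n),
      f m (Y.map α y) = Z.map α (f n y))
    {n : ℕ} (y : Y.obj n) :
    f (n + 1) (Y.cofaceSum n y) = Z.cofaceSum n (f n y) := by
  simp only [cofaceSum_apply, map_sum, map_smul, hf]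

end naturality

theorem altMulti_zero {K : Type u} [Field K] (Y : CommCosimplicial K) (y : Y.obj 0) :
    y ∈ Y.altMulti 0 := by
  refine ⟨fun σ => ?_, fun i => i.elim0⟩
  rw [Subsingleton.elim σ 1]
  have : (fun j : Fin 0 => some ((1 : Equiv.Perm (Fin 0)).symm j)) = fun j => some j := rfl
  rw [this, Y.map_id]
  simp

end CommCosimplicial

/-! ### The core of a graph -/

namespace OGraph

/-- Two graphs have isomorphic cores: they become isomorphic, up to the directions of the edges, when
it is forgotten to which external vertices the half-edges at external vertices are attached. -/
def SameCore {m n : ℕ} (G : OGraph m) (G' : OGraph n) : Prop :=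
  ∃ (σ : Fin G.I ≃ Fin G'.I) (τ : Fin G.E ≃ Fin G'.E) (φ : Fin G.E → Bool), ∀ e b,
    (G'.ends (τ e, xor (φ e) b)).getRight? = ((G.ends (e, b)).getRight?).map σ

theorem SameCore.symm {m n : ℕ} {G : OGraph m} {G' : OGraph n} (h : G.SameCore G') :
    G'.SameCore G := by
  obtain ⟨σ, τ, φ, h⟩ := h
  refine ⟨σ.symm, τ.symm, fun e => φ (τ.symm e), fun e b => ?_⟩
  have := h (τ.symm e) (xor (φ (τ.symm e)) b)
  rw [← Bool.xor_assoc, Bool.xor_self, Bool.false_xor, Equiv.apply_symm_apply] at this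
  rw [this]
  simp

theorem sameCore_act {n : ℕ} (G : OGraph n) (ρ σ τ φ) : G.SameCore (G.act ρ σ τ φ) := by
  refine SameCore.symm ⟨σ.symm, τ, φ, fun e b => ?_⟩
  rcases h : G.ends (τ e, xor (φ e) b) with p | v <;> simp [h]

theorem sameCore_reconnect {m n : ℕ} (G : OGraph n) (α : Fin m → Option (Fin n))
    (f : Fin G.E × Bool → Fin m ⊕ Fin G.I) (hf : f ∈ G.reconnections α) :
    G.SameCore (G.reconnect f) := by
  refine ⟨Equiv.refl _, Equiv.refl _, fun _ => false, fun e b => ?_⟩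
  have h := (mem_reconnections G α f).1 hf (e, b)
  rcases hx : f (e, b) with j | v
  · rw [hx] at h
    simp only [extMap, Sum.elim_inl, Option.map_eq_some_iff] at h
    obtain ⟨i, -, hi⟩ := h
    simp [hx, ← hi]
  · rw [hx] at h
    have h' := Option.some_injective _ h
    simp [hx, ← h']

theorem getRight?_eq {α β : Type*} {x : α ⊕ β} {b : β} : x.getRight? = some b ↔ x = Sum.inr b := by
  rcases x with x | x <;> simp

theorem Admissible.of_sameCore {m n : ℕ} {G : OGraph m} {G' : OGraph n} (h : G.SameCore G')
    (hG : G.Admissible) : G'.Admissible := by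
  obtain ⟨σ, τ, φ, h⟩ := h
  have hv : ∀ e b v, G.ends (e, b) = Sum.inr v ↔ G'.ends (τ e, xor (φ e) b) = Sum.inr (σ v) := by
    intro e b v
    rw [← getRight?_eq, ← getRight?_eq, h]
    simp
  refine ⟨fun v' => ?_, fun v' => ?_⟩
  · obtain ⟨v, rfl⟩ := σ.surjective v'
    refine (hG.1 v).trans_eq (Finset.card_bijective
      (fun x : Fin G.E × Bool => (τ x.1, xor (φ x.1) x.2)) ⟨?_, ?_⟩ ?_)
    · rintro ⟨e, b⟩ ⟨e', b'⟩ hx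
      simp only [Prod.mk.injEq, EmbeddingLike.apply_eq_iff_eq] at hx
      obtain ⟨rfl, hx⟩ := hx
      simpa using hx
    · rintro ⟨e', b'⟩
      refine ⟨(τ.symm e', xor (φ (τ.symm e')) b'), ?_⟩
      simp
    · rintro ⟨e, b⟩
      rw [mem_half, mem_half, hv]
  · obtain ⟨v, rfl⟩ := σ.surjective v'
    obtain ⟨i, hi⟩ := hG.2 v
    have key : ∀ x, Relation.ReflTransGen G.Adj x (Sum.inl i) → ∀ v, x = Sum.inr v →
        ∃ j : Fin n, Relation.ReflTransGen G'.Adj (Sum.inr (σ v)) (Sum.inl j) := by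
      intro x hx
      induction hx using Relation.ReflTransGen.head_induction_on with
      | refl => simp
      | head hxy _ ih =>
        rintro v rfl
        obtain ⟨e, b, h1, h2⟩ := hxy
        have h1' := (hv _ _ _).1 h1
        have hadj : ∀ y, G'.ends (τ e, xor (φ e) (!b)) = y → G'.Adj (Sum.inr (σ v)) y := by
          intro y hy
          refine ⟨τ e, xor (φ e) b, h1', ?_⟩
          rw [← hy]
          cases φ e <;> cases b <;> rfl
        rcases hy : G'.ends (τ e, xor (φ e) (!b)) with j | w'
        · exact ⟨j, .single (hadj _ hy)⟩
        · obtain ⟨w, rfl⟩ := σ.surjective w'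
          obtain ⟨j, hj⟩ := ih w (h2.symm.trans ((hv _ _ _).2 hy))
          exact ⟨j, .head (hadj _ hy) hj⟩
    exact key _ hi v rfl

theorem ConnectedOffExt.of_sameCore {m n : ℕ} {G : OGraph m} {G' : OGraph n} (h : G.SameCore G')
    (hG : G.ConnectedOffExt) : G'.ConnectedOffExt := by
  obtain ⟨σ, τ, φ, h⟩ := h
  have key : ∀ x y, Relation.EqvGen G.Incident x y →
      Relation.EqvGen G'.Incident (Sum.map σ τ x) (Sum.map σ τ y) := by
    intro x y hxy
    induction hxy with
    | rel x y hxy =>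
      obtain ⟨v, e, b, hv, rfl, rfl⟩ := hxy
      refine .rel _ _ ⟨σ v, τ e, xor (φ e) b, ?_, rfl, rfl⟩
      rw [← getRight?_eq, h, getRight?_eq.2 hv]
      rfl
    | refl x => exact .refl _
    | symm x y _ ih => exact .symm _ _ ih
    | trans x y z _ _ ih1 ih2 => exact .trans _ _ _ ih1 ih2
  refine ⟨hG.1.map (Sum.map σ τ), fun x y => ?_⟩
  obtain ⟨x, rfl⟩ := (Equiv.sumCongr σ τ).surjective x
  obtain ⟨y, rfl⟩ := (Equiv.sumCongr σ τ).surjective y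
  exact key _ _ (hG.2 x y)

/-- A property of graphs that depends only on the core, that is, not on the external vertices to which
the half-edges are attached, and not on the orientation. -/
def CoreInvariant (Q : ∀ n, OGraph n → Prop) : Prop :=
  ∀ {m n : ℕ} (G : OGraph m) (G' : OGraph n), G.SameCore G' → Q m G → Q n G'

theorem CoreInvariant.iff {Q : ∀ n, OGraph n → Prop} (hQ : CoreInvariant Q) {m n : ℕ}
    {G : OGraph m} {G' : OGraph n} (h : G.SameCore G') : Q n G' ↔ Q m G :=
  ⟨hQ _ _ h.symm, hQ _ _ h⟩

theorem CoreInvariant.and {Q R : ∀ n, OGraph n → Prop} (hQ : CoreInvariant Q)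
    (hR : CoreInvariant R) : CoreInvariant fun n G => Q n G ∧ R n G :=
  fun _ _ h hG => ⟨hQ _ _ h hG.1, hR _ _ h hG.2⟩

theorem coreInvariant_counts (P : ℕ → ℕ → Prop) :
    CoreInvariant fun _ G => P G.I G.E := by
  rintro m n G G' ⟨σ, τ, -, -⟩ h
  have h1 := Fintype.card_congr σ
  have h2 := Fintype.card_congr τ
  rw [Fintype.card_fin, Fintype.card_fin] at h1 h2
  rwa [← h1, ← h2]

end OGraph

section proj

variable (K : Type u) [Field K] (d : ℕ)

open Classical in
/-- The projection to the span of the graphs with a given property. -/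
def graphProj {Q : ∀ n, OGraph n → Prop} (hQ : CoreInvariant Q) (n : ℕ) :
    GraphSpace K d n {1} →ₗ[K] GraphSpace K d n {1} :=
  liftCls K d (fun G => if Q n G then cls K d {1} G else 0) (by
    intro G ρ σ τ φ hρ
    rw [if_congr (hQ.iff (sameCore_act G ρ σ τ φ)) rfl rfl]
    split_ifs
    · exact cls_act K d G ρ hρ σ τ φ
    · simp)

variable {K d} {Q : ∀ n, OGraph n → Prop} (hQ : CoreInvariant Q)

open Classical in
theorem graphProj_cls {n : ℕ} (G : OGraph n) :
    graphProj K d hQ n (cls K d {1} G) = if Q n G then cls K d {1} G else 0 := liftCls_cls _ _ _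

/-- Properties of linear maps on the span of a class of graphs can be checked on the graphs. -/
theorem graphSpan_induction {n : ℕ} {R : Set (Equiv.Perm (Fin n))} {P : OGraph n → Prop}
    (S : Submodule K (GraphSpace K d n R)) (h : ∀ G, P G → cls K d R G ∈ S) :
    graphSpan K d R P ≤ S := by
  refine Submodule.span_le.2 ?_
  rintro _ ⟨G, hG, rfl⟩
  exact h G hG

theorem graphSpan_mono {n : ℕ} {R : Set (Equiv.Perm (Fin n))} {P P' : OGraph n → Prop}
    (h : ∀ G, P G → P' G) : graphSpan K d R P ≤ graphSpan K d R P' :=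
  graphSpan_induction _ fun G hG => Submodule.subset_span ⟨G, h G hG, rfl⟩

theorem graphSpan_top {n : ℕ} {R : Set (Equiv.Perm (Fin n))} (y : GraphSpace K d n R) :
    y ∈ graphSpan K d R (fun _ => True) := by
  have h : (⊤ : Submodule K (GraphSpace K d n R)) ≤ graphSpan K d R fun _ => True := by
    rw [← span_cls, Submodule.span_le]
    rintro _ ⟨G, rfl⟩
    exact Submodule.subset_span ⟨G, trivial, rfl⟩
  exact h trivial

theorem graphProj_mem {n : ℕ} {P : OGraph n → Prop} {y : GraphSpace K d n {1}}
    (hy : y ∈ graphSpan K d {1} P) : graphProj K d hQ n y ∈ graphSpan K d {1} fun G => P G ∧ Q n G := by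
  refine graphSpan_induction ((graphSpan K d {1} fun G => P G ∧ Q n G).comap (graphProj K d hQ n))
    (fun G hG => ?_) hy
  rw [Submodule.mem_comap, graphProj_cls]
  split_ifs with h
  · exact Submodule.subset_span ⟨G, ⟨hG, h⟩, rfl⟩
  · exact zero_mem _

theorem graphProj_mem' {n : ℕ} (y : GraphSpace K d n {1}) :
    graphProj K d hQ n y ∈ graphSpan K d {1} (Q n) :=
  graphSpan_mono (fun _ h => h.2) (graphProj_mem hQ (graphSpan_top y))

theorem graphProj_of_mem {n : ℕ} {y : GraphSpace K d n {1}} (hy : y ∈ graphSpan K d {1} (Q n)) :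
    graphProj K d hQ n y = y := by
  refine LinearMap.mem_eqLocus.1 (graphSpan_induction
    (LinearMap.eqLocus (graphProj K d hQ n) LinearMap.id) (fun G hG => ?_) hy)
  rw [LinearMap.mem_eqLocus, graphProj_cls, if_pos hG]
  rfl

theorem graphProj_eq_zero {n : ℕ} {P : OGraph n → Prop} {y : GraphSpace K d n {1}}
    (hy : y ∈ graphSpan K d {1} P) (hP : ∀ G, P G → ¬ Q n G) : graphProj K d hQ n y = 0 := by
  refine LinearMap.mem_ker.1 (graphSpan_induction
    (LinearMap.ker (graphProj K d hQ n)) (fun G hG => ?_) hy)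
  rw [LinearMap.mem_ker, graphProj_cls, if_neg (hP G hG)]

theorem graphProj_pull {m n : ℕ} (α : Fin m → Option (Fin n)) (y : GraphSpace K d n {1}) :
    graphProj K d hQ m (pull K d α y) = pull K d α (graphProj K d hQ n y) := by
  classical
  have : graphProj K d hQ m ∘ₗ pull K d α = pull K d α ∘ₗ graphProj K d hQ n := by
    refine hom_ext fun G => ?_
    rw [LinearMap.comp_apply, LinearMap.comp_apply, graphProj_cls, pull, liftCls_cls,
      reconnectionSum, map_sum]
    have h : ∀ f ∈ G.reconnections α, graphProj K d hQ m (cls K d {1} (G.reconnect f)) =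
        if Q n G then cls K d {1} (G.reconnect f) else 0 := fun f hf => by
      rw [graphProj_cls, if_congr (hQ.iff (sameCore_reconnect G α f hf)) rfl rfl]
    rw [Finset.sum_congr rfl h]
    split_ifs
    · rw [liftCls_cls, reconnectionSum]
    · rw [map_zero, Finset.sum_const_zero]
  exact LinearMap.congr_fun this y

theorem diff_mem_of_expand {n : ℕ} {R : Set (Equiv.Perm (Fin n))} {P P' : OGraph n → Prop}
    (h : ∀ G, P G → ∀ v A, G.IsExpansion v A → P' (G.expand v A)) {y : GraphSpace K d n R}
    (hy : y ∈ graphSpan K d R P) : diff K d R y ∈ graphSpan K d R P' := by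
  refine graphSpan_induction ((graphSpan K d R P').comap (diff K d R)) (fun G hG => ?_) hy
  rw [Submodule.mem_comap, diff, liftCls_cls]
  refine Submodule.sum_mem _ fun v _ => Submodule.sum_mem _ fun A _ => ?_
  split_ifs with hA
  · exact Submodule.smul_mem _ _ (Submodule.subset_span ⟨_, h G hG v A hA, rfl⟩)
  · exact zero_mem _

end proj

/-! ### Classes of graphs -/

/-- A class of graphs that depends only on the cores and is closed under expansions. These are the
properties that make its span stable under the structure maps and under the differential. -/
structure GraphClass where
  Mem : ∀ n, OGraph n → Prop
  core : CoreInvariant Mem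
  expand : ∀ {n : ℕ} (G : OGraph n), Mem n G → ∀ v A, G.IsExpansion v A → Mem n (G.expand v A)

section level

variable (K : Type u) [Field K] [CharZero K] (d : ℕ)

/-- The commutative `Σ`-cosimplicial dg vector space spanned by the graphs in a class. -/
def GraphClass.graphs (C : GraphClass) : CommCosimplicial K :=
  (allGraphsCosimplicial K d).sub (fun n => graphSpan K d {1} (C.Mem n))
    (fun _ => homogeneous_graphSpan K d {1} rfl _)
    (fun n => diff_mem_graphSpan K d {1} (C.Mem n) C.expand)
    (fun α => pull_mem_graphSpan K d α _ _ fun G hG f hf =>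
      C.core _ _ (sameCore_reconnect G α f hf) hG)

variable {K d} {C : GraphClass}

/-- The inclusion in the space of all the graphs with `n` external vertices. -/
def GraphClass.val (C : GraphClass) (n : ℕ) : (C.graphs K d).obj n →ₗ[K] GraphSpace K d n {1} :=
  (graphSpan K d {1} (C.Mem n)).subtype

theorem GraphClass.val_injective (n : ℕ) : Function.Injective (C.val (K := K) (d := d) n) :=
  Subtype.val_injective

theorem GraphClass.val_mem {n : ℕ} (y : (C.graphs K d).obj n) :
    C.val n y ∈ graphSpan K d {1} (C.Mem n) := Subtype.coe_prop y

theorem GraphClass.val_map {m n : ℕ} (α : Fin m → Option (Fin n)) (y : (C.graphs K d).obj n) :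
    C.val m ((C.graphs K d).map α y) = pull K d α (C.val n y) := rfl

theorem GraphClass.val_d {n : ℕ} (y : (C.graphs K d).obj n) :
    C.val n (((C.graphs K d).obj n).d y) = diff K d {1} (C.val n y) := rfl

/-- The projection of all the graphs to those in a class with a further property. -/
def GraphClass.toGraphs (C : GraphClass) {R : ∀ n, OGraph n → Prop} (hR : CoreInvariant R) (n : ℕ) :
    GraphSpace K d n {1} →ₗ[K] (C.graphs K d).obj n :=
  (graphProj K d (CoreInvariant.and C.core hR) n).codRestrict (graphSpan K d {1} (C.Mem n)) fun y =>
    graphSpan_mono (fun _ h => h.1) (graphProj_mem' (CoreInvariant.and C.core hR) y)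

theorem GraphClass.val_toGraphs {R : ∀ n, OGraph n → Prop} (hR : CoreInvariant R) {n : ℕ}
    (y : GraphSpace K d n {1}) :
    C.val n (C.toGraphs hR n y) = graphProj K d (CoreInvariant.and C.core hR) n y := rfl

theorem GraphClass.toGraphs_pull {R : ∀ n, OGraph n → Prop} (hR : CoreInvariant R) {m n : ℕ}
    (α : Fin m → Option (Fin n)) (y : GraphSpace K d n {1}) :
    C.toGraphs hR m (pull K d α y) = (C.graphs K d).map α (C.toGraphs hR n y) := by
  refine C.val_injective _ ?_
  rw [C.val_toGraphs, C.val_map, C.val_toGraphs, graphProj_pull]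

/-- The graphs with `p` internal vertices and `q` edges. -/
theorem counts_eq (p q : ℕ) : CoreInvariant fun _ G => G.I = p ∧ G.E = q :=
  coreInvariant_counts fun I E => I = p ∧ E = q

theorem toGraphs_fromAttach_toAttach {p q n : ℕ} (y : GraphSpace K d n {1}) :
    C.toGraphs (counts_eq p q) n (fromAttach K d n p q (toAttach K d n p q y)) =
      C.toGraphs (counts_eq p q) n y := by
  classical
  refine C.val_injective _ ?_
  rw [C.val_toGraphs, C.val_toGraphs]
  have : graphProj K d (CoreInvariant.and C.core (counts_eq p q)) n ∘ₗ fromAttach K d n p q ∘ₗ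
      toAttach K d n p q = graphProj K d (CoreInvariant.and C.core (counts_eq p q)) n := by
    refine hom_ext fun G => ?_
    rw [LinearMap.comp_apply, LinearMap.comp_apply, fromAttach_toAttach_cls]
    split_ifs with h
    · rfl
    · rw [map_zero, graphProj_cls, if_neg fun h' => h h'.2]
  exact LinearMap.congr_fun this y

end level

section retract

variable {K : Type u} [Field K] [CharZero K]

/-- Relative acyclicity is inherited from the attachments by the image of a natural idempotent that
factors through them. -/
theorem exact_of_retract {Y : CommCosimplicial K} {X : Type} [Fintype X] {I : ℕ}
    (f : ∀ n, Y.obj n →ₗ[K] (attachments K X I).obj n)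
    (g : ∀ n, (attachments K X I).obj n →ₗ[K] Y.obj n)
    (hf : ∀ {m n : ℕ} (α : Fin m → Option (Fin n)) (y : Y.obj n),
      f m (Y.map α y) = (attachments K X I).map α (f n y))
    (hg : ∀ {m n : ℕ} (α : Fin m → Option (Fin n)) (y : (attachments K X I).obj n),
      g m ((attachments K X I).map α y) = Y.map α (g n y))
    (hgf : ∀ n y, g n (f n (g n (f n y))) = g n (f n y))
    {n : ℕ} {y : Y.obj (n + 1)} (hy : y ∈ Y.normalized (n + 1))
    (hδ : g (n + 2) (f (n + 2) (Y.cofaceSum (n + 1) y)) ∈ Y.altMulti (n + 2)) :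
    ∃ a ∈ Y.altMulti (n + 1), ∃ z ∈ Y.normalized n, z ∈ LinearMap.range (g n) ∧
      g (n + 1) (f (n + 1) y) = a + Y.cofaceSum n z := by
  have h0 := CommCosimplicial.natural_normalized hf
    (CommCosimplicial.natural_normalized hg (CommCosimplicial.natural_normalized hf hy))
  have h1 : (attachments K X I).cofaceSum (n + 1) (f (n + 1) (g (n + 1) (f (n + 1) y))) ∈
      (attachments K X I).altMulti (n + 2) := by
    rw [← CommCosimplicial.natural_cofaceSum hf, ← CommCosimplicial.natural_cofaceSum hg,
      ← CommCosimplicial.natural_cofaceSum hf]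
    exact CommCosimplicial.natural_altMulti hf hδ
  obtain ⟨a, ha, ψ, hψ, h2⟩ := attachments_exact n _ h0 h1
  refine ⟨g (n + 1) a, CommCosimplicial.natural_altMulti hg ha, g n ψ,
    CommCosimplicial.natural_normalized hg hψ, ⟨ψ, rfl⟩, ?_⟩
  rw [← CommCosimplicial.natural_cofaceSum hg, ← hgf]
  exact (congrArg (g (n + 1)) h2).trans (map_add _ _ _)

end retract

section level

variable {K : Type u} [Field K] [CharZero K] {d : ℕ} {C : GraphClass}

/-- The part with `p` internal vertices and `q` edges of the relative acyclicity behind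
smoothness, without the internal differential. -/
theorem exists_eq_add_cofaceSum (p q n : ℕ) (y : (C.graphs K d).obj (n + 1))
    (hy : y ∈ (C.graphs K d).normalized (n + 1))
    (hδ : C.toGraphs (counts_eq p q) (n + 2) (C.val _ ((C.graphs K d).cofaceSum (n + 1) y)) ∈
      (C.graphs K d).altMulti (n + 2)) :
    ∃ a ∈ (C.graphs K d).altMulti (n + 1), ∃ z ∈ (C.graphs K d).normalized n,
      C.val n z ∈ graphSpan K d {1} (fun G => C.Mem n G ∧ G.I = p ∧ G.E = q) ∧
      C.toGraphs (counts_eq p q) (n + 1) (C.val _ y) = a + (C.graphs K d).cofaceSum n z := by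
  let f : ∀ n, (C.graphs K d).obj n →ₗ[K] (attachments K (Fin q × Bool) p).obj n := fun n =>
    toAttach K d n p q ∘ₗ C.val n
  let g : ∀ n, (attachments K (Fin q × Bool) p).obj n →ₗ[K] (C.graphs K d).obj n := fun n =>
    C.toGraphs (counts_eq p q) n ∘ₗ fromAttach K d n p q
  have hgf : ∀ n y, g n (f n y) = C.toGraphs (counts_eq p q) n (C.val n y) := fun n y =>
    toGraphs_fromAttach_toAttach _
  have hf : ∀ {m n : ℕ} (α : Fin m → Option (Fin n)) (y : (C.graphs K d).obj n),
      f m ((C.graphs K d).map α y) = (attachments K (Fin q × Bool) p).map α (f n y) :=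
    fun α y => toAttach_pull α p q _
  have hg : ∀ {m n : ℕ} (α : Fin m → Option (Fin n))
      (y : (attachments K (Fin q × Bool) p).obj n),
      g m ((attachments K (Fin q × Bool) p).map α y) = (C.graphs K d).map α (g n y) :=
    fun α y => (congrArg _ (fromAttach_pull α p q y)).trans (C.toGraphs_pull (counts_eq p q) α _)
  have hPP : ∀ n y, g n (f n (g n (f n y))) = g n (f n y) := fun n y => by
    rw [hgf, hgf]
    refine C.val_injective _ ?_
    rw [C.val_toGraphs, C.val_toGraphs]
    exact graphProj_of_mem (CoreInvariant.and C.core (counts_eq p q))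
      (graphProj_mem' (CoreInvariant.and C.core (counts_eq p q)) _)
  rw [← hgf] at hδ
  obtain ⟨a, ha, z, hz, ⟨ψ, hψ⟩, h⟩ := exact_of_retract f g hf hg hPP hy hδ
  rw [hgf] at h
  refine ⟨a, ha, z, hz, ?_, h⟩
  rw [← hψ]
  exact graphProj_mem' (CoreInvariant.and C.core (counts_eq p q)) _

end level

/-! ### Smoothness from filtrations -/

section totals

variable {K : Type u} [Field K]

/-- The inclusion of a subcomplex is a quasi-isomorphism if the quotient complex is acyclic. -/
theorem DGVect.subIncl_isQuasiIso (C : DGVect K) {S T : Submodule K C} (hS : C.Homogeneous S)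
    (hdS : ∀ x ∈ S, C.d x ∈ S) (hT : C.Homogeneous T) (hdT : ∀ x ∈ T, C.d x ∈ T) (h : S ≤ T)
    (hex : ∀ x ∈ T, C.d x ∈ S → ∃ a ∈ S, ∃ y ∈ T, x = a + C.d y) :
    (C.subIncl hS hdS hT hdT h).IsQuasiIso := by
  constructor
  · refine (injective_iff_map_eq_zero _).2 fun x hx => ?_
    obtain ⟨⟨⟨s, hs⟩, hs'⟩, rfl⟩ := Submodule.mkQ_surjective _ x
    obtain ⟨⟨t, ht⟩, hts⟩ := (Submodule.Quotient.mk_eq_zero _).1 hx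
    have hts' : C.d t = s := congrArg Subtype.val hts
    obtain ⟨a, ha, y, hy, rfl⟩ := hex t ht (hts' ▸ hs)
    refine (Submodule.Quotient.mk_eq_zero _).2 ⟨⟨a, ha⟩, Subtype.ext ?_⟩
    rw [map_add, C.d_d, add_zero] at hts'
    exact hts'
  · intro x
    obtain ⟨⟨⟨t, ht⟩, ht'⟩, rfl⟩ := Submodule.mkQ_surjective _ x
    have ht1 : (C.sub T hT hdT).d ⟨t, ht⟩ = 0 := ht'
    have ht0 : C.d t = 0 := congrArg Subtype.val ht1
    obtain ⟨a, ha, y, hy, rfl⟩ := hex t ht (ht0 ▸ zero_mem S)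
    have ha0 : C.d a = 0 := by
      rw [map_add, C.d_d, add_zero] at ht0
      exact ht0
    refine ⟨Submodule.Quotient.mk (p := (LinearMap.range (C.sub S hS hdS).d).comap
      (LinearMap.ker (C.sub S hS hdS).d).subtype) ⟨⟨a, ha⟩, Subtype.ext ha0⟩, ?_⟩
    refine (Submodule.Quotient.eq _).2 ⟨(⟨-y, neg_mem hy⟩ : T), Subtype.ext ?_⟩
    change C.d (-y) = a - (a + C.d y)
    rw [map_neg]
    abel

theorem DGVect.totalD_succ (C : ℕ → DGVect K) (δ : ∀ n, C n →ₗ[K] C (n + 1)) (x : ⨁ n, C n)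
    (n : ℕ) : DGVect.totalD C δ x (n + 1) =
      δ n (x n) + (-1 : K) ^ (n + 1) • (C (n + 1)).d (x (n + 1)) := by
  refine DGVect.total_ind C (P := fun x => DGVect.totalD C δ x (n + 1) =
      δ n (x n) + (-1 : K) ^ (n + 1) • (C (n + 1)).d (x (n + 1))) (by simp) ?_ ?_ x
  · intro m y
    rw [DGVect.totalD_lof, DirectSum.add_apply, DirectSum.smul_apply]
    have h : ∀ (k l : ℕ) (z : C k), k ≠ l → DirectSum.lof K ℕ (fun n => (C n).carrier) k z l = 0 :=
      fun k l z hkl => DirectSum.of_eq_of_ne (β := fun n => (C n).carrier) k l z hkl.symm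
    by_cases h1 : m = n
    · subst h1
      rw [h m (m + 1) _ (by omega), h m (m + 1) _ (by omega), DirectSum.lof_apply,
        DirectSum.lof_apply, map_zero, smul_zero, smul_zero]
    · rw [h (m + 1) (n + 1) _ (by omega), h m n _ h1, map_zero, zero_add, zero_add]
      by_cases h2 : m = n + 1
      · subst h2
        rw [DirectSum.lof_apply, DirectSum.lof_apply]
      · rw [h _ _ _ h2, h _ _ _ h2, map_zero, smul_zero, smul_zero]
  · intro y z hy hz
    rw [map_add, DirectSum.add_apply, hy, hz, DirectSum.add_apply, DirectSum.add_apply, map_add,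
      map_add, smul_add]
    abel

namespace CommCosimplicial

variable (Y : CommCosimplicial K)

/-- The differential of the cochain complex. -/
abbrev cochainsD : (⨁ n, Y.obj n) →ₗ[K] (⨁ n, Y.obj n) := DGVect.totalD Y.obj Y.cofaceSum

/-- The passage from one piece `F` of a filtration to the next one `F'`: up to boundaries, cochains in
`F` with differential in `AM(Y)` can be moved to `F'` by the subtraction of elements of `AM(Y)`. -/
theorem exists_of_graded (F F' : ∀ n, Submodule K (Y.obj n))
    (hstep : ∀ n, ∀ y ∈ Y.normalized (n + 1) ⊓ F (n + 1), ∀ y' ∈ F (n + 2),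
      Y.cofaceSum (n + 1) y + (-1 : K) ^ (n + 2) • (Y.obj (n + 2)).d y' ∈ Y.altMulti (n + 2) →
      ∃ a ∈ Y.altMulti (n + 1), ∃ z ∈ Y.normalized n, (Y.obj n).d z ∈ F' n ∧
        y - a - Y.cofaceSum n z ∈ Y.normalized (n + 1) ⊓ F' (n + 1))
    (x : ⨁ n, Y.obj n) (hx : x ∈ DGVect.sumSub Y.obj fun n => Y.normalized n ⊓ F n)
    (hd : Y.cochainsD x ∈ DGVect.sumSub Y.obj Y.altMulti) :
    ∃ a ∈ DGVect.sumSub Y.obj Y.altMulti, ∃ z ∈ DGVect.sumSub Y.obj Y.normalized,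
      ∃ w ∈ DGVect.sumSub Y.obj fun n => Y.normalized n ⊓ F' n, x = a + Y.cochainsD z + w := by
  let A := DGVect.sumSub Y.obj Y.altMulti
  let N := DGVect.sumSub Y.obj Y.normalized
  let W := DGVect.sumSub Y.obj fun n => Y.normalized n ⊓ F' n
  suffices h : x ∈ A ⊔ N.map Y.cochainsD ⊔ W by
    obtain ⟨b, hb, w, hw, rfl⟩ := Submodule.mem_sup.1 h
    obtain ⟨a, ha, b', ⟨z, hz, rfl⟩, rfl⟩ := Submodule.mem_sup.1 hb
    exact ⟨a, ha, z, hz, w, hw, rfl⟩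
  have key : ∀ n, DirectSum.lof K ℕ (fun n => (Y.obj n).carrier) n (x n) ∈ A ⊔ N.map Y.cochainsD ⊔ W := by
    intro n
    cases n with
    | zero =>
      -- in cosimplicial degree `0`, every element is an alternating multiderivation
      exact Submodule.mem_sup_left (Submodule.mem_sup_left
        (DGVect.lof_mem_sumSub Y.obj Y.altMulti 0 _ (Y.altMulti_zero _)))
    | succ n =>
      have h1 := hd (n + 2)
      have h2 : Y.cochainsD x (n + 2) = _ := DGVect.totalD_succ Y.obj Y.cofaceSum x (n + 1)
      obtain ⟨a, ha, z, hz, hdz, hw⟩ := hstep n (x (n + 1)) (hx (n + 1)) (x (n + 2))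
        (hx (n + 2)).2 (h2 ▸ h1)
      have h3 := DGVect.totalD_lof Y.obj Y.cofaceSum n z
      have h4 : DirectSum.lof K ℕ (fun n => (Y.obj n).carrier) (n + 1) (x (n + 1)) =
          DirectSum.lof K ℕ (fun n => (Y.obj n).carrier) (n + 1) a +
          Y.cochainsD (DirectSum.lof K ℕ (fun n => (Y.obj n).carrier) n z) +
          (DirectSum.lof K ℕ (fun n => (Y.obj n).carrier) (n + 1)
            (x (n + 1) - a - Y.cofaceSum n z) -
          (-1 : K) ^ n • DirectSum.lof K ℕ (fun n => (Y.obj n).carrier) n ((Y.obj n).d z)) := by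
        refine Eq.trans ?_ (congrArg (fun t => _ + t + _) h3.symm)
        rw [map_sub, map_sub]
        abel
      rw [h4]
      refine Submodule.add_mem_sup (Submodule.add_mem_sup
        (DGVect.lof_mem_sumSub Y.obj Y.altMulti _ _ ha)
        (Submodule.mem_map_of_mem (DGVect.lof_mem_sumSub Y.obj Y.normalized _ _ hz)))
        (sub_mem (DGVect.lof_mem_sumSub Y.obj _ _ _ hw) (Submodule.smul_mem _ _
          (DGVect.lof_mem_sumSub Y.obj _ _ _ ⟨Y.d_mem_normalized n z hz, hdz⟩)))
  obtain ⟨s, hs⟩ := DGVect.eq_sum_lof Y.obj x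
  rw [hs]
  exact Submodule.sum_mem _ fun n _ => key n

/-- Smoothness from a family of filtrations, indexed by `c`, whose union is everything and each of
which is finite. The hypothesis `hstep` says that on the associated graded pieces, where the
internal differential drops out, the cosimplicial cocycles relative to the alternating
multiderivations are boundaries relative to them. -/
theorem smooth_of_filtration (F : ℕ → ℕ → ∀ n, Submodule K (Y.obj n))
    (hmono : ∀ c c' n, c ≤ c' → F c 0 n ≤ F c' 0 n) (hex : ∀ n y, ∃ c, y ∈ F c 0 n)
    (hbot : ∀ c, ∃ p, ∀ n, F c p n = ⊥)
    (hstep : ∀ c p n, ∀ y ∈ Y.normalized (n + 1) ⊓ F c p (n + 1), ∀ y' ∈ F c p (n + 2),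
      Y.cofaceSum (n + 1) y + (-1 : K) ^ (n + 2) • (Y.obj (n + 2)).d y' ∈ Y.altMulti (n + 2) →
      ∃ a ∈ Y.altMulti (n + 1), ∃ z ∈ Y.normalized n, (Y.obj n).d z ∈ F c (p + 1) n ∧
        y - a - Y.cofaceSum n z ∈ Y.normalized (n + 1) ⊓ F c (p + 1) (n + 1)) :
    Y.Smooth := by
  classical
  refine DGVect.subIncl_isQuasiIso _ _ _ _ _ _ fun (x : ⨁ n, Y.obj n) hx hd => ?_
  change Y.cochainsD x ∈ DGVect.sumSub Y.obj Y.altMulti at hd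
  suffices h : ∃ a ∈ DGVect.sumSub Y.obj Y.altMulti, ∃ z ∈ DGVect.sumSub Y.obj Y.normalized,
      x = a + Y.cochainsD z from h
  have hAd : ∀ a ∈ DGVect.sumSub Y.obj Y.altMulti, Y.cochainsD a ∈ DGVect.sumSub Y.obj Y.altMulti :=
    DGVect.d_mem_sumSub Y.obj Y.cofaceSum Y.cofaceSum_deg Y.cofaceSum_d Y.cofaceSum_sq _
      Y.d_mem_altMulti fun n x hx => by rw [Y.cofaceSum_altMulti n x hx]; exact zero_mem _
  obtain ⟨c, hc⟩ : ∃ c, x ∈ DGVect.sumSub Y.obj fun n => Y.normalized n ⊓ F c 0 n := by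
    choose c hc using fun n => hex n (x n)
    let s : Finset ℕ := DFinsupp.support x
    refine ⟨s.sup c, fun n => ⟨hx n, ?_⟩⟩
    by_cases hn : n ∈ s
    · exact hmono _ _ n (Finset.le_sup hn) (hc n)
    · have : x n = 0 := DFinsupp.notMem_support_iff.1 hn
      rw [this]
      exact zero_mem _
  have key : ∀ p, ∃ a ∈ DGVect.sumSub Y.obj Y.altMulti, ∃ z ∈ DGVect.sumSub Y.obj Y.normalized,
      ∃ w ∈ DGVect.sumSub Y.obj fun n => Y.normalized n ⊓ F c p n,
        x = a + Y.cochainsD z + w := by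
    intro p
    induction p with
    | zero => exact ⟨0, zero_mem _, 0, zero_mem _, x, hc, by rw [map_zero, zero_add, zero_add]⟩
    | succ p ih =>
      obtain ⟨a, ha, z, hz, w, hw, h⟩ := ih
      have hdw : Y.cochainsD w ∈ DGVect.sumSub Y.obj Y.altMulti := by
        have : Y.cochainsD w = Y.cochainsD x - Y.cochainsD a := by
          have hdd : Y.cochainsD (Y.cochainsD z) = 0 := Y.cochains.d_d z
          rw [h, map_add, map_add, hdd]
          abel
        rw [this]
        exact sub_mem hd (hAd a ha)
      obtain ⟨a', ha', z', hz', w', hw', h'⟩ :=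
        Y.exists_of_graded (F c p) (F c (p + 1)) (hstep c p) w hw hdw
      refine ⟨a + a', add_mem ha ha', z + z', add_mem hz hz', w', hw', ?_⟩
      rw [h, h', map_add]
      abel
  obtain ⟨p, hp⟩ := hbot c
  obtain ⟨a, ha, z, hz, w, hw, h⟩ := key p
  have hw0 : w = 0 := DFinsupp.ext fun n => by
    have := (hw n).2
    rw [hp n] at this
    exact (Submodule.mem_bot K).1 this
  exact ⟨a, ha, z, hz, by rw [h, hw0, add_zero]⟩

end CommCosimplicial

end totals

/-! ### Smoothness of the spaces of graphs -/

section smooth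

/-- Internal vertices have at least three half-edges. -/
theorem OGraph.Admissible.three_mul_le {n : ℕ} {G : OGraph n} (hG : G.Admissible) :
    3 * G.I ≤ 2 * G.E := by
  classical
  have h : ∑ v : Fin G.I, G.valence (Sum.inr v) ≤ Fintype.card (Fin G.E × Bool) := by
    simp only [valence]
    rw [← Finset.card_biUnion, ← Finset.card_univ]
    · exact Finset.card_le_card (Finset.subset_univ _)
    · intro v _ w _ hvw
      refine Finset.disjoint_left.2 fun x hx hx' => hvw ?_
      rw [mem_half] at hx hx'
      exact Sum.inr_injective (hx.symm.trans hx')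
  have h' : ∑ _v : Fin G.I, 3 ≤ ∑ v : Fin G.I, G.valence (Sum.inr v) :=
    Finset.sum_le_sum fun v _ => hG.1 v
  rw [Finset.sum_const, Finset.card_univ, Fintype.card_fin, smul_eq_mul] at h'
  rw [Fintype.card_prod, Fintype.card_fin, Fintype.card_bool] at h
  omega

variable {K : Type u} [Field K] [CharZero K] {d : ℕ} {C : GraphClass}

/-- The part of a space of graphs spanned by the graphs with at least `p` internal vertices and
with at most `c` more edges than internal vertices. -/
def GraphClass.filtration (K : Type u) [Field K] [CharZero K] (d : ℕ) (C : GraphClass)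
    (c p n : ℕ) : Submodule K ((C.graphs K d).obj n) :=
  (graphSpan K d {1} fun G => C.Mem n G ∧ p ≤ G.I ∧ G.E ≤ c + G.I).comap (C.val n)

/-- The graphs with at least `p` internal vertices and at most `c` more edges than internal
vertices. -/
theorem counts_le (c p : ℕ) : CoreInvariant fun _ G => p ≤ G.I ∧ G.E ≤ c + G.I :=
  coreInvariant_counts fun I E => p ≤ I ∧ E ≤ c + I

theorem exists_mem_filtration {n : ℕ} (y : (C.graphs K d).obj n) :
    ∃ c, y ∈ C.filtration K d c 0 n := by
  have mono : ∀ c c', c ≤ c' → graphSpan K d {1} (fun G => C.Mem n G ∧ 0 ≤ G.I ∧ G.E ≤ c + G.I) ≤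
      graphSpan K d {1} (fun G => C.Mem n G ∧ 0 ≤ G.I ∧ G.E ≤ c' + G.I) := fun c c' h =>
    graphSpan_mono fun G hG => ⟨hG.1, hG.2.1, hG.2.2.trans (Nat.add_le_add_right h _)⟩
  suffices h : ∀ x ∈ graphSpan K d {1} (C.Mem n),
      ∃ c, x ∈ graphSpan K d {1} (fun G => C.Mem n G ∧ 0 ≤ G.I ∧ G.E ≤ c + G.I) from
    h _ (C.val_mem y)
  intro x hx
  induction hx using Submodule.span_induction with
  | mem x hx =>
    obtain ⟨G, hG, rfl⟩ := hx
    exact ⟨G.E, Submodule.subset_span ⟨G, ⟨hG, Nat.zero_le _, Nat.le_add_right _ _⟩, rfl⟩⟩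
  | zero => exact ⟨0, zero_mem _⟩
  | add x y _ _ hx hy =>
    obtain ⟨c, hc⟩ := hx
    obtain ⟨c', hc'⟩ := hy
    exact ⟨c + c', add_mem (mono _ _ (Nat.le_add_right _ _) hc)
      (mono _ _ (Nat.le_add_left _ _) hc')⟩
  | smul a x _ hx =>
    obtain ⟨c, hc⟩ := hx
    exact ⟨c, Submodule.smul_mem _ _ hc⟩

/-- Projections to classes of graphs commute with the structure maps. -/
theorem toGraphs_val_map {R : ∀ n, OGraph n → Prop} (hR : CoreInvariant R) {m n : ℕ}
    (α : Fin m → Option (Fin n)) (y : (C.graphs K d).obj n) :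
    (C.toGraphs hR m ∘ₗ C.val m) ((C.graphs K d).map α y) =
      (C.graphs K d).map α ((C.toGraphs hR n ∘ₗ C.val n) y) :=
  C.toGraphs_pull hR α _

/-- An element of the filtration is the sum of its parts with exactly `p` internal vertices and
of its part with more internal vertices. -/
theorem eq_sum_toGraphs {c p n : ℕ} (y : (C.graphs K d).obj n) (hy : y ∈ C.filtration K d c p n) :
    y = ∑ q ∈ Finset.range (c + p + 1), C.toGraphs (counts_eq p q) n (C.val n y) +
      C.toGraphs (counts_le c (p + 1)) n (C.val n y) := by
  classical
  refine C.val_injective _ ?_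
  rw [map_add, map_sum]
  simp only [C.val_toGraphs]
  have h : C.val n y ∈ LinearMap.eqLocus LinearMap.id
      (∑ q ∈ Finset.range (c + p + 1),
        graphProj K d (CoreInvariant.and C.core (counts_eq p q)) n +
        graphProj K d (CoreInvariant.and C.core (counts_le c (p + 1))) n) := by
    refine graphSpan_induction _ (fun G hG => ?_) hy
    obtain ⟨hG, h1, h2⟩ := hG
    rw [LinearMap.mem_eqLocus, LinearMap.add_apply, LinearMap.sum_apply, LinearMap.id_apply]
    simp only [graphProj_cls]
    by_cases h3 : G.I = p
    · rw [Finset.sum_eq_single_of_mem G.E (Finset.mem_range.2 (by omega)), if_pos ⟨hG, h3, rfl⟩,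
        if_neg, add_zero]
      · rintro ⟨-, h4, -⟩
        omega
      · exact fun q _ hq => if_neg fun h => hq h.2.2.symm
    · rw [Finset.sum_eq_zero, zero_add, if_pos ⟨hG, by omega, h2⟩]
      exact fun q _ => if_neg fun h => h3 h.2.1
  have := LinearMap.mem_eqLocus.1 h
  rw [LinearMap.add_apply, LinearMap.sum_apply] at this
  exact this

/-- The differential raises the number of internal vertices, so it has no part with `p` of them on the
`p`-th step of the filtration. -/
theorem toGraphs_d_eq_zero {c p q n : ℕ} (y : (C.graphs K d).obj n)
    (hy : y ∈ C.filtration K d c p n) :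
    C.toGraphs (counts_eq p q) n (C.val n (((C.graphs K d).obj n).d y)) = 0 := by
  refine C.val_injective _ ?_
  rw [C.val_toGraphs, C.val_d, map_zero]
  have h : diff K d {1} (C.val n y) ∈ graphSpan K d {1} fun G : OGraph n => p + 1 ≤ G.I :=
    diff_mem_of_expand (fun G hG v A _ => Nat.add_le_add_right hG.2.1 1) hy
  exact graphProj_eq_zero (CoreInvariant.and C.core (counts_eq p q)) h fun G hG hG' => by
    have := hG'.2.1
    omega

/-- The spaces of graphs in a class of admissible graphs are smooth. -/
theorem GraphClass.smooth (C : GraphClass) (hC : ∀ n G, C.Mem n G → G.Admissible) :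
    (C.graphs K d).Smooth := by
  refine CommCosimplicial.smooth_of_filtration _ (C.filtration K d) ?_
    (fun n y => exists_mem_filtration y) ?_ ?_
  · intro c c' n h
    exact Submodule.comap_mono (graphSpan_mono fun G hG =>
      ⟨hG.1, hG.2.1, hG.2.2.trans (Nat.add_le_add_right h _)⟩)
  · -- `3 * I ≤ 2 * E ≤ 2 * (c + I)` bounds the number of internal vertices by `2 * c`
    refine fun c => ⟨2 * c + 1, fun n => (Submodule.eq_bot_iff _).2 fun y hy => ?_⟩
    refine C.val_injective _ ?_
    rw [map_zero, ← Submodule.mem_bot K]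
    refine graphSpan_induction _ (fun G hG => ?_) hy
    have := (hC n G hG.1).three_mul_le
    have h1 := hG.2.1
    have h2 := hG.2.2
    omega
  · rintro c p n y ⟨hyN, hyF⟩ y' hy' h
    -- in the part with exactly `p` internal vertices, only the cosimplicial differential remains
    have hq : ∀ q, C.toGraphs (counts_eq p q) (n + 2)
        (C.val _ ((C.graphs K d).cofaceSum (n + 1) y)) ∈ (C.graphs K d).altMulti (n + 2) := by
      intro q
      have h1 := CommCosimplicial.natural_altMulti
        (f := fun n => C.toGraphs (counts_eq p q) n ∘ₗ C.val n)
        (toGraphs_val_map (counts_eq p q)) h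
      rw [map_add, map_smul, LinearMap.comp_apply, LinearMap.comp_apply, toGraphs_d_eq_zero y' hy',
        smul_zero, add_zero] at h1
      exact h1
    choose a ha z hz hz' haz using fun q => exists_eq_add_cofaceSum p q n y hyN (hq q)
    refine ⟨∑ q ∈ Finset.range (c + p + 1), a q, Submodule.sum_mem _ fun q _ => ha q,
      ∑ q ∈ Finset.range (c + p + 1), z q, Submodule.sum_mem _ fun q _ => hz q, ?_, ?_⟩
    · rw [map_sum]
      refine Submodule.sum_mem _ fun q hq => ?_
      rw [Finset.mem_range] at hq
      change C.val n (((C.graphs K d).obj n).d (z q)) ∈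
        graphSpan K d {1} fun G => C.Mem n G ∧ p + 1 ≤ G.I ∧ G.E ≤ c + G.I
      rw [C.val_d]
      refine diff_mem_of_expand (fun G hG v A hA => ⟨C.expand G hG.1 v A hA, ?_⟩) (hz' q)
      obtain ⟨-, h1, h2⟩ := hG
      change p + 1 ≤ G.I + 1 ∧ G.E + 1 ≤ c + (G.I + 1)
      omega
    · have h1 : y - ∑ q ∈ Finset.range (c + p + 1), a q -
          (C.graphs K d).cofaceSum n (∑ q ∈ Finset.range (c + p + 1), z q) =
          C.toGraphs (counts_le c (p + 1)) (n + 1) (C.val _ y) := by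
        have h2 := eq_sum_toGraphs y hyF
        rw [Finset.sum_congr rfl fun q _ => haz q, Finset.sum_add_distrib, ← map_sum] at h2
        rw [sub_sub, sub_eq_iff_eq_add']
        exact h2
      rw [h1]
      refine ⟨?_, ?_⟩
      · exact CommCosimplicial.natural_normalized
          (f := fun n => C.toGraphs (counts_le c (p + 1)) n ∘ₗ C.val n)
          (toGraphs_val_map (counts_le c (p + 1))) hyN
      · exact graphProj_mem' (CoreInvariant.and C.core (counts_le c (p + 1))) _

/-- The class of the admissible graphs. -/
def admissibleGraphs : GraphClass where
  Mem _ G := G.Admissible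
  core _ _ h hG := hG.of_sameCore h
  expand _ hG v A h := hG.expand v A h

/-- The class of the admissible graphs that are connected off the external vertices. -/
def primitiveGraphs : GraphClass where
  Mem _ G := G.Admissible ∧ G.ConnectedOffExt
  core _ _ h hG := ⟨hG.1.of_sameCore h, hG.2.of_sameCore h⟩
  expand _ hG v A h := ⟨hG.1.expand v A h, hG.2.expand v A h⟩

theorem smooth_graphsD : (graphsD K d).Smooth := admissibleGraphs.smooth fun _ _ h => h

theorem smooth_graphsP : (graphsP K d).Smooth := primitiveGraphs.smooth fun _ _ h => h.1

end smooth

/-! ### Connectedness of graphs with univalent external vertices -/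

section connectivity

namespace OGraph

variable {n : ℕ} {G : OGraph n}

theorem extUnivalent_iff : G.ExtUnivalent ↔ IsUnivalent G.ends := by
  refine forall_congr' fun i => ?_
  rw [valence, Finset.card_eq_one]
  constructor
  · rintro ⟨x, hx⟩
    have h : ∀ y, G.ends y = Sum.inl i ↔ y = x := fun y => by
      rw [← mem_half, hx, Finset.mem_singleton]
    exact ⟨x, (h x).2 rfl, fun y hy => (h y).1 hy⟩
  · rintro ⟨x, hx, hx'⟩
    refine ⟨x, Finset.ext fun y => ?_⟩
    rw [mem_half, Finset.mem_singleton]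
    exact ⟨hx' y, fun h => h ▸ hx⟩

theorem ExtUnivalent.act (hG : G.ExtUnivalent) (ρ σ τ φ) : (G.act ρ σ τ φ).ExtUnivalent := by
  intro i
  obtain ⟨i, rfl⟩ := ρ.surjective i
  have h := act_half G ρ σ τ φ (Sum.inl i)
  refine Eq.trans ?_ (hG i)
  refine (congrArg Finset.card h).trans ?_
  simp [valence]

theorem Adj.symm {x y : Fin n ⊕ Fin G.I} (h : G.Adj x y) : G.Adj y x := by
  obtain ⟨e, b, h1, h2⟩ := h
  exact ⟨e, !b, h2, by rwa [Bool.not_not]⟩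

/-- For graphs with univalent external vertices, removing the external vertices from their edges
does not change the connected components. -/
theorem connectedOffExt_iff_isConnected (hG : G.Admissible) (hu : G.ExtUnivalent) :
    G.ConnectedOffExt ↔ G.IsConnected := by
  have hu' := extUnivalent_iff.1 hu
  constructor
  · rintro ⟨hne, hc⟩
    have hn : 0 < n := by
      have hv : ∀ v : Fin G.I, 0 < n := fun v => by
        obtain ⟨i, -⟩ := hG.2 v
        exact i.pos
      obtain ⟨v | e⟩ := hne
      · exact hv v
      · rcases G.ends (e, false) with i | v
        · exact i.pos
        · exact hv v
    let p : Fin G.I ⊕ Fin G.E → Fin n ⊕ Fin G.I := Sum.elim Sum.inr fun e => G.ends (e, false)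
    have hsymm : ∀ {x y}, Relation.ReflTransGen G.Adj x y → Relation.ReflTransGen G.Adj y x :=
      fun h => by
        induction h with
        | refl => exact .refl
        | tail _ h ih => exact .head h.symm ih
    have hend : ∀ e b, Relation.ReflTransGen G.Adj (G.ends (e, b)) (p (Sum.inr e)) := by
      rintro e (_ | _)
      · exact .refl
      · exact .single ⟨e, true, rfl, rfl⟩
    have hp : ∀ x y, Relation.EqvGen G.Incident x y →
        Relation.ReflTransGen G.Adj (p x) (p y) := by
      intro x y h
      induction h with
      | rel x y h =>
        obtain ⟨v, e, b, hv, rfl, rfl⟩ := h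
        have := hend e b
        rwa [hv] at this
      | refl x => exact .refl
      | symm x y _ ih => exact hsymm ih
      | trans x y z _ _ ih1 ih2 => exact ih1.trans ih2
    have hex : ∀ x, ∃ a, Relation.ReflTransGen G.Adj x (p a) := by
      rintro (i | v)
      · obtain ⟨⟨e, b⟩, h, -⟩ := hu' i
        exact ⟨Sum.inr e, h ▸ hend e b⟩
      · exact ⟨Sum.inl v, .refl⟩
    refine ⟨hn, fun x y => ?_⟩
    obtain ⟨a, ha⟩ := hex x
    obtain ⟨b, hb⟩ := hex y
    exact (ha.trans (hp _ _ (hc a b))).trans (hsymm hb)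
  · rintro ⟨hn, hc⟩
    -- the remnants `a` at the vertex `x`: `x` itself, if it is internal, and its edges
    let At : Fin n ⊕ Fin G.I → Fin G.I ⊕ Fin G.E → Prop := fun x a =>
      Sum.elim (fun v => x = Sum.inr v) (fun e => ∃ b, G.ends (e, b) = x) a
    have hAt : ∀ x a a', At x a → At x a' → Relation.EqvGen G.Incident a a' := by
      rintro (i | v) a a' h h'
      · rcases a with w | e
        · cases h
        rcases a' with w' | e'
        · cases h'
        obtain ⟨b, h⟩ := h
        obtain ⟨b', h'⟩ := h'
        obtain rfl : e = e' := congrArg Prod.fst ((hu' i).unique h h')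
        exact .refl _
      · have : ∀ a, At (Sum.inr v) a → Relation.EqvGen G.Incident (Sum.inl v) a := by
          rintro (w | e) h
          · cases h
            exact .refl _
          · obtain ⟨b, h⟩ := h
            exact .rel _ _ ⟨v, e, b, h, rfl, rfl⟩
        exact .trans _ _ _ (.symm _ _ (this a h)) (this a' h')
    have hpath : ∀ x y, Relation.ReflTransGen G.Adj x y → ∀ a b, At x a → At y b →
        Relation.EqvGen G.Incident a b := by
      intro x y h
      induction h with
      | refl => exact hAt x
      | tail _ h ih =>
        obtain ⟨e, c, h1, h2⟩ := h
        exact fun a b ha hb => .trans _ _ _ (ih a (Sum.inr e) ha ⟨c, h1⟩)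
          (hAt _ _ _ ⟨!c, h2⟩ hb)
    have hex : ∀ a, ∃ x, At x a := by
      rintro (v | e)
      · exact ⟨Sum.inr v, rfl⟩
      · exact ⟨_, false, rfl⟩
    refine ⟨?_, fun a b => ?_⟩
    · obtain ⟨x, -⟩ := hu' ⟨0, hn⟩
      exact ⟨Sum.inr x.1⟩
    · obtain ⟨x, hx⟩ := hex a
      obtain ⟨y, hy⟩ := hex b
      exact hpath x y (hc x y) a b hx hy

end OGraph

end connectivity

/-! ### Forgetting the labels of the external vertices -/

section relabel

variable {K : Type u} [Field K] {d : ℕ} {n : ℕ}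

/-- The structure maps of permutations renumber the external vertices. -/
theorem pull_perm_cls (ρ : Equiv.Perm (Fin n)) (G : OGraph n) :
    pull K d (fun j => some (ρ.symm j)) (cls K d {1} G) =
      cls K d {1} (G.act ρ 1 1 fun _ => false) := by
  rw [pull, liftCls_cls, reconnectionSum, Finset.sum_eq_single (Sum.map ρ id ∘ G.ends)]
  · refine congrArg (cls K d {1}) (OGraph.ext rfl rfl (heq_of_eq (funext fun h => ?_)))
    simp
  · intro f hf hne
    refine absurd (funext fun h => ?_) hne
    have := (mem_reconnections _ _ _).1 hf h
    rw [Function.comp_apply]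
    rcases hx : f h with j | v
    · rw [hx] at this
      have h' : Sum.inl (ρ.symm j) = G.ends h := Option.some_injective _ this
      rw [← h']
      simp
    · rw [hx] at this
      have h' : Sum.inr v = G.ends h := Option.some_injective _ this
      rw [← h']
      rfl
  · intro h
    refine absurd ((mem_reconnections _ _ _).2 fun x => ?_) h
    rw [Function.comp_apply]
    rcases G.ends x with i | v <;> simp [extMap]

theorem pull_perm_pull_perm (ρ ρ₀ : Equiv.Perm (Fin n)) (y : GraphSpace K d n {1}) :
    pull K d (fun j => some (ρ.symm j)) (pull K d (fun j => some (ρ₀.symm j)) y) =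
      pull K d (fun j => some ((ρ * ρ₀).symm j)) y := by
  rw [pull_comp]
  rfl

variable (K d n) in
/-- The antisymmetrization in the external vertices. -/
def antisymm : GraphSpace K d n {1} →ₗ[K] GraphSpace K d n {1} :=
  (n.factorial : K)⁻¹ • ∑ ρ : Equiv.Perm (Fin n),
    ((Equiv.Perm.sign ρ : ℤ) : K) • pull K d fun j => some (ρ.symm j)

theorem antisymm_apply (y : GraphSpace K d n {1}) : antisymm K d n y =
    (n.factorial : K)⁻¹ • ∑ ρ : Equiv.Perm (Fin n),
      ((Equiv.Perm.sign ρ : ℤ) : K) • pull K d (fun j => some (ρ.symm j)) y := by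
  simp [antisymm]

theorem antisymm_pull_perm (σ : Equiv.Perm (Fin n)) (y : GraphSpace K d n {1}) :
    antisymm K d n (pull K d (fun j => some (σ.symm j)) y) =
      ((Equiv.Perm.sign σ : ℤ) : K) • antisymm K d n y := by
  rw [antisymm_apply, antisymm_apply, smul_comm]
  congr 1
  rw [Finset.smul_sum]
  refine Fintype.sum_equiv (Equiv.mulRight σ) _ _ fun ρ => ?_
  rw [pull_perm_pull_perm, Equiv.coe_mulRight, smul_smul, Equiv.Perm.sign_mul, Units.val_mul,
    Int.cast_mul, mul_left_comm, sign_mul_sign, mul_one]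

theorem pull_perm_antisymm (σ : Equiv.Perm (Fin n)) (y : GraphSpace K d n {1}) :
    pull K d (fun j => some (σ.symm j)) (antisymm K d n y) =
      ((Equiv.Perm.sign σ : ℤ) : K) • antisymm K d n y := by
  rw [antisymm_apply, map_smul, map_sum, smul_comm]
  congr 1
  rw [Finset.smul_sum]
  refine Fintype.sum_equiv (Equiv.mulLeft σ) _ _ fun ρ => ?_
  rw [map_smul, pull_perm_pull_perm, Equiv.coe_mulLeft, smul_smul, Equiv.Perm.sign_mul,
    Units.val_mul, Int.cast_mul, ← mul_assoc, sign_mul_sign, one_mul]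

theorem antisymm_of_alternating [CharZero K] {y : GraphSpace K d n {1}}
    (hy : ∀ σ : Equiv.Perm (Fin n), pull K d (fun j => some (σ.symm j)) y =
      ((Equiv.Perm.sign σ : ℤ) : K) • y) : antisymm K d n y = y := by
  rw [antisymm_apply]
  simp only [hy, smul_smul, sign_mul_sign]
  rw [Finset.sum_const, Finset.card_univ, Fintype.card_perm, Fintype.card_fin,
    ← Nat.cast_smul_eq_nsmul K, smul_smul,
    inv_mul_cancel₀ (Nat.cast_ne_zero.2 n.factorial_ne_zero), one_smul, one_smul]

theorem forgetLabels_cls (G : OGraph n) :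
    forgetLabels K d n (cls K d {1} G) = cls K d Set.univ G := liftCls_cls _ _ _

theorem forgetLabels_pull_perm (σ : Equiv.Perm (Fin n)) (y : GraphSpace K d n {1}) :
    forgetLabels K d n (pull K d (fun j => some (σ.symm j)) y) =
      ((Equiv.Perm.sign σ : ℤ) : K) • forgetLabels K d n y := by
  have : forgetLabels K d n ∘ₗ pull K d (fun j => some (σ.symm j)) =
      ((Equiv.Perm.sign σ : ℤ) : K) • forgetLabels K d n := by
    refine hom_ext fun G => ?_
    rw [LinearMap.comp_apply, pull_perm_cls, LinearMap.smul_apply, forgetLabels_cls,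
      forgetLabels_cls, cls_act K d G σ (Set.mem_univ σ)]
    simp [orientSign]
  exact LinearMap.congr_fun this y

theorem forgetLabels_antisymm [CharZero K] (y : GraphSpace K d n {1}) :
    forgetLabels K d n (antisymm K d n y) = forgetLabels K d n y := by
  rw [antisymm_apply, map_smul, map_sum]
  simp only [map_smul, forgetLabels_pull_perm, smul_smul, sign_mul_sign]
  rw [Finset.sum_const, Finset.card_univ, Fintype.card_perm, Fintype.card_fin,
    ← Nat.cast_smul_eq_nsmul K, smul_smul,
    inv_mul_cancel₀ (Nat.cast_ne_zero.2 n.factorial_ne_zero), one_smul, one_smul]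

variable (K d n) in
/-- The section of the map that forgets the labels of the external vertices, given by
antisymmetrization. -/
def labelings : GraphSpace K d n Set.univ →ₗ[K] GraphSpace K d n {1} :=
  liftCls K d (fun G => antisymm K d n (cls K d {1} G)) (by
    intro G ρ σ τ φ _
    have h : cls K d {1} (G.act ρ σ τ φ) = pull K d (fun j => some (ρ.symm j))
        (cls K d {1} (G.act 1 σ τ φ)) := by
      rw [pull_perm_cls]
      refine congrArg (cls K d {1}) (OGraph.ext rfl rfl (heq_of_eq (funext fun h => ?_)))
      simp [Sum.map_map]
    rw [h, antisymm_pull_perm, cls_act K d G 1 (Set.mem_singleton 1), map_smul, smul_smul]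
    simp)

theorem labelings_cls (G : OGraph n) :
    labelings K d n (cls K d Set.univ G) = antisymm K d n (cls K d {1} G) := liftCls_cls _ _ _

theorem labelings_forgetLabels (y : GraphSpace K d n {1}) :
    labelings K d n (forgetLabels K d n y) = antisymm K d n y := by
  have : labelings K d n ∘ₗ forgetLabels K d n = antisymm K d n := hom_ext fun G => by
    rw [LinearMap.comp_apply, forgetLabels_cls, labelings_cls]
  exact LinearMap.congr_fun this y

theorem forgetLabels_labelings [CharZero K] (x : GraphSpace K d n Set.univ) :
    forgetLabels K d n (labelings K d n x) = x := by
  have : forgetLabels K d n ∘ₗ labelings K d n = LinearMap.id := hom_ext fun G => by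
    rw [LinearMap.comp_apply, labelings_cls, forgetLabels_antisymm, forgetLabels_cls,
      LinearMap.id_apply]
  exact LinearMap.congr_fun this x

theorem pull_perm_labelings (σ : Equiv.Perm (Fin n)) (x : GraphSpace K d n Set.univ) :
    pull K d (fun j => some (σ.symm j)) (labelings K d n x) =
      ((Equiv.Perm.sign σ : ℤ) : K) • labelings K d n x := by
  have : pull K d (fun j => some (σ.symm j)) ∘ₗ labelings K d n =
      ((Equiv.Perm.sign σ : ℤ) : K) • labelings K d n := hom_ext fun G => by
    rw [LinearMap.comp_apply, LinearMap.smul_apply, labelings_cls, pull_perm_antisymm]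
  exact LinearMap.congr_fun this x

theorem forgetLabels_diff (y : GraphSpace K d n {1}) :
    forgetLabels K d n (diff K d {1} y) = diff K d Set.univ (forgetLabels K d n y) := by
  have : forgetLabels K d n ∘ₗ diff K d {1} = diff K d Set.univ ∘ₗ forgetLabels K d n := by
    refine hom_ext fun G => ?_
    rw [LinearMap.comp_apply, LinearMap.comp_apply, forgetLabels_cls, diff, diff, liftCls_cls,
      liftCls_cls, expansionSum, expansionSum, map_sum]
    refine Finset.sum_congr rfl fun v _ => ?_
    rw [map_sum]
    refine Finset.sum_congr rfl fun A _ => ?_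
    split_ifs
    · rw [map_smul, forgetLabels_cls]
    · rw [map_zero]
  exact LinearMap.congr_fun this y

theorem forgetLabels_mem {P : OGraph n → Prop} {y : GraphSpace K d n {1}}
    (hy : y ∈ graphSpan K d {1} P) : forgetLabels K d n y ∈ graphSpan K d Set.univ P := by
  refine graphSpan_induction ((graphSpan K d Set.univ P).comap (forgetLabels K d n))
    (fun G hG => ?_) hy
  rw [Submodule.mem_comap, forgetLabels_cls]
  exact Submodule.subset_span ⟨G, hG, rfl⟩

theorem labelings_mem {P : OGraph n → Prop}
    (hP : ∀ G (ρ : Equiv.Perm (Fin n)), P G → P (G.act ρ 1 1 fun _ => false))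
    {x : GraphSpace K d n Set.univ}
    (hx : x ∈ graphSpan K d Set.univ P) : labelings K d n x ∈ graphSpan K d {1} P := by
  refine graphSpan_induction ((graphSpan K d {1} P).comap (labelings K d n))
    (fun G hG => ?_) hx
  rw [Submodule.mem_comap, labelings_cls, antisymm_apply]
  refine Submodule.smul_mem _ _ (Submodule.sum_mem _ fun ρ _ => Submodule.smul_mem _ _ ?_)
  rw [pull_perm_cls]
  exact Submodule.subset_span ⟨_, hP G ρ hG, rfl⟩

end relabel

/-! ### Coefficients of alternating multiderivations -/

section coefficientsOfAltMulti

variable {K : Type u} [Field K] {d : ℕ}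

theorem fromAttach_single {n I E : ℕ} (e : Fin E × Bool → Fin n ⊕ Fin I) [DecidableEq (Fin E × Bool → Fin n ⊕ Fin I)] :
    fromAttach K d n I E (Pi.single e 1) = cls K d {1} ⟨I, E, e⟩ := by
  rw [fromAttach_apply, Finset.sum_eq_single e]
  · rw [Pi.single_eq_same, one_smul]
  · intro e' _ h
    rw [Pi.single_eq_of_ne h, zero_smul]
  · simp

/-- The graphs with univalent external vertices are multiderivations. -/
theorem pull_mergeMap_of_extUnivalent {n : ℕ} {y : GraphSpace K d n {1}}
    (hy : y ∈ graphSpan K d {1} (OGraph.ExtUnivalent (n := n))) (i : Fin n) :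
    pull K d (mergeMap i) y = pull K d (splitMap i.castSucc) y + pull K d (splitMap i.succ) y := by
  classical
  have h : y ∈ LinearMap.eqLocus (pull K d (mergeMap i))
      (pull K d (splitMap i.castSucc) + pull K d (splitMap i.succ)) := by
    refine graphSpan_induction _ (fun G hG => ?_) hy
    rw [LinearMap.mem_eqLocus, LinearMap.add_apply, ← fromAttach_single (K := K) (d := d) G.ends,
      ← fromAttach_pull, ← fromAttach_pull, ← fromAttach_pull, ← map_add]
    refine congrArg _ (isMultiderivation_of_isUnivalent (fun e he => ?_) i)
    have : e = G.ends := by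
      by_contra hne
      exact he (Pi.single_eq_of_ne hne _)
    rw [this]
    exact extUnivalent_iff.1 hG
  exact LinearMap.mem_eqLocus.1 h

/-- An element of the space of graphs is the sum of its parts with given numbers of internal vertices
and of edges, which are determined by its coefficients. -/
theorem exists_sum_fromAttach [CharZero K] {n : ℕ} (y : GraphSpace K d n {1}) :
    ∃ s : Finset (ℕ × ℕ), ∑ p ∈ s, fromAttach K d n p.1 p.2 (toAttach K d n p.1 p.2 y) = y := by
  classical
  suffices h : ∃ s : Finset (ℕ × ℕ), ∀ t, s ⊆ t →
      ∑ p ∈ t, fromAttach K d n p.1 p.2 (toAttach K d n p.1 p.2 y) = y from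
    h.imp fun s hs => hs s subset_rfl
  induction graphSpan_top y using Submodule.span_induction with
  | mem x hx =>
    obtain ⟨G, -, rfl⟩ := hx
    refine ⟨{(G.I, G.E)}, fun t ht => ?_⟩
    rw [Finset.sum_eq_single_of_mem (G.I, G.E) (ht (Finset.mem_singleton_self _)),
      fromAttach_toAttach_cls, if_pos ⟨rfl, rfl⟩]
    intro p _ hp
    rw [fromAttach_toAttach_cls, if_neg]
    rintro ⟨h1, h2⟩
    exact hp (Prod.ext h1.symm h2.symm)
  | zero => exact ⟨∅, fun t _ => by simp⟩
  | add x y _ _ hx hy =>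
    obtain ⟨s, hs⟩ := hx
    obtain ⟨t, ht⟩ := hy
    refine ⟨s ∪ t, fun r hr => ?_⟩
    simp only [map_add, Finset.sum_add_distrib]
    rw [hs r (Finset.union_subset_left hr), ht r (Finset.union_subset_right hr)]
  | smul a x _ hx =>
    obtain ⟨s, hs⟩ := hx
    refine ⟨s, fun t ht => ?_⟩
    simp only [map_smul, ← Finset.smul_sum]
    rw [hs t ht]

theorem toAttach_eq_zero {n I E : ℕ} {P : OGraph n → Prop}
    (hP : ∀ G σ τ φ, P G → P (G.act 1 σ τ φ)) {y : GraphSpace K d n {1}}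
    (hy : y ∈ graphSpan K d {1} P) (e : Fin E × Bool → Fin n ⊕ Fin I) (he : ¬ P ⟨I, E, e⟩) :
    toAttach K d n I E y e = 0 := by
  have h : y ∈ LinearMap.ker (LinearMap.proj e ∘ₗ toAttach K d n I E) := by
    refine graphSpan_induction _ (fun G hG => ?_) hy
    rw [LinearMap.mem_ker, LinearMap.comp_apply, toAttach_cls, LinearMap.proj_apply, attachCoeff,
      Finset.sum_eq_zero, mul_zero]
    refine fun g _ => if_neg fun hg => he ?_
    rw [← hg]
    exact hP G _ _ _ hG
  exact h

variable [CharZero K] {C : GraphClass}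

/-- The alternating multiderivations are spanned by graphs with univalent external vertices. -/
theorem mem_graphSpan_of_altMulti {n : ℕ} {y : (C.graphs K d).obj n}
    (hy : y ∈ (C.graphs K d).altMulti n) :
    C.val n y ∈ graphSpan K d {1} fun G => C.Mem n G ∧ G.ExtUnivalent := by
  obtain ⟨s, hs⟩ := exists_sum_fromAttach (C.val n y)
  rw [← hs]
  refine Submodule.sum_mem _ fun p _ => ?_
  rw [fromAttach_apply]
  refine Submodule.sum_mem _ fun e _ => ?_
  by_cases he : toAttach K d n p.1 p.2 (C.val n y) e = 0
  · rw [he, zero_smul]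
    exact zero_mem _
  · refine Submodule.smul_mem _ _ (Submodule.subset_span ⟨_, ⟨?_, ?_⟩, rfl⟩)
    · by_contra hM
      exact he (toAttach_eq_zero (fun G σ τ φ => C.core _ _ (sameCore_act G 1 σ τ φ))
        (C.val_mem y) e hM)
    · refine extUnivalent_iff.2 ?_
      have hf : ∀ {m n : ℕ} (α : Fin m → Option (Fin n)) (y : (C.graphs K d).obj n),
          (toAttach K d m p.1 p.2 ∘ₗ C.val m) ((C.graphs K d).map α y) =
            (attachments K (Fin p.2 × Bool) p.1).map α ((toAttach K d n p.1 p.2 ∘ₗ C.val n) y) :=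
        fun α y => toAttach_pull α p.1 p.2 _
      have h1 := CommCosimplicial.natural_altMulti
        (Z := attachments K (Fin p.2 × Bool) p.1)
        (f := fun n => toAttach K d n p.1 p.2 ∘ₗ C.val n) hf hy
      exact isUnivalent_of_isMultiderivation h1.2
        (CommCosimplicial.altMulti_le_normalized _ _ h1) e he

/-- The forgetful map is injective on the alternating multiderivations, as they can be recovered by
antisymmetrization. -/
theorem injective_forgetLabels {n : ℕ} {y : (C.graphs K d).obj n}
    (hy : y ∈ (C.graphs K d).altMulti n) (h : forgetLabels K d n (C.val n y) = 0) : y = 0 := by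
  refine C.val_injective _ ?_
  have h1 : ∀ σ : Equiv.Perm (Fin n), pull K d (fun j => some (σ.symm j)) (C.val n y) =
      ((Equiv.Perm.sign σ : ℤ) : K) • C.val n y := fun σ => by
    rw [← C.val_map, hy.1 σ, map_smul]
  rw [← antisymm_of_alternating h1, ← labelings_forgetLabels, h, map_zero, map_zero]

/-- The antisymmetrization of a graph with unlabelled univalent external vertices is an alternating
multiderivation. -/
theorem exists_forgetLabels_eq {n : ℕ} {x : GraphSpace K d n Set.univ}
    (hx : x ∈ graphSpan K d Set.univ fun G => C.Mem n G ∧ G.ExtUnivalent) :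
    ∃ y ∈ (C.graphs K d).altMulti n, forgetLabels K d n (C.val n y) = x := by
  have h1 : labelings K d n x ∈ graphSpan K d {1} fun G => C.Mem n G ∧ G.ExtUnivalent :=
    labelings_mem (fun G ρ hG => ⟨C.core _ _ (sameCore_act G ρ 1 1 _) hG.1, hG.2.act ρ 1 1 _⟩) hx
  obtain ⟨y, hy⟩ : ∃ y, C.val (K := K) (d := d) n y = labelings K d n x :=
    ⟨⟨_, graphSpan_mono (fun _ h => h.1) h1⟩, rfl⟩
  refine ⟨y, ⟨fun σ => C.val_injective _ ?_, fun i => C.val_injective _ ?_⟩, ?_⟩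
  · rw [C.val_map, map_smul, hy, pull_perm_labelings]
  · rw [map_add, C.val_map, C.val_map, C.val_map, hy]
    exact pull_mergeMap_of_extUnivalent (graphSpan_mono (fun _ h => h.2) h1) i
  · rw [hy, forgetLabels_labelings]

end coefficientsOfAltMulti

/-! ### The isomorphisms with the complexes of unlabelled graphs -/

section isomorphism

/-- The alternating multiderivations in `Y` are isomorphic to a subcomplex of the sum of the complexes
`Zₙ[-n]` if they are so in every cosimplicial degree, as the differential of `AM(Y)` has no
cosimplicial part. -/
theorem exists_AM_iso {K : Type u} [Field K] (Y : CommCosimplicial K) (Z : ℕ → DGVect K)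
    (h1 : ∀ n k, ∀ x ∈ (Z n).deg k, (0 : Z n →ₗ[K] Z (n + 1)) x ∈ (Z (n + 1)).deg k)
    (h2 : ∀ n x, (0 : Z n →ₗ[K] Z (n + 1)) ((Z n).d x) = (Z (n + 1)).d ((0 : Z n →ₗ[K] Z (n + 1)) x))
    (h3 : ∀ n (x : Z n), (0 : Z (n + 1) →ₗ[K] Z (n + 1 + 1)) ((0 : Z n →ₗ[K] Z (n + 1)) x) = 0)
    (T : ∀ n, Submodule K (Z n))
    (hS : (DGVect.total Z (fun _ => 0) h1 h2 h3).Homogeneous (DGVect.sumSub Z T))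
    (hd : ∀ x ∈ DGVect.sumSub Z T, (DGVect.total Z (fun _ => 0) h1 h2 h3).d x ∈ DGVect.sumSub Z T)
    (f : ∀ n, Y.obj n →ₗ[K] Z n) (hdeg : ∀ n k, ∀ y ∈ (Y.obj n).deg k, f n y ∈ (Z n).deg k)
    (hfd : ∀ n y, f n ((Y.obj n).d y) = (Z n).d (f n y))
    (hmem : ∀ n, ∀ y ∈ Y.altMulti n, f n y ∈ T n)
    (hinj : ∀ n, ∀ y ∈ Y.altMulti n, f n y = 0 → y = 0)
    (hsurj : ∀ n, ∀ x ∈ T n, ∃ y ∈ Y.altMulti n, f n y = x) :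
    ∃ e : DGVect.Iso Y.AM ((DGVect.total Z (fun _ => 0) h1 h2 h3).sub (DGVect.sumSub Z T) hS hd),
      ∀ x, DGVect.subVal (DGVect.total Z (fun _ => 0) h1 h2 h3) (DGVect.sumSub Z T) hS hd
        (e.toEquiv x) = (DFinsupp.mapRange.linearMap f : (⨁ n, Y.obj n) →ₗ[K] (⨁ n, Z n))
          (Subtype.val (p := fun x => x ∈ DGVect.sumSub Y.obj Y.altMulti) x) := by
  classical
  let F : (⨁ n, Y.obj n) →ₗ[K] (⨁ n, Z n) := DFinsupp.mapRange.linearMap f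
  have hF : ∀ x n, F x n = f n (x n) := fun x n => rfl
  have hFl : ∀ n (y : Y.obj n), F (DirectSum.lof K ℕ (fun n => (Y.obj n).carrier) n y) =
      DirectSum.lof K ℕ (fun n => (Z n).carrier) n (f n y) := fun n y => by
    refine (DFinsupp.mapRange_single (hf := fun n => map_zero (f n))).trans rfl
  let A := DGVect.sumSub Y.obj Y.altMulti
  let B := DGVect.sumSub Z T
  let g : A →ₗ[K] B := F.restrict fun x hx n => hmem n _ (hx n)
  have hg : Function.Bijective g := by
    constructor
    · refine (injective_iff_map_eq_zero _).2 ?_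
      rintro ⟨x, hx⟩ hgx
      have hFx : F x = 0 := congrArg Subtype.val hgx
      refine Subtype.ext (DFinsupp.ext fun n => hinj n _ (hx n) ?_)
      rw [← hF, hFx]
      rfl
    · rintro ⟨z, hz⟩
      choose y hy hyz using fun n => hsurj n (z n) (hz n)
      obtain ⟨s, hs⟩ := DGVect.eq_sum_lof Z z
      refine ⟨⟨∑ n ∈ s, DirectSum.lof K ℕ (fun n => (Y.obj n).carrier) n (y n),
        Submodule.sum_mem _ fun n _ => DGVect.lof_mem_sumSub Y.obj _ n _ (hy n)⟩,
        Subtype.ext ?_⟩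
      change F (∑ n ∈ s, _) = z
      rw [map_sum, hs]
      refine Finset.sum_congr rfl fun n _ => ?_
      rw [hFl, hyz]
  have hcomm : ∀ x ∈ A, F (Y.cochainsD x) = DGVect.totalD Z (fun _ => 0) (F x) := by
    intro x hx
    obtain ⟨s, hs⟩ := DGVect.eq_sum_lof Y.obj x
    rw [hs]
    simp only [map_sum]
    refine Finset.sum_congr rfl fun n _ => ?_
    rw [hFl, DGVect.totalD_lof, DGVect.totalD_lof, Y.cofaceSum_altMulti n _ (hx n), map_zero,
      zero_add, map_smul, hFl, hfd, LinearMap.zero_apply, map_zero, zero_add]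
  refine ⟨⟨LinearEquiv.ofBijective g hg, ?_, ?_⟩, fun x => rfl⟩
  · rintro k ⟨(x : ⨁ n, Y.obj n), hx⟩
    constructor
    · intro h n
      have h4 : f n (x n) ∈ (Z n).deg (k + n) := h n
      have h5 : f n ((Y.obj n).proj (k + n) (x n) - x n) = 0 := by
        rw [map_sub, DGVect.map_proj (f n) (hdeg n), (Z n).proj_self _ _ h4, sub_self]
      have h6 := hinj n _ (sub_mem (Y.homogeneous_altMulti n _ (hx n) _) (hx n)) h5
      have h7 := (Y.obj n).proj_mem (k + n) (x n)
      rw [sub_eq_zero.1 h6] at h7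
      exact h7
    · exact fun h n => hdeg n _ _ (h n)
  · rintro ⟨x, hx⟩
    exact Subtype.ext (hcomm x hx)

theorem forgetLabels_deg {K : Type u} [Field K] {d n : ℕ} (k : ℤ) :
    ∀ y ∈ graphDeg K d {1} k, forgetLabels K d n y ∈ graphDeg K d Set.univ k := by
  exact fun y hy => forgetLabels_mem (P := fun G => G.degree d = k) hy

variable {K : Type u} [Field K] [CharZero K] {d : ℕ}

/-- The map that forgets the labels of the external vertices, on the graphs in a class. -/
def GraphClass.forget (K : Type u) [Field K] [CharZero K] (d : ℕ) (C : GraphClass) (n : ℕ) :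
    (C.graphs K d).obj n →ₗ[K] allGraphs K d n Set.univ (Set.mem_univ 1) :=
  forgetLabels K d n ∘ₗ C.val n

theorem exists_iso_uniGraphs : ∃ e : DGVect.Iso (graphsD K d).AM (uniGraphs K d),
    ∀ x, uniGraphsIncl K d (e.toEquiv x) = forgetD K d x :=
  exists_AM_iso (admissibleGraphs.graphs K d) (fun n => allGraphs K d n Set.univ (Set.mem_univ 1))
    _ _ _ (fun _ => graphSpan K d Set.univ fun G => G.Admissible ∧ G.ExtUnivalent) _ _
    (admissibleGraphs.forget K d)
    (fun _ k _ hy => forgetLabels_deg k _ hy) (fun _ _ => forgetLabels_diff _)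
    (fun _ _ hy => graphSpan_mono (fun _ hG => ⟨hG.1, hG.2⟩)
      (forgetLabels_mem (mem_graphSpan_of_altMulti hy)))
    (fun _ _ hy h => injective_forgetLabels hy h)
    (fun _ _ hx => exists_forgetLabels_eq (graphSpan_mono (fun _ hG => ⟨hG.1, hG.2⟩) hx))

theorem primitiveGraphs_extUnivalent_iff {n : ℕ} (G : OGraph n) :
    primitiveGraphs.Mem n G ∧ G.ExtUnivalent ↔ G.Admissible ∧ G.ExtUnivalent ∧ G.IsConnected :=
  ⟨fun h => ⟨h.1.1, h.2, (connectedOffExt_iff_isConnected h.1.1 h.2).1 h.1.2⟩,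
    fun h => ⟨⟨h.1, (connectedOffExt_iff_isConnected h.1 h.2.1).2 h.2.2⟩, h.2.1⟩⟩

theorem exists_iso_connectedUniGraphs :
    ∃ e : DGVect.Iso (graphsP K d).AM (connectedUniGraphs K d),
      ∀ x, connectedUniGraphsIncl K d (e.toEquiv x) = forgetP K d x :=
  exists_AM_iso (primitiveGraphs.graphs K d) (fun n => allGraphs K d n Set.univ (Set.mem_univ 1))
    _ _ _ (fun _ => graphSpan K d Set.univ fun G =>
      G.Admissible ∧ G.ExtUnivalent ∧ G.IsConnected) _ _
    (primitiveGraphs.forget K d)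
    (fun _ k _ hy => forgetLabels_deg k _ hy) (fun _ _ => forgetLabels_diff _)
    (fun _ _ hy => graphSpan_mono (fun G hG => (primitiveGraphs_extUnivalent_iff G).1 hG)
      (forgetLabels_mem (mem_graphSpan_of_altMulti hy)))
    (fun _ _ hy h => injective_forgetLabels hy h)
    (fun _ _ hx => exists_forgetLabels_eq
      (graphSpan_mono (fun G hG => (primitiveGraphs_extUnivalent_iff G).2 hG) hx))

end isomorphism

end GC

end

theorem theorem10p1 {K : Type*} [Field K] [CharZero K] (d : ℕ) :
    (GC.graphsD K d).Smooth ∧ (GC.graphsP K d).Smooth ∧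
    (∃ e : GC.DGVect.Iso (GC.graphsD K d).AM (GC.uniGraphs K d),
      ∀ x, GC.uniGraphsIncl K d (e.toEquiv x) = GC.forgetD K d x) ∧
    (∃ e : GC.DGVect.Iso (GC.graphsP K d).AM (GC.connectedUniGraphs K d),
      ∀ x, GC.connectedUniGraphsIncl K d (e.toEquiv x) = GC.forgetP K d x) :=
  ⟨GC.smooth_graphsD, GC.smooth_graphsP, GC.exists_iso_uniGraphs, GC.exists_iso_connectedUniGraphs⟩
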